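/- Consider the two-component long-wave--short-wave resonant interaction (2-LSRI) system $$iA_t-A_{xx}+LA=0,\qquad iB_t-B_{xx}+LB=0,\qquad L_t=2(\delta_1|A|^2+\delta_2|B|^2)_x,$$ with $\delta_1,\delta_2\in\mathbb R$, complex $A,B$ and real $L$. Let $\rho_1,\rho_2,k_1,k_2,\gamma\in\mathbb R$ and $$\mathcal Q(p)=\frac{\delta_1\rho_1^2}{p-ik_1}+\frac{\delta_2\rho_2^2}{p-ik_2}+ip^2 .$$ Let $p_0^{(1)}\ne p_0^{(2)}$ be two simple roots of $\mathcal Q'(p)=0$ with $\operatorname{Re}p_0^{(1)}>0$, $\operatorname{Re}p_0^{(2)}>0$, and let $N_1,N_2$ be positive integers. Then $\mathcal Q(p_0^{(\alpha)})\neq0$, the local holomorphic branches named below exist, and for either of the following two choices (a), (b) of the matrix elements, with $$\tau_{n,k}=\det\begin{pmatrix}\tau^{[1,1]}_{n,k}&\tau^{[1,2]}_{n,k}\\ \tau^{[2,1]}_{n,k}&\tau^{[2,2]}_{n,k}\end{pmatrix},\qquad \tau^{[\alpha,\beta]}_{n,k}=\bigl(m^{(n,k,\alpha,\beta)}_{2s-1,2j-1}\bigr)_{1\le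 s\le N_\alpha,\,1\le j\le N_\beta},$$ the function $f=\tau_{0,0}(x,t)$ is real and positive on $\mathbb R^2$, and with $g=\tau_{1,0}$, $h=\tau_{0,1}$ the functions $$A=\rho_1e^{i(k_1x+(\gamma+k_1^2)t)}\frac gf,\qquad B=\rho_2e^{i(k_2x+(\gamma+k_2^2)t)}\frac hf,\qquad L=\gamma-2(\log f)_{xx}$$ form a smooth solution of the 2-LSRI system on $\mathbb R^2$, a mixed bounded $(N_1,N_2)$-th order rogue wave: $A,B,L$ are bounded and $|A|\to|\rho_1|$, $|B|\to|\rho_2|$, $L\to\gamma$ as $(x,t)\to\infty$ in $\mathbb R^2$. (a) Differential operator form. For $\alpha=1,2$ let $\mathcal T_\alpha$ be a holomorphic branch near $p_0^{(\alpha)}$ of $\sqrt{(\mathcal Q^2(p)-\mathcal Q^2(p_0^{(\alpha)}))/\mathcal Q'(p)^2}$, let $\mathcal W_\alpha$ be a holomorphic branch near $p_0^{(\alpha)}$ of $\bigl(\mathcal Q(p)\pm\sqrt{\mathcal Q^2(p)-\mathcal Q^2(p_0^{(\alpha)})}\bigr)/\mathcal Q(p_0^{(\alpha)})$, let $\hat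 a_{r,\alpha}$ $(r\ge1)$ be complex constants such that $\sum_r\hat a_{r,\alpha}z^r$ has positive radius of convergence, and put $\xi_\alpha(p)=px-ip^2t+\sum_{r\ge1}\hat a_{r,\alpha}\ln^r\mathcal W_\alpha(p)$. Write $F^*(q)=\overline{F(\bar q)}$. Then $$m^{(n,k,\alpha,\beta)}_{s,j}=\frac{[\mathcal T_\alpha(p)\partial_p]^s}{s!}\frac{[\mathcal T_\beta^*(q)\partial_q]^j}{j!}\left[\frac1{p+q}\Bigl(-\frac{p-ik_1}{q+ik_1}\Bigr)^n\Bigl(-\frac{p-ik_2}{q+ik_2}\Bigr)^k e^{\xi_\alpha(p)+\xi_\beta^*(q)}\right]_{p=p_0^{(\alpha)},\;q=\overline{p_0^{(\beta)}}}.$$ (b) Schur polynomial form. Let $p^{(\alpha)}(\kappa)$ be a holomorphic solution near $\kappa=0$ of $\mathcal Q(p^{(\alpha)}(\kappa))=\mathcal Q(p_0^{(\alpha)})\cosh\kappa$, $p^{(\alpha)}(0)=p_0^{(\alpha)}$, let $a_{r,\alpha}$ $(r\ge1)$ be arbitrary complex constants, and let $\mathbf S_j$ be given by $\sum_{j\ge0}\mathbf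 S_j(\mathbf x)\epsilon^j=\exp\bigl(\sum_{r\ge1}x_r\epsilon^r\bigr)$. Then $$m^{(n,k,\alpha,\beta)}_{s,j}=\sum_{\nu=0}^{\min(s,j)}\frac1{p_0^{(\alpha)}+\overline{p_0^{(\beta)}}}\left[\frac{\lambda_{1,\alpha}\overline{\lambda_{1,\beta}}}{\bigl(p_0^{(\alpha)}+\overline{p_0^{(\beta)}}\bigr)^2}\right]^\nu\mathbf S_{s-\nu}(\mathbf x^+_{\alpha,\beta}+\nu\mathbf s_{\alpha,\beta})\,\mathbf S_{j-\nu}(\mathbf x^-_{\alpha,\beta}+\nu\overline{\mathbf s_{\beta,\alpha}}),$$ $$x^+_{r,\alpha,\beta}=\lambda_{r,\alpha}x-i\beta_{r,\alpha}t+n\theta^{(1)}_{r,\alpha}+k\theta^{(2)}_{r,\alpha}-b_{r,\alpha,\beta}+a_{r,\alpha},$$ $$x^-_{r,\alpha,\beta}=\overline{\lambda_{r,\beta}}x+i\overline{\beta_{r,\beta}}t-n\overline{\theta^{(1)}_{r,\beta}}-k\overline{\theta^{(2)}_{r,\beta}}-\overline{b_{r,\beta,\alpha}}+\overline{a_{r,\beta}},$$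 where $\lambda_{r,\alpha},\beta_{r,\alpha},\theta^{(\ell)}_{r,\alpha},b_{r,\alpha,\beta},s_{r,\alpha,\beta}$ are the coefficients of $\kappa^r$, $r\ge1$, in the Taylor expansions at $\kappa=0$ of, respectively, $$p^{(\alpha)}(\kappa)-p_0^{(\alpha)},\quad p^{(\alpha)}(\kappa)^2-p_0^{(\alpha)2},\quad \ln\frac{p^{(\alpha)}(\kappa)-ik_\ell}{p_0^{(\alpha)}-ik_\ell},\quad \ln\frac{p^{(\alpha)}(\kappa)+\overline{p_0^{(\beta)}}}{p_0^{(\alpha)}+\overline{p_0^{(\beta)}}},\quad \ln\left[\frac1\kappa\,\frac{p_0^{(\alpha)}+\overline{p_0^{(\beta)}}}{\lambda_{1,\alpha}}\,\frac{p^{(\alpha)}(\kappa)-p_0^{(\alpha)}}{p^{(\alpha)}(\kappa)+\overline{p_0^{(\beta)}}}\right].$$ -/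

import Mathlib

open scoped ContDiff ComplexConjugate Nat

noncomputable section

namespace TwoLSRI

/-- The real constants: coefficients `δ₁, δ₂` of the system, amplitudes `ρ₁, ρ₂` and wave numbers
`k₁, k₂` of the plane-wave background, and the background value `γ` of the long wave. -/
structure Params where
  δ₁ : ℝ
  δ₂ : ℝ
  ρ₁ : ℝ
  ρ₂ : ℝ
  k₁ : ℝ
  k₂ : ℝ
  γ : ℝ

/-- `A`, `B`, `L` (functions of `x` and `t`, in this order) form a smooth solution, on the whole
plane, of the two-component long-wave--short-wave resonant interaction system
`i A_t - A_xx + L A = 0`, `i B_t - B_xx + L B = 0`, `L_t = 2 (δ₁ |A|² + δ₂ |B|²)_x`. -/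
structure IsSolution (δ₁ δ₂ : ℝ) (A B : ℝ → ℝ → ℂ) (L : ℝ → ℝ → ℝ) : Prop where
  smooth_A : ContDiff ℝ ∞ (fun z : ℝ × ℝ => A z.1 z.2)
  smooth_B : ContDiff ℝ ∞ (fun z : ℝ × ℝ => B z.1 z.2)
  smooth_L : ContDiff ℝ ∞ (fun z : ℝ × ℝ => L z.1 z.2)
  eq_A : ∀ x t : ℝ, Complex.I * deriv (fun t' => A x t') t
      - iteratedDeriv 2 (fun x' => A x' t) x + (L x t : ℂ) * A x t = 0
  eq_B : ∀ x t : ℝ, Complex.I * deriv (fun t' => B x t') t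
      - iteratedDeriv 2 (fun x' => B x' t) x + (L x t : ℂ) * B x t = 0
  eq_L : ∀ x t : ℝ, deriv (fun t' => L x t') t
      = 2 * deriv (fun x' => δ₁ * ‖A x' t‖ ^ 2 + δ₂ * ‖B x' t‖ ^ 2) x

/-- `𝒬(p) = δ₁ρ₁² / (p - i k₁) + δ₂ρ₂² / (p - i k₂) + i p²`. -/
def Q (c : Params) (p : ℂ) : ℂ :=
  (c.δ₁ : ℂ) * (c.ρ₁ : ℂ) ^ 2 / (p - Complex.I * c.k₁)
    + (c.δ₂ : ℂ) * (c.ρ₂ : ℂ) ^ 2 / (p - Complex.I * c.k₂) + Complex.I * p ^ 2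

/-- `p₀` is a simple root of `𝒬'(p) = 0`. Used only for `p₀` off the imaginary axis, where `𝒬` is
holomorphic. -/
def IsSimpleRoot (c : Params) (p₀ : ℂ) : Prop :=
  deriv (Q c) p₀ = 0 ∧ deriv (deriv (Q c)) p₀ ≠ 0

/-- The conjugate function `q ↦ (F (q*))*`; holomorphic near `p₀*` when `F` is so near `p₀`. -/
def conjFun (F : ℂ → ℂ) (q : ℂ) : ℂ := conj (F (conj q))

/-! ### Local holomorphic branches -/

/-- `T` is, near `p₀`, a holomorphic branch of `√((𝒬(p)² - 𝒬(p₀)²) / 𝒬'(p)²)`. -/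
def IsBranchT (c : Params) (p₀ : ℂ) (T : ℂ → ℂ) : Prop :=
  AnalyticAt ℂ T p₀ ∧
    ∀ᶠ p in nhds p₀, T p ^ 2 * deriv (Q c) p ^ 2 = Q c p ^ 2 - Q c p₀ ^ 2

/-- `W` is, near `p₀`, a holomorphic branch of `(𝒬(p) ± √(𝒬(p)² - 𝒬(p₀)²)) / 𝒬(p₀)`. -/
def IsBranchW (c : Params) (p₀ : ℂ) (W : ℂ → ℂ) : Prop :=
  AnalyticAt ℂ W p₀ ∧ W p₀ = 1 ∧
    ∀ᶠ p in nhds p₀, (Q c p₀ * W p - Q c p) ^ 2 = Q c p ^ 2 - Q c p₀ ^ 2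

/-- `P` is, near `0`, a holomorphic solution `p(κ)` of `𝒬(p(κ)) = 𝒬(p₀) cosh κ`, `p(0) = p₀`. -/
def IsBranchP (c : Params) (p₀ : ℂ) (P : ℂ → ℂ) : Prop :=
  AnalyticAt ℂ P 0 ∧ P 0 = p₀ ∧
    ∀ᶠ κ in nhds (0 : ℂ), Q c (P κ) = Q c p₀ * Complex.cosh κ

/-! ### The block determinant -/

/-- The block `(m_{2s-1, 2j-1})`, `1 ≤ s ≤ M`, `1 ≤ j ≤ N`; the indices of `Fin` start at `0`. -/
def oddBlock (M N : ℕ) (m : ℕ → ℕ → ℂ) : Matrix (Fin M) (Fin N) ℂ :=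
  Matrix.of fun s j => m (2 * (s : ℕ) + 1) (2 * (j : ℕ) + 1)

/-- The `2 × 2` block determinant with blocks `(m^{(α,β)}_{2s-1, 2j-1})` of size `N_α × N_β`;
the values `0, 1` of the indices `α, β : Fin 2` stand for `1, 2`. -/
def blockDet (N : Fin 2 → ℕ) (m : Fin 2 → Fin 2 → ℕ → ℕ → ℂ) : ℂ :=
  (Matrix.fromBlocks
    (oddBlock (N 0) (N 0) (m 0 0)) (oddBlock (N 0) (N 1) (m 0 1))
    (oddBlock (N 1) (N 0) (m 1 0)) (oddBlock (N 1) (N 1) (m 1 1))).det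

/-! ### Matrix elements in differential operator form -/

/-- `[T(z) ∂_z]^s F / s!`. -/
def opPow (T : ℂ → ℂ) (s : ℕ) (F : ℂ → ℂ) (z : ℂ) : ℂ :=
  ((fun G : ℂ → ℂ => fun w => T w * deriv G w)^[s] F) z / (s ! : ℂ)

/-- `ξ(p) = p x - i p² t + ∑_{r ≥ 1} a_r (ln W(p))^r`. -/
def xi (W : ℂ → ℂ) (a : ℕ → ℂ) (x t : ℝ) (p : ℂ) : ℂ :=
  p * x - Complex.I * p ^ 2 * t + ∑' r : ℕ, a (r + 1) * Complex.log (W p) ^ (r + 1)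

/-- `m^{(n,k,α,β)}` as a function of the independent variables `p` and `q` (`q` stands for the
conjugate variable), with `W, a` belonging to the index `α` and `W', a'` to the index `β`. -/
def genFun (c : Params) (W W' : ℂ → ℂ) (a a' : ℕ → ℂ) (n k : ℤ) (x t : ℝ) (p q : ℂ) : ℂ :=
  1 / (p + q)
    * (-((p - Complex.I * c.k₁) / (q + Complex.I * c.k₁))) ^ n
    * (-((p - Complex.I * c.k₂) / (q + Complex.I * c.k₂))) ^ k
    * Complex.exp (xi W a x t p + conjFun (xi W' a' x t) q)

/-- The matrix element
`[T_α(p)∂_p]^s / s! · [T_β^*(q)∂_q]^j / j! · m^{(n,k,α,β)}` at `p = p₀^{(α)}`, `q = p₀^{(β)*}`. -/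
def mOp (c : Params) (p₀ : Fin 2 → ℂ) (T W : Fin 2 → ℂ → ℂ) (a : Fin 2 → ℕ → ℂ)
    (n k : ℤ) (x t : ℝ) (α β : Fin 2) (s j : ℕ) : ℂ :=
  opPow (T α) s
    (fun p => opPow (conjFun (T β)) j
      (fun q => genFun c (W α) (W β) (a α) (a β) n k x t p q) (conj (p₀ β))) (p₀ α)

/-- `τ_{n,k}(x,t)` built from the differential operator entries. -/
def tauOp (c : Params) (p₀ : Fin 2 → ℂ) (N : Fin 2 → ℕ) (T W : Fin 2 → ℂ → ℂ)
    (a : Fin 2 → ℕ → ℂ) (n k : ℤ) (x t : ℝ) : ℂ :=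
  blockDet N (mOp c p₀ T W a n k x t)

/-! ### Matrix elements through Schur polynomials -/

/-- The elementary Schur polynomial `S_j(x₁, x₂, …)`: the coefficient of `ε^j` in
`exp (∑_{k ≥ 1} x_k ε^k) = ∑_m (∑_{k ≥ 1} x_k ε^k)^m / m!`, to which only `m ≤ j` contribute. -/
def schur (j : ℕ) (x : ℕ → ℂ) : ℂ :=
  ∑ m ∈ Finset.range (j + 1),
    PowerSeries.coeff j ((PowerSeries.mk fun k => if k = 0 then 0 else x k) ^ m) / (m ! : ℂ)

/-- The coefficient of `κ^r` in the Taylor expansion of `F` at `0`. -/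
def taylor (F : ℂ → ℂ) (r : ℕ) : ℂ := iteratedDeriv r F 0 / (r ! : ℂ)

/-- `p(κ) - p₀ = ∑_{r ≥ 1} λ_r κ^r`, where `p₀ = p(0)` here and below. -/
def lamCoeff (P : ℂ → ℂ) (r : ℕ) : ℂ := taylor (fun κ => P κ - P 0) r

/-- `p(κ)² - p₀² = ∑_{r ≥ 1} β_r κ^r`. -/
def betaCoeff (P : ℂ → ℂ) (r : ℕ) : ℂ := taylor (fun κ => P κ ^ 2 - P 0 ^ 2) r

/-- `ln ((p(κ) - i k) / (p₀ - i k)) = ∑_{r ≥ 1} θ_r κ^r`. -/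
def thetaCoeff (k : ℝ) (P : ℂ → ℂ) (r : ℕ) : ℂ :=
  taylor (fun κ => Complex.log ((P κ - Complex.I * k) / (P 0 - Complex.I * k))) r

/-- `ln ((p^{(α)}(κ) + p₀^{(β)*}) / (p₀^{(α)} + p₀^{(β)*})) = ∑_{r ≥ 1} b_r κ^r`, with `P` belonging
to the index `α` and `P'` to the index `β`. -/
def bCoeff (P P' : ℂ → ℂ) (r : ℕ) : ℂ :=
  taylor (fun κ => Complex.log ((P κ + conj (P' 0)) / (P 0 + conj (P' 0)))) r

/-- `ln [ (1/κ) ((p₀^{(α)} + p₀^{(β)*}) / λ_{1,α}) ((p^{(α)}(κ) - p₀^{(α)}) / (p^{(α)}(κ) + p₀^{(β)*})) ]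
= ∑_{r ≥ 1} s_r κ^r`; `dslope P 0 κ` is `(p(κ) - p₀) / κ`, continued to `κ = 0`. -/
def sCoeff (P P' : ℂ → ℂ) (r : ℕ) : ℂ :=
  taylor (fun κ => Complex.log
    ((P 0 + conj (P' 0)) / lamCoeff P 1 * (dslope P 0 κ / (P κ + conj (P' 0))))) r

/-- `x^+_{r,α,β}(n,k)`. -/
def xPlus (c : Params) (P P' : ℂ → ℂ) (a : ℕ → ℂ) (n k : ℤ) (x t : ℝ) (r : ℕ) : ℂ :=
  lamCoeff P r * x - Complex.I * betaCoeff P r * t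
    + n * thetaCoeff c.k₁ P r + k * thetaCoeff c.k₂ P r - bCoeff P P' r + a r

/-- `x^-_{r,α,β}(n,k)`. -/
def xMinus (c : Params) (P P' : ℂ → ℂ) (a' : ℕ → ℂ) (n k : ℤ) (x t : ℝ) (r : ℕ) : ℂ :=
  conj (lamCoeff P' r) * x + Complex.I * conj (betaCoeff P' r) * t
    - n * conj (thetaCoeff c.k₁ P' r) - k * conj (thetaCoeff c.k₂ P' r)
    - conj (bCoeff P' P r) + conj (a' r)

/-- The matrix element of the Schur form, with `P, a` belonging to the index `α` and `P', a'` to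
the index `β`. -/
def mSchur (c : Params) (P P' : ℂ → ℂ) (a a' : ℕ → ℂ) (n k : ℤ) (x t : ℝ) (s j : ℕ) : ℂ :=
  ∑ ν ∈ Finset.range (min s j + 1),
    1 / (P 0 + conj (P' 0))
      * (lamCoeff P 1 * conj (lamCoeff P' 1) / (P 0 + conj (P' 0)) ^ 2) ^ ν
      * schur (s - ν) (fun r => xPlus c P P' a n k x t r + ν * sCoeff P P' r)
      * schur (j - ν) (fun r => xMinus c P P' a' n k x t r + ν * conj (sCoeff P' P r))

/-- `τ_{n,k}(x,t)` built from the Schur polynomial entries. -/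
def tauSchur (c : Params) (N : Fin 2 → ℕ) (P : Fin 2 → ℂ → ℂ) (a : Fin 2 → ℕ → ℂ)
    (n k : ℤ) (x t : ℝ) : ℂ :=
  blockDet N (fun α β => mSchur c (P α) (P β) (a α) (a β) n k x t)

/-! ### The fields generated by `τ` -/

/-- `A = ρ₁ exp(i (k₁ x + (γ + k₁²) t)) τ_{1,0} / τ_{0,0}`. -/
def fieldA (c : Params) (τ : ℤ → ℤ → ℝ → ℝ → ℂ) (x t : ℝ) : ℂ :=
  c.ρ₁ * Complex.exp (Complex.I * (c.k₁ * x + (c.γ + c.k₁ ^ 2) * t)) * (τ 1 0 x t / τ 0 0 x t)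

/-- `B = ρ₂ exp(i (k₂ x + (γ + k₂²) t)) τ_{0,1} / τ_{0,0}`. -/
def fieldB (c : Params) (τ : ℤ → ℤ → ℝ → ℝ → ℂ) (x t : ℝ) : ℂ :=
  c.ρ₂ * Complex.exp (Complex.I * (c.k₂ * x + (c.γ + c.k₂ ^ 2) * t)) * (τ 0 1 x t / τ 0 0 x t)

/-- `L = γ - 2 (log τ_{0,0})_xx`, for real positive `τ_{0,0}`. -/
def fieldL (c : Params) (τ : ℤ → ℤ → ℝ → ℝ → ℂ) (x t : ℝ) : ℝ :=
  c.γ - 2 * iteratedDeriv 2 (fun x' => Real.log (τ 0 0 x' t).re) x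

/-- `τ` generates a bounded rogue-wave solution: `f = τ_{0,0}` is real and positive everywhere, the
fields solve the system, they are bounded, and they approach the plane-wave background
`|A| = |ρ₁|`, `|B| = |ρ₂|`, `L = γ` as `(x, t)` tends to infinity in the plane. -/
structure IsBoundedRogueWave (c : Params) (τ : ℤ → ℤ → ℝ → ℝ → ℂ) : Prop where
  real : ∀ x t : ℝ, (τ 0 0 x t).im = 0
  pos : ∀ x t : ℝ, 0 < (τ 0 0 x t).re
  solution : IsSolution c.δ₁ c.δ₂ (fieldA c τ) (fieldB c τ) (fieldL c τ)
  bounded : ∃ C : ℝ, ∀ x t : ℝ,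
    ‖fieldA c τ x t‖ ≤ C ∧ ‖fieldB c τ x t‖ ≤ C ∧ |fieldL c τ x t| ≤ C
  limit_A : Filter.Tendsto (fun z : ℝ × ℝ => ‖fieldA c τ z.1 z.2‖)
    (Filter.cocompact (ℝ × ℝ)) (nhds |c.ρ₁|)
  limit_B : Filter.Tendsto (fun z : ℝ × ℝ => ‖fieldB c τ z.1 z.2‖)
    (Filter.cocompact (ℝ × ℝ)) (nhds |c.ρ₂|)
  limit_L : Filter.Tendsto (fun z : ℝ × ℝ => fieldL c τ z.1 z.2)
    (Filter.cocompact (ℝ × ℝ)) (nhds c.γ)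

end TwoLSRI

end

/-! The tau functions are Gram determinants. Along a branch `p(κ)` the derivation `𝒯 ∂_p` becomes
`d/dκ` and `ln 𝒲` becomes `±κ`. In either form, up to nonzero row and column factors, the entries of
`τ_{0,0}` are therefore the odd-odd coefficients of `E_α(κ) E_β^*(κ') / (p_α(κ) + p_β^*(κ'))` with
`E = exp(p x - i p² t + phase)`. Call this matrix `M`.

The equations. Multiplying the kernel by `p + p^*` leaves a product, so `M_x = v₀ v₀^*` and `M_t`
has rank at most two. By partial fractions the index shift `n = 1` or `k = 1` subtracts `v₀ χ^*`,
where `χ` is `v₀` with the weight `1 / (p - i k_ℓ)`. Hence `g / f` is `1 - χ^* M⁻¹ v₀` up to a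
unimodular constant, and everything is expressed by pairings `u^* M⁻¹ v`, which are closed under
differentiation. The equations for `A` and `B` are then polynomial identities
(`GramFlow.ratio_equation`). The equation for `L` needs the dimension reduction: `𝒬(p(κ)) = 𝒬(p₀)
cosh κ` is even, so multiplication by `𝒬` preserves odd coefficients and acts by a constant matrix
`Θ`. The resulting Lyapunov equation for `Θ M + M Θ^*`, tested on `v₀`, expresses `(log f)_xt` by
`|g|²/f²` and `|h|²/f²` (`Reduction.wt_equation`).

Positivity. The Cauchy kernel `1 / (p + q)` is a finite sum of products of Takenaka-Malmquist
functions with weights `2 Re z_l > 0`, up to a Blaschke remainder vanishing to high order at both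
base points. So `M = Y D Y^*` with `D > 0`, and the rows of `Y` are independent because the basis
functions realize all jets at the two points (`LocalPair.kernel_posDef`).

Infinity. Since `Re p₀ > 0`, the coordinate `ζ = p'(0)(x - 2 i p₀ t)` tends to infinity with `(x,
t)`, and the `j`-th coefficient of `E / E(0)` is asymptotic to `ζ^j / j!`. After an invertible
change of rows, which no pairing sees, the odd rows converge to the projection onto the first `N_α`
coefficients (`BranchPair.weights_reduces`). That limit space is stable under multiplication by
every power series, so Lyapunov equations hold there for `p` and `1 / (p - i k)` themselves. They
give `L → γ` and `|g / f|, |h / f| → 1` (`limitPairing_p`, `norm_one_sub_limitPairing`).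

The Schur form expands the same kernel with nodes depending on the block. Finite expansions of the
Cauchy kernel are unique (`cauchyKernel_unique`), so the two forms differ only by phases and gauge
factors. -/

open scoped ComplexOrder

noncomputable section

namespace TwoLSRI

section

/-! ### Calculus of matrix inverses and determinants -/

section MatrixCalculus

variable {ι : Type*} [Fintype ι]

/-- The sesquilinear form `u^* P v`. -/
def sesq (P : Matrix ι ι ℂ) (u v : ι → ℂ) : ℂ := ∑ i, ∑ j, conj (u i) * P i j * v j

/-- The rank one matrix `a b^*`. -/
def outer (a b : ι → ℂ) : Matrix ι ι ℂ := Matrix.of fun i j => a i * conj (b j)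

lemma sesq_eq_dotProduct (P : Matrix ι ι ℂ) (u v : ι → ℂ) :
    sesq P u v = star u ⬝ᵥ P.mulVec v := by
  simp [sesq, dotProduct, Matrix.mulVec, Finset.mul_sum, mul_assoc]

lemma sesq_add_left (P : Matrix ι ι ℂ) (u u' v : ι → ℂ) :
    sesq P (u + u') v = sesq P u v + sesq P u' v := by
  simp [sesq_eq_dotProduct, add_dotProduct]

lemma sesq_smul_left (P : Matrix ι ι ℂ) (c : ℂ) (u v : ι → ℂ) :
    sesq P (c • u) v = conj c * sesq P u v := by
  simp [sesq_eq_dotProduct, smul_dotProduct]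

lemma sesq_add_right (P : Matrix ι ι ℂ) (u v v' : ι → ℂ) :
    sesq P u (v + v') = sesq P u v + sesq P u v' := by
  simp [sesq_eq_dotProduct, Matrix.mulVec_add, dotProduct_add]

lemma sesq_smul_right (P : Matrix ι ι ℂ) (c : ℂ) (u v : ι → ℂ) :
    sesq P u (c • v) = c * sesq P u v := by
  simp [sesq_eq_dotProduct, Matrix.mulVec_smul, dotProduct_smul]

lemma sesq_add_matrix (P P' : Matrix ι ι ℂ) (u v : ι → ℂ) :
    sesq (P + P') u v = sesq P u v + sesq P' u v := by
  simp [sesq_eq_dotProduct, Matrix.add_mulVec, dotProduct_add]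

lemma sesq_smul_matrix (c : ℂ) (P : Matrix ι ι ℂ) (u v : ι → ℂ) :
    sesq (c • P) u v = c * sesq P u v := by
  simp [sesq_eq_dotProduct, Matrix.smul_mulVec, dotProduct_smul]

lemma conj_sesq {P : Matrix ι ι ℂ} (hP : P.IsHermitian) (u v : ι → ℂ) :
    conj (sesq P u v) = sesq P v u := by
  simp only [sesq, map_sum, map_mul, Complex.conj_conj]
  rw [Finset.sum_comm]
  refine Finset.sum_congr rfl fun i _ => Finset.sum_congr rfl fun j _ => ?_
  have : conj (P j i) = P i j := hP.apply i j
  rw [this]; ring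

/-- A rank one matrix in the middle splits the form into a product; this is why derivatives of
pairings are polynomials in pairings. -/
lemma sesq_mul_outer_mul (P P' : Matrix ι ι ℂ) (a b u v : ι → ℂ) :
    sesq (P * outer a b * P') u v = sesq P u a * sesq P' b v := by
  have h : outer a b = Matrix.vecMulVec a (star b) := by
    ext i j; simp [outer, Matrix.vecMulVec_apply]
  rw [h, Matrix.mul_vecMulVec, Matrix.vecMulVec_mul]
  simp only [sesq_eq_dotProduct]
  rw [Matrix.vecMulVec_mulVec, dotProduct_smul, ← Matrix.dotProduct_mulVec]
  simp

/-- `F` is entrywise differentiable at `x` with derivative `F'`. -/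
def HasEntryDeriv {m : Type*} (F : ℝ → Matrix ι m ℂ) (F' : Matrix ι m ℂ) (x : ℝ) : Prop :=
  ∀ i j, HasDerivAt (fun y => F y i j) (F' i j) x

lemma hasDerivAt_sesq {P : ℝ → Matrix ι ι ℂ} {P' : Matrix ι ι ℂ} {u v : ℝ → ι → ℂ}
    {u' v' : ι → ℂ} {x : ℝ} (hP : HasEntryDeriv P P' x)
    (hu : ∀ i, HasDerivAt (fun y => u y i) (u' i) x)
    (hv : ∀ i, HasDerivAt (fun y => v y i) (v' i) x) :
    HasDerivAt (fun y => sesq (P y) (u y) (v y))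
      (sesq (P x) u' (v x) + sesq P' (u x) (v x) + sesq (P x) (u x) v') x := by
  simp only [sesq, ← Finset.sum_add_distrib]
  refine HasDerivAt.fun_sum fun i _ => HasDerivAt.fun_sum fun j _ => ?_
  have hc : HasDerivAt (fun y => conj (u y i)) (conj (u' i)) x := (hu i).star
  refine ((hc.mul (hP i j)).mul (hv j)).congr_deriv ?_
  simp only [Pi.mul_apply]
  ring

variable [DecidableEq ι]

/-- The matrix determinant lemma; it turns the quotient of a shifted tau function by `f` into `1 -
χ^* M⁻¹ v₀`. -/
lemma det_sub_outer {M : Matrix ι ι ℂ} (hM : IsUnit M.det) (a b : ι → ℂ) :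
    (M - outer a b).det = M.det * (1 - sesq M⁻¹ b a) := by
  have h := Matrix.det_add_replicateCol_mul_replicateRow (ι := Unit) hM (-a) (star b)
  have e : M + Matrix.replicateCol Unit (-a) * Matrix.replicateRow Unit (star b)
      = M - outer a b := by
    ext i j; simp [outer, Matrix.mul_apply, sub_eq_add_neg]
  rw [← e, h, sesq_eq_dotProduct]
  congr 1
  rw [Matrix.det_unique, Matrix.mul_assoc]
  simp [Matrix.mul_apply, dotProduct, Matrix.mulVec, Finset.sum_neg_distrib, sub_eq_add_neg]

/-- Jacobi's formula, by the Leibniz expansion. -/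
lemma HasEntryDeriv.det {M : ℝ → Matrix ι ι ℂ} {M' : Matrix ι ι ℂ} {x : ℝ}
    (h : HasEntryDeriv M M' x) :
    HasDerivAt (fun y => (M y).det) ((M x).adjugate * M').trace x := by
  have key : ((M x).adjugate * M').trace = ∑ σ : Equiv.Perm ι, (Equiv.Perm.sign σ : ℤ) *
      ∑ i, (∏ j ∈ Finset.univ.erase i, M x (σ j) j) * M' (σ i) i := by
    -- Cramer's rule: each diagonal entry of `adj(M) M'` is the determinant of `M` with one column
    -- replaced by that of `M'`.
    have h1 : ((M x).adjugate * M').trace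
        = ∑ i, ((M x).updateCol i (fun k => M' k i)).det := by
      simp only [Matrix.trace, Matrix.diag]
      refine Finset.sum_congr rfl fun i _ => ?_
      rw [← Matrix.cramer_apply, Matrix.cramer_eq_adjugate_mulVec]
      rfl
    rw [h1]
    simp only [Matrix.det_apply', Finset.mul_sum]
    rw [Finset.sum_comm]
    refine Finset.sum_congr rfl fun σ _ => Finset.sum_congr rfl fun i _ => ?_
    rw [← Finset.mul_prod_erase _ _ (Finset.mem_univ i), mul_comm (∏ j ∈ _, _)]
    congr 2
    · simp
    · refine Finset.prod_congr rfl fun j hj => ?_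
      simp [(Finset.mem_erase.1 hj).1]
  rw [key]
  simp only [Matrix.det_apply']
  refine HasDerivAt.fun_sum fun σ _ => HasDerivAt.const_mul _ ?_
  have := HasDerivAt.fun_finsetProd (u := Finset.univ) (f := fun i y => M y (σ i) i)
    (f' := fun i => M' (σ i) i) (x := x) (fun i _ => h (σ i) i)
  simpa using this

lemma HasEntryDeriv.differentiableAt_inv {M : ℝ → Matrix ι ι ℂ} {M' : Matrix ι ι ℂ} {x : ℝ}
    (h : HasEntryDeriv M M' x) (hM : (M x).det ≠ 0) (i j : ι) :
    DifferentiableAt ℝ (fun y => (M y)⁻¹ i j) x := by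
  have hadj : DifferentiableAt ℝ (fun y => (M y).adjugate i j) x := by
    simp only [Matrix.adjugate_apply]
    refine (HasEntryDeriv.det (M' := M'.updateRow j 0) fun a b => ?_).differentiableAt
    by_cases hj : a = j
    · subst hj
      simpa using hasDerivAt_const x ((Pi.single i 1 : ι → ℂ) b)
    · simpa [Matrix.updateRow_apply, hj] using h a b
  have : (fun y => (M y)⁻¹ i j) = fun y => ((M y).det)⁻¹ * (M y).adjugate i j := by
    funext y
    simp [Matrix.inv_def]
  rw [this]
  exact (h.det.differentiableAt.inv hM).mul hadj

/-- Cramer's rule supplies differentiability; the value of the derivative then follows by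
differentiating `M M⁻¹ = 1`. -/
lemma HasEntryDeriv.inv {M : ℝ → Matrix ι ι ℂ} {M' : Matrix ι ι ℂ} {x : ℝ}
    (h : HasEntryDeriv M M' x) (hM : ∀ y, (M y).det ≠ 0) :
    HasEntryDeriv (fun y => (M y)⁻¹) (-((M x)⁻¹ * M' * (M x)⁻¹)) x := by
  have hd := h.differentiableAt_inv (hM x)
  set D : Matrix ι ι ℂ := Matrix.of fun i j => deriv (fun y => (M y)⁻¹ i j) x with hD
  have hDd : HasEntryDeriv (fun y => (M y)⁻¹) D x := fun i j => (hd i j).hasDerivAt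
  have hone : M' * (M x)⁻¹ + M x * D = 0 := by
    ext i j
    have h1 : HasDerivAt (fun y => (M y * (M y)⁻¹) i j) ((M' * (M x)⁻¹ + M x * D) i j) x := by
      simp only [Matrix.mul_apply, Matrix.add_apply, ← Finset.sum_add_distrib]
      exact HasDerivAt.fun_sum fun k _ => (h i k).mul (hDd k j)
    have h2 : (fun y => (M y * (M y)⁻¹) i j) = fun _ => (1 : Matrix ι ι ℂ) i j := by
      funext y
      rw [Matrix.mul_nonsing_inv _ (isUnit_iff_ne_zero.2 (hM y))]
    rw [h2] at h1
    simpa using h1.unique (hasDerivAt_const x _)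
  have : D = -((M x)⁻¹ * M' * (M x)⁻¹) := by
    have h3 : (M x)⁻¹ * (M' * (M x)⁻¹ + M x * D) = 0 := by rw [hone, Matrix.mul_zero]
    rw [Matrix.mul_add, ← Matrix.mul_assoc, ← Matrix.mul_assoc,
      Matrix.nonsing_inv_mul _ (isUnit_iff_ne_zero.2 (hM x)), Matrix.one_mul] at h3
    exact (neg_eq_of_add_eq_zero_right h3).symm
  rw [← this]
  exact hDd

/-- The derivative of `u^* M⁻¹ v`. -/
lemma hasDerivAt_sesq_inv {M : ℝ → Matrix ι ι ℂ} {M' : Matrix ι ι ℂ} {u v : ℝ → ι → ℂ}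
    {u' v' : ι → ℂ} {x : ℝ} (h : HasEntryDeriv M M' x) (hM : ∀ y, (M y).det ≠ 0)
    (hu : ∀ i, HasDerivAt (fun y => u y i) (u' i) x)
    (hv : ∀ i, HasDerivAt (fun y => v y i) (v' i) x) :
    HasDerivAt (fun y => sesq (M y)⁻¹ (u y) (v y))
      (sesq (M x)⁻¹ u' (v x) - sesq ((M x)⁻¹ * M' * (M x)⁻¹) (u x) (v x)
        + sesq (M x)⁻¹ (u x) v') x := by
  refine (hasDerivAt_sesq (h.inv hM) hu hv).congr_deriv ?_
  have := sesq_smul_matrix (-1) ((M x)⁻¹ * M' * (M x)⁻¹) (u x) (v x)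
  rw [neg_one_smul] at this
  rw [this]; ring

lemma trace_adjugate_mul_outer {M : Matrix ι ι ℂ} (hM : M.det ≠ 0) (a b : ι → ℂ) :
    (M.adjugate * outer a b).trace = M.det * sesq M⁻¹ b a := by
  have : M.adjugate = M.det • M⁻¹ := by
    rw [Matrix.inv_def, smul_smul, Ring.mul_inverse_cancel _ (isUnit_iff_ne_zero.2 hM), one_smul]
  rw [this, Matrix.smul_mul, Matrix.trace_smul, smul_eq_mul]
  congr 1
  simp only [Matrix.trace, Matrix.diag, Matrix.mul_apply, outer, Matrix.of_apply, sesq]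
  exact Finset.sum_congr rfl fun i _ => Finset.sum_congr rfl fun j _ => by ring

/-- If `Θ M + M Θ^* = R` and `y = M⁻¹ a`, then `y^* R y = y^* Θ a + (Θ a)^* y`. -/
lemma sesq_lyapunov {M Θ R : Matrix ι ι ℂ} (hM : M.det ≠ 0) (h : Θ * M + M * Θ.conjTranspose = R)
    (a : ι → ℂ) :
    sesq (M⁻¹ * R * M⁻¹) a a
      = sesq M⁻¹ a (Θ.mulVec a) + sesq M⁻¹ (Θ.mulVec a) a := by
  have hu := isUnit_iff_ne_zero.2 hM
  -- Multiplying the Lyapunov equation by `M⁻¹` on both sides cancels one `M` in each term.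
  have e : M⁻¹ * R * M⁻¹ = M⁻¹ * Θ + Θ.conjTranspose * M⁻¹ := by
    rw [← h, Matrix.mul_add, Matrix.add_mul, Matrix.mul_assoc, Matrix.mul_assoc,
      Matrix.mul_nonsing_inv _ hu, Matrix.mul_one, ← Matrix.mul_assoc,
      Matrix.nonsing_inv_mul _ hu, Matrix.one_mul]
  rw [e]
  simp only [sesq_eq_dotProduct, Matrix.add_mulVec, dotProduct_add, ← Matrix.mulVec_mulVec]
  congr 1
  rw [Matrix.star_mulVec, ← Matrix.dotProduct_mulVec]

end MatrixCalculus

end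

section

/-! ### Gram matrices whose derivatives have low rank -/

/-- A family of positive definite matrices `M(x,t)` with `M_x = v₀ v₀^*` and
`M_t = -i (v₁ v₀^* - v₀ v₁^*)`, for vectors with `∂_x v_j = v_{j+1}`, `∂_t v_j = -i v_{j+2}`. -/
structure GramFlow (ι : Type*) [Fintype ι] where
  M : ℝ → ℝ → Matrix ι ι ℂ
  v : ℕ → ℝ → ℝ → ι → ℂ
  posDef : ∀ x t, (M x t).PosDef
  M_x : ∀ x t, HasEntryDeriv (fun x' => M x' t) (outer (v 0 x t) (v 0 x t)) x
  M_t : ∀ x t, HasEntryDeriv (fun t' => M x t')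
    ((-Complex.I) • outer (v 1 x t) (v 0 x t) + Complex.I • outer (v 0 x t) (v 1 x t)) t
  v_x : ∀ j x t i, HasDerivAt (fun x' => v j x' t i) (v (j + 1) x t i) x
  v_t : ∀ j x t i, HasDerivAt (fun t' => v j x t' i) (-Complex.I * v (j + 2) x t i) t
  smooth_M : ∀ i j, ContDiff ℝ ∞ (fun z : ℝ × ℝ => M z.1 z.2 i j)
  smooth_v : ∀ n i, ContDiff ℝ ∞ (fun z : ℝ × ℝ => v n z.1 z.2 i)

/-- The vector `χ` obtained from `v₀` by the resolvent `(∂_x - i k)⁻¹`. -/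
structure GramFlow.IsResolvent {ι : Type*} [Fintype ι] (G : GramFlow ι) (k : ℝ)
    (χ : ℝ → ℝ → ι → ℂ) : Prop where
  χ_x : ∀ x t i, HasDerivAt (fun x' => χ x' t i) (G.v 0 x t i + Complex.I * k * χ x t i) x
  χ_t : ∀ x t i, HasDerivAt (fun t' => χ x t' i)
    (-Complex.I * (G.v 1 x t i + Complex.I * k * G.v 0 x t i - k ^ 2 * χ x t i)) t
  smooth : ∀ i, ContDiff ℝ ∞ (fun z : ℝ × ℝ => χ z.1 z.2 i)

namespace GramFlow

variable {ι : Type*} [Fintype ι] [DecidableEq ι] (G : GramFlow ι)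

lemma det_ne_zero (x t : ℝ) : (G.M x t).det ≠ 0 :=
  ((Matrix.isUnit_iff_isUnit_det _).1 (G.posDef x t).isUnit).ne_zero

lemma isHermitian_inv (x t : ℝ) : ((G.M x t)⁻¹).IsHermitian := (G.posDef x t).isHermitian.inv

/-- `u^* M⁻¹ v` as a function on the plane. -/
def pairing (u v : ℝ → ℝ → ι → ℂ) (x t : ℝ) : ℂ := sesq (G.M x t)⁻¹ (u x t) (v x t)

/-- `w_{ij} = v_i^* M⁻¹ v_j`. -/
def w (i j : ℕ) : ℝ → ℝ → ℂ := G.pairing (G.v i) (G.v j)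

lemma conj_pairing (u v : ℝ → ℝ → ι → ℂ) (x t : ℝ) :
    conj (G.pairing u v x t) = G.pairing v u x t :=
  conj_sesq (G.isHermitian_inv x t) _ _

lemma hasDerivAt_pairing_x {u v : ℝ → ℝ → ι → ℂ} {u' v' : ι → ℂ} {x t : ℝ}
    (hu : ∀ i, HasDerivAt (fun y => u y t i) (u' i) x)
    (hv : ∀ i, HasDerivAt (fun y => v y t i) (v' i) x) :
    HasDerivAt (fun y => G.pairing u v y t)
      (sesq (G.M x t)⁻¹ u' (v x t) + sesq (G.M x t)⁻¹ (u x t) v'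
        - G.pairing u (G.v 0) x t * G.pairing (G.v 0) v x t) x := by
  refine (hasDerivAt_sesq_inv (G.M_x x t) (fun y => G.det_ne_zero y t) hu hv).congr_deriv ?_
  rw [sesq_mul_outer_mul]
  simp only [pairing]; ring

lemma hasDerivAt_pairing_t {u v : ℝ → ℝ → ι → ℂ} {u' v' : ι → ℂ} {x t : ℝ}
    (hu : ∀ i, HasDerivAt (fun y => u x y i) (u' i) t)
    (hv : ∀ i, HasDerivAt (fun y => v x y i) (v' i) t) :
    HasDerivAt (fun y => G.pairing u v x y)
      (sesq (G.M x t)⁻¹ u' (v x t) + sesq (G.M x t)⁻¹ (u x t) v'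
        + Complex.I * (G.pairing u (G.v 1) x t * G.pairing (G.v 0) v x t
          - G.pairing u (G.v 0) x t * G.pairing (G.v 1) v x t)) t := by
  refine (hasDerivAt_sesq_inv (G.M_t x t) (fun y => G.det_ne_zero x y) hu hv).congr_deriv ?_
  simp only [Matrix.mul_add, Matrix.add_mul, Matrix.mul_smul, Matrix.smul_mul, sesq_add_matrix,
    sesq_smul_matrix, sesq_mul_outer_mul]
  simp only [pairing]; ring

lemma hasDerivAt_w_x (i j : ℕ) (x t : ℝ) :
    HasDerivAt (fun y => G.w i j y t)
      (G.w (i + 1) j x t + G.w i (j + 1) x t - G.w i 0 x t * G.w 0 j x t) x :=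
  G.hasDerivAt_pairing_x (G.v_x i x t) (G.v_x j x t)

lemma hasDerivAt_w_t (i j : ℕ) (x t : ℝ) :
    HasDerivAt (fun y => G.w i j x y)
      (Complex.I * (G.w (i + 2) j x t - G.w i (j + 2) x t
        + G.w i 1 x t * G.w 0 j x t - G.w i 0 x t * G.w 1 j x t)) t := by
  refine (G.hasDerivAt_pairing_t (u' := (-Complex.I) • G.v (i + 2) x t)
    (v' := (-Complex.I) • G.v (j + 2) x t) (G.v_t i x t) (G.v_t j x t)).congr_deriv ?_
  rw [sesq_smul_left, sesq_smul_right]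
  simp only [w, pairing, map_neg, Complex.conj_I, neg_neg]
  ring

/-- `(log det M)_xx`. -/
def wx (x t : ℝ) : ℂ := G.w 1 0 x t + G.w 0 1 x t - G.w 0 0 x t ^ 2

/-- `(log det M)_xt`. -/
def wt (x t : ℝ) : ℂ :=
  Complex.I * (G.w 2 0 x t - G.w 0 2 x t + G.w 0 1 x t * G.w 0 0 x t - G.w 0 0 x t * G.w 1 0 x t)

lemma hasDerivAt_w00_x (x t : ℝ) : HasDerivAt (fun y => G.w 0 0 y t) (G.wx x t) x :=
  (G.hasDerivAt_w_x 0 0 x t).congr_deriv (by simp only [wx]; ring)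

/-- Equality of the mixed derivatives of `(log det M)_x`, read off from the explicit derivatives of
the pairings. It links `L_t` to the conserved density. -/
lemma hasDerivAt_wx_t_eq_wt_x (x t : ℝ) :
    ∃ d : ℂ, HasDerivAt (fun y => G.wx x y) d t ∧ HasDerivAt (fun y => G.wt y t) d x := by
  have ht := fun i j => G.hasDerivAt_w_t i j x t
  have hx := fun i j => G.hasDerivAt_w_x i j x t
  refine ⟨_, ((ht 1 0).add (ht 0 1)).sub ((ht 0 0).pow 2), ?_⟩
  refine (((((hx 2 0).sub (hx 0 2)).add ((hx 0 1).mul (hx 0 0))).sub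
    ((hx 0 0).mul (hx 1 0))).const_mul Complex.I).congr_deriv ?_
  simp only [zero_add, Nat.reduceAdd]
  ring

lemma conj_wx (x t : ℝ) : conj (G.wx x t) = G.wx x t := by
  simp only [wx, w, map_sub, map_add, map_pow, conj_pairing]
  ring

lemma ofReal_re_wx (x t : ℝ) : ((G.wx x t).re : ℂ) = G.wx x t :=
  Complex.conj_eq_iff_re.1 (G.conj_wx x t)

lemma smooth_det {F : ℝ × ℝ → Matrix ι ι ℂ} (h : ∀ i j, ContDiff ℝ ∞ (fun z => F z i j)) :
    ContDiff ℝ ∞ (fun z => (F z).det) := by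
  simp only [Matrix.det_apply']
  exact ContDiff.sum fun σ _ => contDiff_const.mul (contDiff_prod fun i _ => h _ _)

lemma smooth_pairing {u v : ℝ → ℝ → ι → ℂ} (hu : ∀ i, ContDiff ℝ ∞ (fun z : ℝ × ℝ => u z.1 z.2 i))
    (hv : ∀ i, ContDiff ℝ ∞ (fun z : ℝ × ℝ => v z.1 z.2 i)) :
    ContDiff ℝ ∞ (fun z : ℝ × ℝ => G.pairing u v z.1 z.2) := by
  have hinv : ∀ i j, ContDiff ℝ ∞ (fun z : ℝ × ℝ => (G.M z.1 z.2)⁻¹ i j) := by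
    intro i j
    have e : (fun z : ℝ × ℝ => (G.M z.1 z.2)⁻¹ i j)
        = fun z => ((G.M z.1 z.2).det)⁻¹ * (G.M z.1 z.2).adjugate i j := by
      funext z; simp [Matrix.inv_def]
    rw [e]
    refine ((smooth_det fun i j => G.smooth_M i j).inv fun z => G.det_ne_zero _ _).mul ?_
    simp only [Matrix.adjugate_apply]
    refine smooth_det fun a b => ?_
    by_cases hj : a = j
    · subst hj
      simpa using contDiff_const
    · simpa [Matrix.updateRow_apply, hj] using G.smooth_M a b
  simp only [pairing, sesq]
  refine ContDiff.sum fun i _ => ContDiff.sum fun j _ => ?_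
  exact ((Complex.conjCLE.contDiff.comp (hu i)).mul (hinv i j)).mul (hv j)

section Resolvent

variable {G} {k : ℝ} {χ : ℝ → ℝ → ι → ℂ}

/-- The quotient `g / f` of tau functions. -/
def ratio (G : GramFlow ι) (χ : ℝ → ℝ → ι → ℂ) (x t : ℝ) : ℂ := 1 - G.pairing χ (G.v 0) x t

/-- The term `w 0 j` from `χ_x = v₀ + i k χ` and the product from the rank one `M_x` combine into
the factor `ratio`; the term `i k χ` is conjugated, whence the minus sign. -/
lemma hasDerivAt_pairing_resolvent_x (h : G.IsResolvent k χ) (j : ℕ) (x t : ℝ) :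
    HasDerivAt (fun y => G.pairing χ (G.v j) y t)
      (G.ratio χ x t * G.w 0 j x t - Complex.I * k * G.pairing χ (G.v j) x t
        + G.pairing χ (G.v (j + 1)) x t) x := by
  refine (G.hasDerivAt_pairing_x (u' := G.v 0 x t + (Complex.I * k) • χ x t)
    (h.χ_x x t) (G.v_x j x t)).congr_deriv ?_
  rw [sesq_add_left, sesq_smul_left]
  simp only [w, ratio, pairing, map_mul, Complex.conj_I, Complex.conj_ofReal]
  ring

lemma hasDerivAt_ratio_t (h : G.IsResolvent k χ) (x t : ℝ) :
    HasDerivAt (fun y => G.ratio χ x y)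
      (-Complex.I * (G.ratio χ x t * G.w 1 0 x t - Complex.I * k * G.w 0 0 x t
        - k ^ 2 * G.pairing χ (G.v 0) x t + G.pairing χ (G.v 1) x t * G.w 0 0 x t
        - G.pairing χ (G.v 2) x t)) t := by
  refine ((G.hasDerivAt_pairing_t (u' := (-Complex.I) • (G.v 1 x t + (Complex.I * k) • G.v 0 x t
    + (-(k : ℂ) ^ 2) • χ x t)) (v' := (-Complex.I) • G.v 2 x t)
    (fun i => (h.χ_t x t i).congr_deriv ?_) (G.v_t 0 x t)).const_sub 1).congr_deriv ?_
  · simp only [Pi.smul_apply, Pi.add_apply, smul_eq_mul]; ring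
  · simp only [sesq_add_left, sesq_smul_left, sesq_smul_right]
    simp only [w, ratio, pairing, map_mul, Complex.conj_I, Complex.conj_ofReal, map_neg, map_pow]
    ring

/-- The first bilinear equation in terms of `R = g / f`. -/
lemma ratio_equation (h : G.IsResolvent k χ) (x t : ℝ) :
    ∃ Rx Rxx Rt : ℂ, HasDerivAt (fun y => G.ratio χ y t) Rx x ∧
      (∃ D : ℝ → ℂ, (∀ y, HasDerivAt (fun y => G.ratio χ y t) (D y) y) ∧ D x = Rx ∧
        HasDerivAt D Rxx x) ∧
      HasDerivAt (fun y => G.ratio χ x y) Rt t ∧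
      Complex.I * Rt - 2 * Complex.I * k * Rx - Rxx - 2 * G.wx x t * G.ratio χ x t = 0 := by
  have h0 := fun y => hasDerivAt_pairing_resolvent_x h 0 y t
  have h1 := fun y => hasDerivAt_pairing_resolvent_x h 1 y t
  have hr := fun y => (h0 y).const_sub 1
  have hw := G.hasDerivAt_w00_x x t
  refine ⟨_, _, _, hr x, ⟨_, hr, rfl,
    ((((hr x).mul hw).sub ((h0 x).const_mul (Complex.I * k))).add (h1 x)).neg⟩,
    hasDerivAt_ratio_t h x t, ?_⟩
  have e : G.pairing χ (G.v 0) x t = 1 - G.ratio χ x t := by simp [ratio]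
  simp only [zero_add, Nat.reduceAdd, e, wx]
  -- With all derivatives written as pairings the equation is an identity of polynomials modulo `i²
  -- = -1`.
  linear_combination (-(G.ratio χ x t * G.w 1 0 x t - Complex.I * k * G.w 0 0 x t
    - k ^ 2 * (1 - G.ratio χ x t) + G.pairing χ (G.v 1) x t * G.w 0 0 x t
    - G.pairing χ (G.v 2) x t) - (k : ℂ) ^ 2 * (1 - G.ratio χ x t)) * Complex.I_sq

end Resolvent

end GramFlow

end

/-! ### Dimension reduction and the passage from Gram flows to solutions -/

section

namespace GramFlow

variable {ι : Type*} [Fintype ι] [DecidableEq ι]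

/-- A Gram flow together with its resolvent vectors and a constant matrix `Θ` that realizes
multiplication by `𝒬`, which encodes the dimension reduction. -/
structure Reduction (c : Params) (G : GramFlow ι) where
  χ₁ : ℝ → ℝ → ι → ℂ
  χ₂ : ℝ → ℝ → ι → ℂ
  res₁ : G.IsResolvent c.k₁ χ₁
  res₂ : G.IsResolvent c.k₂ χ₂
  Θ : Matrix ι ι ℂ
  lyapunov : ∀ x t, Θ * G.M x t + G.M x t * Θ.conjTranspose
    = ((c.δ₁ * c.ρ₁ ^ 2 : ℝ) : ℂ) • outer (χ₁ x t) (χ₁ x t)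
      + ((c.δ₂ * c.ρ₂ ^ 2 : ℝ) : ℂ) • outer (χ₂ x t) (χ₂ x t)
      + Complex.I • outer (G.v 1 x t) (G.v 0 x t) + (-Complex.I) • outer (G.v 0 x t) (G.v 1 x t)
  mulVec : ∀ x t, Θ.mulVec (G.v 0 x t)
    = ((c.δ₁ * c.ρ₁ ^ 2 : ℝ) : ℂ) • χ₁ x t + ((c.δ₂ * c.ρ₂ ^ 2 : ℝ) : ℂ) • χ₂ x t
      + Complex.I • G.v 2 x t

variable {c : Params} {G : GramFlow ι}

lemma conj_ratio (χ : ℝ → ℝ → ι → ℂ) (x t : ℝ) :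
    conj (G.ratio χ x t) = 1 - G.pairing (G.v 0) χ x t := by
  simp [ratio, conj_pairing]

/-- The second bilinear equation, integrated once in `x`. -/
lemma Reduction.wt_equation (R : G.Reduction c) (x t : ℝ) :
    G.wt x t + ((c.δ₁ * c.ρ₁ ^ 2 : ℝ) : ℂ) * (G.ratio R.χ₁ x t * conj (G.ratio R.χ₁ x t))
      + ((c.δ₂ * c.ρ₂ ^ 2 : ℝ) : ℂ) * (G.ratio R.χ₂ x t * conj (G.ratio R.χ₂ x t))
      = ((c.δ₁ * c.ρ₁ ^ 2 : ℝ) : ℂ) + ((c.δ₂ * c.ρ₂ ^ 2 : ℝ) : ℂ) := by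
  -- Tested on `v₀`, each resolvent term gives `|χ^* M⁻¹ v₀|²` on one side and twice the real part
  -- of `χ^* M⁻¹ v₀` on the other, which completes to `|ratio|² - 1`; the remaining terms assemble
  -- to `wt`.
  have h := sesq_lyapunov (G.det_ne_zero x t) (R.lyapunov x t) (G.v 0 x t)
  rw [R.mulVec] at h
  simp only [Matrix.mul_add, Matrix.add_mul, Matrix.mul_smul, Matrix.smul_mul, sesq_add_matrix,
    sesq_smul_matrix, sesq_mul_outer_mul, sesq_add_left, sesq_add_right, sesq_smul_left,
    sesq_smul_right, Complex.conj_ofReal, Complex.conj_I] at h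
  rw [conj_ratio, conj_ratio]
  simp only [wt, w, ratio, pairing]
  linear_combination h

lemma contDiff_re {f : ℝ × ℝ → ℂ} (h : ContDiff ℝ ∞ f) : ContDiff ℝ ∞ (fun z => (f z).re) :=
  Complex.reCLM.contDiff.comp h

/-- `τ` is, up to gauge factors, given by the determinants of a reduced Gram flow. -/
structure Reduction.Generates (R : G.Reduction c) (τ : ℤ → ℤ → ℝ → ℝ → ℂ) : Prop where
  gauge : ∃ (a b d : ℝ) (u₁ u₂ : ℂ), ‖u₁‖ = 1 ∧ ‖u₂‖ = 1 ∧ ∀ x t : ℝ,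
    τ 0 0 x t = Real.exp (a * x + b * t + d) * (G.M x t).det ∧
    τ 1 0 x t = u₁ * Real.exp (a * x + b * t + d)
      * (G.M x t - outer (G.v 0 x t) (R.χ₁ x t)).det ∧
    τ 0 1 x t = u₂ * Real.exp (a * x + b * t + d)
      * (G.M x t - outer (G.v 0 x t) (R.χ₂ x t)).det

lemma det_re_pos (x t : ℝ) : 0 < (G.M x t).det.re ∧ (G.M x t).det.im = 0 := by
  have := (G.posDef x t).det_pos
  rw [Complex.lt_def] at this
  exact ⟨this.1, this.2.symm⟩

lemma hasDerivAt_det_x (x t : ℝ) :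
    HasDerivAt (fun y => (G.M y t).det) ((G.M x t).det * G.w 0 0 x t) x := by
  refine (G.M_x x t).det.congr_deriv ?_
  rw [trace_adjugate_mul_outer (G.det_ne_zero x t)]
  rfl

lemma hasDerivAt_log_det_x (x t : ℝ) :
    HasDerivAt (fun y => Real.log (G.M y t).det.re) (G.w 0 0 x t).re x := by
  obtain ⟨h1, h2⟩ := G.det_re_pos x t
  have h : HasDerivAt (fun y => (G.M y t).det.re) ((G.M x t).det * G.w 0 0 x t).re x :=
    Complex.reCLM.hasFDerivAt.comp_hasDerivAt x (hasDerivAt_det_x x t)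
  refine (h.log h1.ne').congr_deriv ?_
  rw [Complex.mul_re, h2]
  field_simp
  ring

lemma iteratedDeriv_two_eq {E : Type*} [NormedAddCommGroup E] [NormedSpace ℝ E]
    {f f' : ℝ → E} {f'' : E} {x : ℝ}
    (h : ∀ y, HasDerivAt f (f' y) y) (h' : HasDerivAt f' f'' x) : iteratedDeriv 2 f x = f'' := by
  rw [iteratedDeriv_succ, iteratedDeriv_one, (funext fun y => (h y).deriv : deriv f = f')]
  exact h'.deriv

/-- The logarithm of the gauge factor is affine in `x`, so two `x`-derivatives remove it. -/
lemma fieldL_eq_of_gauge {τ : ℤ → ℤ → ℝ → ℝ → ℂ} {a b d : ℝ}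
    (h : ∀ x t : ℝ, τ 0 0 x t = Real.exp (a * x + b * t + d) * (G.M x t).det) (x t : ℝ) :
    fieldL c τ x t = c.γ - 2 * (G.wx x t).re := by
  have e : (fun x' => Real.log (τ 0 0 x' t).re)
      = fun x' => (a * x' + b * t + d) + Real.log (G.M x' t).det.re := by
    funext x'
    rw [h, Complex.re_ofReal_mul, Real.log_mul (Real.exp_pos _).ne' (G.det_re_pos x' t).1.ne',
      Real.log_exp]
  rw [fieldL, e, iteratedDeriv_two_eq (f' := fun x' => a + (G.w 0 0 x' t).re)
    (f'' := (G.wx x t).re)]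
  · intro y
    refine HasDerivAt.add ?_ (hasDerivAt_log_det_x y t)
    simpa using (((hasDerivAt_id y).const_mul a).add_const (b * t)).add_const d
  · exact (Complex.reCLM.hasFDerivAt.comp_hasDerivAt x (G.hasDerivAt_w00_x x t)).const_add a

/-- A plane wave multiplied by a solution of the bilinear equation solves the Schrödinger
equation. -/
lemma wave_equation {k γ : ℝ} {χ : ℝ → ℝ → ι → ℂ} (h : G.IsResolvent k χ) (r : ℂ) (x t : ℝ) :
    Complex.I * deriv (fun t' : ℝ => r * Complex.exp (Complex.I * (k * x + (γ + k ^ 2) * t'))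
        * G.ratio χ x t') t
      - iteratedDeriv 2 (fun x' : ℝ => r * Complex.exp (Complex.I * (k * x' + (γ + k ^ 2) * t))
        * G.ratio χ x' t) x
      + (γ - 2 * G.wx x t) * (r * Complex.exp (Complex.I * (k * x + (γ + k ^ 2) * t))
        * G.ratio χ x t) = 0 := by
  obtain ⟨Rx, Rxx, Rt, hx, ⟨D, hD, hDx, hDD⟩, ht, heq⟩ := ratio_equation h x t
  have hid : ∀ y : ℝ, HasDerivAt (fun y : ℝ => (y : ℂ)) 1 y := fun y => Complex.ofRealCLM.hasDerivAt
  have et : HasDerivAt (fun t' : ℝ => r * Complex.exp (Complex.I * (k * x + (γ + k ^ 2) * t')))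
      (r * Complex.exp (Complex.I * (k * x + (γ + k ^ 2) * t)) * (Complex.I * (γ + k ^ 2))) t := by
    have := (((((hid t).const_mul ((γ : ℂ) + k ^ 2)).const_add ((k : ℂ) * x)).const_mul
      Complex.I).cexp).const_mul r
    refine this.congr_deriv ?_
    ring
  have ex : ∀ y : ℝ, HasDerivAt
      (fun x' : ℝ => r * Complex.exp (Complex.I * (k * x' + (γ + k ^ 2) * t)))
      (r * Complex.exp (Complex.I * (k * y + (γ + k ^ 2) * t)) * (Complex.I * k)) y := by
    intro y
    have := (((((hid y).const_mul (k : ℂ)).add_const (((γ : ℂ) + k ^ 2) * t)).const_mul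
      Complex.I).cexp).const_mul r
    refine this.congr_deriv ?_
    ring
  rw [(et.fun_mul ht).deriv, iteratedDeriv_two_eq (fun y => (ex y).fun_mul (hD y))
    ((((ex x).mul_const (Complex.I * k)).fun_mul hx).fun_add ((ex x).fun_mul hDD)), hDx]
  set E := r * Complex.exp (Complex.I * (k * x + (γ + k ^ 2) * t))
  -- The frequency `γ + k²` makes the plane wave itself a solution for `L = γ`; those contributions
  -- cancel and the equation for the ratio remains.
  linear_combination E * heq + (E * (γ + (k : ℂ) ^ 2) - E * (k : ℂ) ^ 2) * G.ratio χ x t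
    * Complex.I_sq

lemma smooth_ratio {k : ℝ} {χ : ℝ → ℝ → ι → ℂ} (h : G.IsResolvent k χ) :
    ContDiff ℝ ∞ (fun z : ℝ × ℝ => G.ratio χ z.1 z.2) :=
  contDiff_const.sub (G.smooth_pairing h.smooth (G.smooth_v 0))

lemma smooth_wave (r : ℂ) (k γ : ℝ) : ContDiff ℝ ∞ (fun z : ℝ × ℝ =>
    r * Complex.exp (Complex.I * (k * z.1 + (γ + k ^ 2) * z.2))) := by
  have h1 : ContDiff ℝ ∞ (fun z : ℝ × ℝ => (z.1 : ℂ)) := Complex.ofRealCLM.contDiff.comp contDiff_fst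
  have h2 : ContDiff ℝ ∞ (fun z : ℝ × ℝ => (z.2 : ℂ)) := Complex.ofRealCLM.contDiff.comp contDiff_snd
  exact contDiff_const.mul (contDiff_const.mul
    ((contDiff_const.mul h1).add (contDiff_const.mul h2))).cexp

lemma norm_wave (r : ℝ) {u : ℂ} (hu : ‖u‖ = 1) (k γ x t : ℝ) :
    ‖(r : ℂ) * u * Complex.exp (Complex.I * (k * x + (γ + k ^ 2) * t))‖ = |r| := by
  have : Complex.I * (k * x + (γ + k ^ 2) * t)
      = ((k * x + (γ + k ^ 2) * t : ℝ) : ℂ) * Complex.I := by push_cast; ring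
  rw [norm_mul, norm_mul, hu, this, Complex.norm_exp_ofReal_mul_I]
  simp

/-- The fields generated by `τ`, in terms of the Gram flow. -/
lemma Reduction.Generates.fields {R : G.Reduction c} {τ : ℤ → ℤ → ℝ → ℝ → ℂ}
    (h : R.Generates τ) : ∃ u₁ u₂ : ℂ, ‖u₁‖ = 1 ∧ ‖u₂‖ = 1 ∧
      (∀ x t, fieldA c τ x t = c.ρ₁ * u₁
        * Complex.exp (Complex.I * (c.k₁ * x + (c.γ + c.k₁ ^ 2) * t)) * G.ratio R.χ₁ x t) ∧
      (∀ x t, fieldB c τ x t = c.ρ₂ * u₂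
        * Complex.exp (Complex.I * (c.k₂ * x + (c.γ + c.k₂ ^ 2) * t)) * G.ratio R.χ₂ x t) ∧
      (∀ x t, fieldL c τ x t = c.γ - 2 * (G.wx x t).re) := by
  obtain ⟨a, b, d, u₁, u₂, h1, h2, h⟩ := h.gauge
  -- The common exponential cancels and only the unimodular constant survives.
  have key : ∀ (χ : ℝ → ℝ → ι → ℂ) (x t : ℝ) (u : ℂ),
      u * Real.exp (a * x + b * t + d) * (G.M x t - outer (G.v 0 x t) (χ x t)).det
        / (Real.exp (a * x + b * t + d) * (G.M x t).det) = u * G.ratio χ x t := by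
    intro χ x t u
    have e1 : (Real.exp (a * x + b * t + d) : ℂ) ≠ 0 :=
      Complex.ofReal_ne_zero.2 (Real.exp_pos _).ne'
    have e2 := G.det_ne_zero x t
    rw [det_sub_outer (isUnit_iff_ne_zero.2 e2)]
    simp only [ratio, pairing]
    field_simp
  refine ⟨u₁, u₂, h1, h2, fun x t => ?_, fun x t => ?_, fieldL_eq_of_gauge fun x t => (h x t).1⟩
  · rw [fieldA, (h x t).1, (h x t).2.1, key]; ring
  · rw [fieldB, (h x t).1, (h x t).2.2, key]; ring

/-- The equations for `A` and `B` are instances of `wave_equation`. For `L`, `wt_equation` shows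
that `δ₁|A|² + δ₂|B|²` is a constant minus `wt`, and `wt_x = wx_t` while `L = γ - 2 wx`. -/
theorem Reduction.Generates.isSolution {R : G.Reduction c} {τ : ℤ → ℤ → ℝ → ℝ → ℂ}
    (h : R.Generates τ) :
    IsSolution c.δ₁ c.δ₂ (fieldA c τ) (fieldB c τ) (fieldL c τ) := by
  obtain ⟨u₁, u₂, h1, h2, hA, hB, hL⟩ := h.fields
  have hAf : fieldA c τ = fun x t => _ := funext fun x => funext fun t => hA x t
  have hBf : fieldB c τ = fun x t => _ := funext fun x => funext fun t => hB x t
  have hLf : fieldL c τ = fun x t => _ := funext fun x => funext fun t => hL x t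
  have hLc : ∀ x t, (fieldL c τ x t : ℂ) = c.γ - 2 * G.wx x t := by
    intro x t
    rw [hL]; push_cast; rw [G.ofReal_re_wx]
  refine ⟨?_, ?_, ?_, fun x t => ?_, fun x t => ?_, fun x t => ?_⟩
  · rw [hAf]; exact (smooth_wave _ _ _).mul (smooth_ratio R.res₁)
  · rw [hBf]; exact (smooth_wave _ _ _).mul (smooth_ratio R.res₂)
  · rw [hLf]
    have hw : ∀ i j, ContDiff ℝ ∞ (fun z : ℝ × ℝ => G.w i j z.1 z.2) := fun i j =>
      G.smooth_pairing (G.smooth_v i) (G.smooth_v j)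
    exact contDiff_const.sub (contDiff_const.mul
      (contDiff_re (((hw 1 0).add (hw 0 1)).sub ((hw 0 0).pow 2))))
  · rw [hLc, hAf]; exact wave_equation R.res₁ _ x t
  · rw [hLc, hBf]; exact wave_equation R.res₂ _ x t
  · obtain ⟨d, hd1, hd2⟩ := G.hasDerivAt_wx_t_eq_wt_x x t
    have e1 : deriv (fun t' => fieldL c τ x t') t = - (2 * d.re) := by
      rw [hLf]
      exact (((Complex.reCLM.hasFDerivAt.comp_hasDerivAt t hd1).const_mul 2).const_sub
        c.γ).deriv
    have e2 : (fun x' => c.δ₁ * ‖fieldA c τ x' t‖ ^ 2 + c.δ₂ * ‖fieldB c τ x' t‖ ^ 2)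
        = fun x' => (c.δ₁ * c.ρ₁ ^ 2 + c.δ₂ * c.ρ₂ ^ 2) - (G.wt x' t).re := by
      funext x'
      have := congrArg Complex.re (R.wt_equation x' t)
      rw [Complex.mul_conj, Complex.mul_conj, Complex.normSq_eq_norm_sq,
        Complex.normSq_eq_norm_sq] at this
      simp only [Complex.add_re, ← Complex.ofReal_mul, Complex.ofReal_re] at this
      rw [hA, hB, norm_mul _ (G.ratio _ _ _), norm_mul _ (G.ratio _ _ _), norm_wave _ h1, norm_wave _ h2, mul_pow, mul_pow, sq_abs,
        sq_abs]
      linarith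
    rw [e1, e2]
    have : HasDerivAt (fun x' => (c.δ₁ * c.ρ₁ ^ 2 + c.δ₂ * c.ρ₂ ^ 2) - (G.wt x' t).re) (-d.re) x :=
      (Complex.reCLM.hasFDerivAt.comp_hasDerivAt x hd2).const_sub _
    rw [this.deriv]; ring

/-- Limits of the invariants of the Gram flow at infinity give a bounded rogue wave. -/
theorem Reduction.Generates.isBoundedRogueWave {R : G.Reduction c} {τ : ℤ → ℤ → ℝ → ℝ → ℂ}
    (h : R.Generates τ)
    (h₁ : Filter.Tendsto (fun z : ℝ × ℝ => ‖G.ratio R.χ₁ z.1 z.2‖)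
      (Filter.cocompact (ℝ × ℝ)) (nhds 1))
    (h₂ : Filter.Tendsto (fun z : ℝ × ℝ => ‖G.ratio R.χ₂ z.1 z.2‖)
      (Filter.cocompact (ℝ × ℝ)) (nhds 1))
    (hw : Filter.Tendsto (fun z : ℝ × ℝ => G.wx z.1 z.2)
      (Filter.cocompact (ℝ × ℝ)) (nhds 0)) :
    IsBoundedRogueWave c τ := by
  have hsol := h.isSolution
  obtain ⟨u₁, u₂, hu1, hu2, hA, hB, hL⟩ := h.fields
  have tA : Filter.Tendsto (fun z : ℝ × ℝ => ‖fieldA c τ z.1 z.2‖)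
      (Filter.cocompact (ℝ × ℝ)) (nhds |c.ρ₁|) := by
    simp only [hA, norm_mul _ (G.ratio _ _ _), norm_wave _ hu1]
    simpa using h₁.const_mul |c.ρ₁|
  have tB : Filter.Tendsto (fun z : ℝ × ℝ => ‖fieldB c τ z.1 z.2‖)
      (Filter.cocompact (ℝ × ℝ)) (nhds |c.ρ₂|) := by
    simp only [hB, norm_mul _ (G.ratio _ _ _), norm_wave _ hu2]
    simpa using h₂.const_mul |c.ρ₂|
  have tL : Filter.Tendsto (fun z : ℝ × ℝ => fieldL c τ z.1 z.2)
      (Filter.cocompact (ℝ × ℝ)) (nhds c.γ) := by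
    simp only [hL]
    simpa using ((Complex.continuous_re.tendsto 0).comp hw).const_mul 2 |>.const_sub c.γ
  have bdd : ∀ (F : ℝ × ℝ → ℝ) (l : ℝ), Continuous F →
      Filter.Tendsto F (Filter.cocompact (ℝ × ℝ)) (nhds l) → ∃ C, ∀ z, F z ≤ C := by
    intro F l hF hl
    have h1 : ∀ᶠ z in Filter.cocompact (ℝ × ℝ), F z ≤ l + 1 :=
      (hl.eventually (gt_mem_nhds (lt_add_one l))).mono fun z hz => hz.le
    obtain ⟨K, hK, hK'⟩ := Filter.mem_cocompact.1 h1
    obtain ⟨C, hC⟩ := (hK.image hF).bddAbove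
    refine ⟨max (l + 1) C, fun z => ?_⟩
    by_cases hz : z ∈ K
    · exact (hC ⟨z, hz, rfl⟩).trans (le_max_right _ _)
    · exact le_max_of_le_left (hK' hz)
  obtain ⟨a, b, d, _, _, _, _, hτ⟩ := h.gauge
  refine ⟨fun x t => ?_, fun x t => ?_, hsol, ?_, tA, tB, tL⟩
  · rw [(hτ x t).1, Complex.im_ofReal_mul, (G.det_re_pos x t).2, mul_zero]
  · rw [(hτ x t).1, Complex.re_ofReal_mul]
    exact mul_pos (Real.exp_pos _) (G.det_re_pos x t).1
  · obtain ⟨C1, h1⟩ := bdd _ _ hsol.smooth_A.continuous.norm tA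
    obtain ⟨C2, h2⟩ := bdd _ _ hsol.smooth_B.continuous.norm tB
    obtain ⟨C3, h3⟩ := bdd _ _ hsol.smooth_L.continuous.abs tL.abs
    exact ⟨max C1 (max C2 C3), fun x t => ⟨(h1 (x, t)).trans (le_max_left _ _),
      (h2 (x, t)).trans ((le_max_left _ _).trans (le_max_right _ _)),
      (h3 (x, t)).trans ((le_max_right _ _).trans (le_max_right _ _))⟩⟩

end GramFlow

end

section

/-! ### Taylor series at the origin -/

/-- The Taylor series of `F` at `0`. -/
def taylorSeries (F : ℂ → ℂ) : PowerSeries ℂ := PowerSeries.mk (taylor F)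

/-- The series with conjugate coefficients. -/
abbrev conjSeries : PowerSeries ℂ →+* PowerSeries ℂ := PowerSeries.map (starRingEnd ℂ)

@[simp] lemma coeff_taylorSeries (F : ℂ → ℂ) (n : ℕ) :
    PowerSeries.coeff n (taylorSeries F) = taylor F n := PowerSeries.coeff_mk _ _

@[simp] lemma taylor_zero_right (F : ℂ → ℂ) : taylor F 0 = F 0 := by simp [taylor]

@[simp] lemma constantCoeff_taylorSeries (F : ℂ → ℂ) :
    PowerSeries.constantCoeff (taylorSeries F) = F 0 := by
  rw [← PowerSeries.coeff_zero_eq_constantCoeff_apply]; simp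

lemma taylor_one_right (F : ℂ → ℂ) : taylor F 1 = deriv F 0 := by
  simp [taylor, iteratedDeriv_one]

lemma taylor_congr {F G : ℂ → ℂ} (h : F =ᶠ[nhds 0] G) (n : ℕ) : taylor F n = taylor G n := by
  rw [taylor, taylor, h.iteratedDeriv_eq]

lemma taylorSeries_congr {F G : ℂ → ℂ} (h : F =ᶠ[nhds 0] G) : taylorSeries F = taylorSeries G := by
  ext n; simp [taylor_congr h]

lemma taylorSeries_add {F G : ℂ → ℂ} (hF : AnalyticAt ℂ F 0) (hG : AnalyticAt ℂ G 0) :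
    taylorSeries (fun z => F z + G z) = taylorSeries F + taylorSeries G := by
  ext n
  simp only [coeff_taylorSeries, map_add, taylor]
  rw [← add_div]
  congr 1
  exact iteratedDeriv_add hF.contDiffAt hG.contDiffAt

lemma taylorSeries_const_mul (c : ℂ) (F : ℂ → ℂ) :
    taylorSeries (fun z => c * F z) = PowerSeries.C c * taylorSeries F := by
  ext n
  simp only [coeff_taylorSeries, PowerSeries.coeff_C_mul, taylor, iteratedDeriv_const_mul_field]
  ring

lemma taylorSeries_const (c : ℂ) : taylorSeries (fun _ => c) = PowerSeries.C c := by
  ext n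
  simp only [coeff_taylorSeries, taylor, iteratedDeriv_const, PowerSeries.coeff_C]
  split_ifs with h
  · simp [h]
  · simp

lemma taylorSeries_sub {F G : ℂ → ℂ} (hF : AnalyticAt ℂ F 0) (hG : AnalyticAt ℂ G 0) :
    taylorSeries (fun z => F z - G z) = taylorSeries F - taylorSeries G := by
  ext n
  simp only [coeff_taylorSeries, map_sub, taylor]
  rw [← sub_div]
  congr 1
  exact iteratedDeriv_fun_sub hF.contDiffAt hG.contDiffAt

lemma taylorSeries_mul {F G : ℂ → ℂ} (hF : AnalyticAt ℂ F 0) (hG : AnalyticAt ℂ G 0) :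
    taylorSeries (fun z => F z * G z) = taylorSeries F * taylorSeries G := by
  ext n
  rw [PowerSeries.coeff_mul, Finset.Nat.sum_antidiagonal_eq_sum_range_succ_mk]
  simp only [coeff_taylorSeries, taylor]
  have := iteratedDeriv_mul (n := n) hF.contDiffAt hG.contDiffAt
  rw [show (fun z => F z * G z) = F * G from rfl, this, Finset.sum_div]
  refine Finset.sum_congr rfl fun i hi => ?_
  have hin : i ≤ n := Nat.lt_succ_iff.1 (Finset.mem_range.1 hi)
  rw [Nat.cast_choose ℂ hin]
  have := Nat.cast_ne_zero (R := ℂ).2 n.factorial_ne_zero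
  have := Nat.cast_ne_zero (R := ℂ).2 i.factorial_ne_zero
  have := Nat.cast_ne_zero (R := ℂ).2 (n - i).factorial_ne_zero
  field_simp

lemma taylorSeries_pow {F : ℂ → ℂ} (hF : AnalyticAt ℂ F 0) (m : ℕ) :
    taylorSeries (fun z => F z ^ m) = taylorSeries F ^ m := by
  induction m with
  | zero => simp [taylorSeries_const]
  | succ m ih =>
    simp only [pow_succ]
    rw [taylorSeries_mul (hF.fun_pow m) hF, ih]

lemma taylorSeries_sum {ι : Type*} (s : Finset ι) {F : ι → ℂ → ℂ}
    (hF : ∀ i ∈ s, AnalyticAt ℂ (F i) 0) :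
    taylorSeries (fun z => ∑ i ∈ s, F i z) = ∑ i ∈ s, taylorSeries (F i) := by
  classical
  induction s using Finset.induction_on with
  | empty => simp [taylorSeries_const]
  | insert a s ha ih =>
    simp only [Finset.sum_insert ha]
    rw [taylorSeries_add (hF a (by simp))
      (Finset.analyticAt_fun_sum s fun i hi => hF i (by simp [hi])),
      ih fun i hi => hF i (by simp [hi])]

lemma taylorSeries_inv {F : ℂ → ℂ} (hF : AnalyticAt ℂ F 0) (h0 : F 0 ≠ 0) :
    taylorSeries (fun z => (F z)⁻¹) = (taylorSeries F)⁻¹ := by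
  rw [PowerSeries.eq_inv_iff_mul_eq_one (by simpa using h0), ← taylorSeries_mul (hF.fun_inv h0) hF,
    ← map_one PowerSeries.C, ← taylorSeries_const]
  refine taylorSeries_congr ?_
  filter_upwards [hF.continuousAt.eventually_ne h0] with z hz using inv_mul_cancel₀ hz

lemma taylorSeries_div {F G : ℂ → ℂ} (hF : AnalyticAt ℂ F 0) (hG : AnalyticAt ℂ G 0)
    (h0 : G 0 ≠ 0) :
    taylorSeries (fun z => F z / G z) = taylorSeries F * (taylorSeries G)⁻¹ := by
  simp only [div_eq_mul_inv]
  rw [taylorSeries_mul hF (hG.fun_inv h0), taylorSeries_inv hG h0]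

lemma taylorSeries_id : taylorSeries (fun z => z) = PowerSeries.X := by
  ext n
  simp only [coeff_taylorSeries, taylor, PowerSeries.coeff_X]
  rcases n with _ | _ | n
  · simp
  · simp [iteratedDeriv_one]
  · have : iteratedDeriv (n + 1 + 1) (fun z : ℂ => z) 0 = 0 := by
      rw [iteratedDeriv_succ', iteratedDeriv_succ']
      simp
    simp [this]

lemma iteratedDeriv_conjFun (F : ℂ → ℂ) (n : ℕ) :
    iteratedDeriv n (conjFun F) = conjFun (iteratedDeriv n F) := by
  induction n with
  | zero => simp
  | succ n ih =>
    rw [iteratedDeriv_succ, ih, iteratedDeriv_succ]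
    exact deriv_conj_conj (𝕜 := ℂ) (f := iteratedDeriv n F)

lemma taylor_conjFun (F : ℂ → ℂ) (n : ℕ) : taylor (conjFun F) n = conj (taylor F n) := by
  simp [taylor, iteratedDeriv_conjFun, conjFun]

lemma analyticAt_conjFun {F : ℂ → ℂ} {z : ℂ} (h : AnalyticAt ℂ F (conj z)) :
    AnalyticAt ℂ (conjFun F) z := by
  rw [Complex.analyticAt_iff_eventually_differentiableAt] at h ⊢
  have : Filter.Tendsto (starRingEnd ℂ) (nhds z) (nhds (conj z)) :=
    Complex.continuous_conj.tendsto z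
  filter_upwards [this.eventually h] with w hw
  exact differentiableAt_conj_conj_iff.2 hw

/-- `S_j` involves only `x₁, …, x_j`; hence the value at index `0` is irrelevant and arbitrary phase
constants can be replaced by finitely many of them. -/
lemma schur_congr {j : ℕ} {x y : ℕ → ℂ} (h : ∀ r, 1 ≤ r → r ≤ j → x r = y r) :
    schur j x = schur j y := by
  unfold schur
  refine Finset.sum_congr rfl fun m _ => ?_
  congr 1
  have : ∀ m i, i ≤ j →
      PowerSeries.coeff i ((PowerSeries.mk fun k => if k = 0 then 0 else x k) ^ m)
        = PowerSeries.coeff i ((PowerSeries.mk fun k => if k = 0 then 0 else y k) ^ m) := by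
    intro m
    induction m with
    | zero => intro i _; simp
    | succ m ih =>
      intro i hi
      rw [pow_succ, pow_succ, PowerSeries.coeff_mul, PowerSeries.coeff_mul]
      refine Finset.sum_congr rfl fun a ha => ?_
      have ha' := Finset.HasAntidiagonal.mem_antidiagonal.1 ha
      rw [ih a.1 (by omega)]
      congr 1
      simp only [PowerSeries.coeff_mk]
      split_ifs with h0
      · rfl
      · exact h _ (by omega) (by omega)
  exact this m j le_rfl

lemma conj_schur (j : ℕ) (x : ℕ → ℂ) : conj (schur j x) = schur j (fun r => conj (x r)) := by
  have : (PowerSeries.mk fun k => if k = 0 then 0 else conj (x k))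
      = conjSeries (PowerSeries.mk fun k => if k = 0 then 0 else x k) := by
    ext n; simp [apply_ite (starRingEnd ℂ)]
  simp only [schur, map_sum, map_div₀, this, ← map_pow, PowerSeries.coeff_map, Complex.conj_natCast]

/-- The Schur polynomial of the Taylor coefficients of `F` is the Taylor coefficient of `exp F`. -/
lemma schur_taylor {F : ℂ → ℂ} (hF : AnalyticAt ℂ F 0) (h0 : F 0 = 0) (j : ℕ) :
    schur j (taylor F) = taylor (fun z => Complex.exp (F z)) j := by
  obtain ⟨R, hR, hexp⟩ :=
    (analyticAt_cexp (z := 0)).exists_eventuallyEq_sum_add_pow_mul (j + 1)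
  have hser : (PowerSeries.mk fun k => if k = 0 then 0 else taylor F k) = taylorSeries F := by
    ext n
    rcases n with _ | n <;> simp [h0]
  have hF0 : Filter.Tendsto F (nhds 0) (nhds 0) := by
    have := hF.continuousAt.tendsto; rwa [h0] at this
  have hRF : AnalyticAt ℂ (fun z => R (F z)) 0 := by
    have hR' : AnalyticAt ℂ R (F 0) := by rwa [h0]
    exact hR'.comp hF
  have hev : (fun z => Complex.exp (F z)) =ᶠ[nhds 0]
      fun z => (∑ m ∈ Finset.range (j + 1), (m ! : ℂ)⁻¹ * F z ^ m) + F z ^ (j + 1) * R (F z) := by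
    filter_upwards [hF0.eventually hexp] with z hz
    rw [hz]
    simp [iteratedDeriv_eq_iterate, Complex.iter_deriv_exp, div_eq_inv_mul]
  have hpow : ∀ m, AnalyticAt ℂ (fun z => F z ^ m) 0 := fun m => hF.pow m
  have hterm : ∀ m ∈ Finset.range (j + 1), AnalyticAt ℂ (fun z => (m ! : ℂ)⁻¹ * F z ^ m) 0 :=
    fun m _ => analyticAt_const.mul (hpow m)
  rw [← coeff_taylorSeries (fun z => Complex.exp (F z)), taylorSeries_congr hev, taylorSeries_add
    (Finset.analyticAt_fun_sum _ hterm) ((hpow _).fun_mul hRF),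
    taylorSeries_mul (hpow _) hRF, taylorSeries_pow hF,
    taylorSeries_sum _ hterm, map_add, schur, hser]
  -- `F` vanishes at `0`, so the Taylor remainder of `exp` after `j + 1` terms contributes nothing
  -- to the coefficient `j`.
  have hX : PowerSeries.X ^ (j + 1) ∣ taylorSeries F ^ (j + 1) * taylorSeries fun z => R (F z) :=
    Dvd.dvd.mul_right (pow_dvd_pow_of_dvd (PowerSeries.X_dvd_iff.2 (by simpa using h0)) _) _
  rw [PowerSeries.X_pow_dvd_iff.1 hX j (Nat.lt_succ_self j), add_zero, map_sum]
  refine Finset.sum_congr rfl fun m _ => ?_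
  rw [taylorSeries_const_mul, PowerSeries.coeff_C_mul, taylorSeries_pow hF, div_eq_inv_mul]

/-- If `T = P'` along the curve `P`, then `(T ∂)^s / s!` computes Taylor coefficients along `P`. -/
lemma opPow_eq_taylor {T P F : ℂ → ℂ} {p₀ : ℂ} (hP : AnalyticAt ℂ P 0) (hP0 : P 0 = p₀)
    (hT : AnalyticAt ℂ T p₀) (hTP : ∀ᶠ z in nhds 0, T (P z) = deriv P z)
    (hF : AnalyticAt ℂ F p₀) (s : ℕ) :
    opPow T s F p₀ = taylor (fun z => F (P z)) s := by
  subst hP0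
  -- The induction must carry equality on a neighbourhood, since the next step differentiates it.
  have key : ∀ (s : ℕ) (F : ℂ → ℂ), AnalyticAt ℂ F (P 0) →
      AnalyticAt ℂ ((fun G : ℂ → ℂ => fun w => T w * deriv G w)^[s] F) (P 0) ∧
      ∀ᶠ z in nhds 0, (fun G : ℂ → ℂ => fun w => T w * deriv G w)^[s] F (P z)
        = iteratedDeriv s (fun z => F (P z)) z := by
    intro s F hF
    induction s with
    | zero => exact ⟨hF, by simp⟩
    | succ s ih =>
      obtain ⟨ih1, ih2⟩ := ih
      rw [Function.iterate_succ_apply']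
      refine ⟨hT.mul ih1.deriv, ?_⟩
      have hcont := hP.continuousAt.tendsto
      filter_upwards [hTP, ih2.eventually_nhds, hcont.eventually ih1.eventually_analyticAt,
        hP.eventually_analyticAt] with z h1 h2 h3 h4
      rw [iteratedDeriv_succ, ← Filter.EventuallyEq.deriv_eq h2, h1]
      have := (h3.differentiableAt.hasDerivAt).comp z h4.differentiableAt.hasDerivAt
      rw [mul_comm]
      exact this.deriv.symm
  rw [opPow, taylor, (key s F hF).2.self_of_nhds]

lemma opPow_congr {T F G : ℂ → ℂ} {z : ℂ} (h : F =ᶠ[nhds z] G) (s : ℕ) :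
    opPow T s F z = opPow T s G z := by
  have : (fun G : ℂ → ℂ => fun w => T w * deriv G w)^[s] F =ᶠ[nhds z]
      (fun G : ℂ → ℂ => fun w => T w * deriv G w)^[s] G := by
    induction s with
    | zero => exact h
    | succ s ih =>
      simp only [Function.iterate_succ_apply']
      filter_upwards [ih.deriv] with w hw
      rw [hw]
  rw [opPow, opPow, this.eq_of_nhds]

end

section

open PowerSeries

/-! ### Finite expansions of the Cauchy kernel -/

lemma coeff_conjSeries (F : PowerSeries ℂ) (n : ℕ) :
    coeff n (conjSeries F) = conj (coeff n F) := PowerSeries.coeff_map _ _ _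

lemma constantCoeff_conjSeries (F : PowerSeries ℂ) :
    constantCoeff (conjSeries F) = conj (constantCoeff F) := by
  rw [← coeff_zero_eq_constantCoeff_apply, coeff_conjSeries, coeff_zero_eq_constantCoeff_apply]

/-- The finite Blaschke product with zeros `z m` and poles `-(z' m)^*`, `m < l`. -/
def blaschke (z z' : ℕ → ℂ) (p : PowerSeries ℂ) (l : ℕ) : PowerSeries ℂ :=
  ∏ m ∈ Finset.range l, (p - C (z m)) * (p + C (conj (z' m)))⁻¹

/-- The rational functions of Takenaka-Malmquist type built from Blaschke products. -/
def tmBasis (z z' : ℕ → ℂ) (p : PowerSeries ℂ) (l : ℕ) : PowerSeries ℂ :=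
  blaschke z z' p l * (p + C (conj (z' l)))⁻¹

/-- The coefficient of `κ^s κ'^j` in the expansion of `U(κ) V(κ') / (p(κ) + p'^*(κ'))` truncated to
`L` terms. -/
def cauchyKernel (z z' : ℕ → ℂ) (L : ℕ) (p p' U V : PowerSeries ℂ) (s j : ℕ) : ℂ :=
  ∑ l ∈ Finset.range L, (z l + conj (z' l)) * coeff s (U * tmBasis z z' p l)
    * coeff j (V * conjSeries (tmBasis z' z p' l))

section CauchyKernel

variable {z z' : ℕ → ℂ} {L : ℕ} {p p' : PowerSeries ℂ}

lemma cauchyKernel_add_left (U U' V : PowerSeries ℂ) (s j : ℕ) :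
    cauchyKernel z z' L p p' (U + U') V s j
      = cauchyKernel z z' L p p' U V s j + cauchyKernel z z' L p p' U' V s j := by
  simp only [cauchyKernel, add_mul, mul_add, map_add, Finset.sum_add_distrib]

lemma cauchyKernel_add_right (U V V' : PowerSeries ℂ) (s j : ℕ) :
    cauchyKernel z z' L p p' U (V + V') s j
      = cauchyKernel z z' L p p' U V s j + cauchyKernel z z' L p p' U V' s j := by
  simp only [cauchyKernel, add_mul, mul_add, map_add, Finset.sum_add_distrib]

lemma cauchyKernel_C_mul_left (c : ℂ) (U V : PowerSeries ℂ) (s j : ℕ) :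
    cauchyKernel z z' L p p' (C c * U) V s j = c * cauchyKernel z z' L p p' U V s j := by
  simp only [cauchyKernel, mul_assoc (C c), coeff_C_mul, Finset.mul_sum]
  exact Finset.sum_congr rfl fun l _ => by ring

lemma cauchyKernel_C_mul_right (c : ℂ) (U V : PowerSeries ℂ) (s j : ℕ) :
    cauchyKernel z z' L p p' U (C c * V) s j = c * cauchyKernel z z' L p p' U V s j := by
  simp only [cauchyKernel, mul_assoc (C c), coeff_C_mul, Finset.mul_sum]
  exact Finset.sum_congr rfl fun l _ => by ring

/-- The defining property of the Cauchy kernel, up to the truncation error. -/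
lemma cauchyKernel_lyapunov_remainder
    (h : ∀ l < L, constantCoeff p + conj (z' l) ≠ 0)
    (h' : ∀ l < L, constantCoeff p' + conj (z l) ≠ 0) (U V : PowerSeries ℂ) (s j : ℕ) :
    cauchyKernel z z' L p p' (p * U) V s j + cauchyKernel z z' L p p' U (conjSeries p' * V) s j
      = coeff s U * coeff j V - coeff s (U * blaschke z z' p L)
        * coeff j (V * conjSeries (blaschke z' z p' L)) := by
  induction L with
  | zero => simp [cauchyKernel, blaschke]
  | succ L ih =>
    have ih := ih (fun l hl => h l (by omega)) (fun l hl => h' l (by omega))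
    simp only [cauchyKernel, Finset.sum_range_succ] at ih ⊢
    have e1 : (p + C (conj (z' L))) * (p + C (conj (z' L)))⁻¹ = 1 :=
      PowerSeries.mul_inv_cancel _ (by simpa using h L (Nat.lt_succ_self L))
    have e2 : (p' + C (conj (z L))) * (p' + C (conj (z L)))⁻¹ = 1 :=
      PowerSeries.mul_inv_cancel _ (by simpa using h' L (Nat.lt_succ_self L))
    -- With `q = p'^*`, `a = z'^*`: the old remainder is `(p + a)F · (q + z)G`, the new one is `(p -
    -- z)F · (q - a)G`, and their difference is `(z + a)(p + q)FG`, the contribution of the added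
    -- term.
    set F := U * tmBasis z z' p L with hF
    set G := V * conjSeries (tmBasis z' z p' L) with hG
    have a1 : p * U * tmBasis z z' p L = p * F := by rw [hF]; ring
    have a2 : U * blaschke z z' p L = p * F + C (conj (z' L)) * F := by
      rw [hF, tmBasis]
      calc _ = U * blaschke z z' p L * ((p + C (conj (z' L))) * (p + C (conj (z' L)))⁻¹) := by
            rw [e1, mul_one]
        _ = _ := by ring
    have a3 : U * blaschke z z' p (L + 1) = p * F - C (z L) * F := by
      rw [hF, tmBasis, blaschke, Finset.prod_range_succ, ← blaschke]; ring
    have b1 : conjSeries p' * V * conjSeries (tmBasis z' z p' L) = conjSeries p' * G := by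
      rw [hG]; ring
    have b2 : V * conjSeries (blaschke z' z p' L) = conjSeries p' * G + C (z L) * G := by
      rw [hG, tmBasis]
      calc _ = V * conjSeries (blaschke z' z p' L
              * ((p' + C (conj (z L))) * (p' + C (conj (z L)))⁻¹)) := by rw [e2, mul_one]
        _ = _ := by simp only [map_mul, map_add, PowerSeries.map_C, Complex.conj_conj]; ring
    have b3 : V * conjSeries (blaschke z' z p' (L + 1))
        = conjSeries p' * G - C (conj (z' L)) * G := by
      rw [hG, tmBasis, blaschke, Finset.prod_range_succ, ← blaschke]
      simp only [map_mul, map_sub, PowerSeries.map_C]; ring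
    rw [a2, b2] at ih
    rw [a1, b1, a3, b3]
    simp only [map_add, map_sub, coeff_C_mul] at ih ⊢
    linear_combination ih

/-- A bilinear functional on pairs of series annihilated by `p + p'^*` vanishes. -/
lemma bilinear_eq_zero {q : PowerSeries ℂ} (hpq : constantCoeff p + constantCoeff q ≠ 0)
    {s j : ℕ} (D : PowerSeries ℂ → PowerSeries ℂ → ℂ)
    (add_left : ∀ U U' V, D (U + U') V = D U V + D U' V)
    (add_right : ∀ U V V', D U (V + V') = D U V + D U V')
    (C_left : ∀ c U V, D (C c * U) V = c * D U V)
    (C_right : ∀ c U V, D U (C c * V) = c * D U V)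
    (lyap : ∀ U V, D (p * U) V + D U (q * V) = 0)
    (left : ∀ U V, X ^ (s + 1) ∣ U → D U V = 0)
    (right : ∀ U V, X ^ (j + 1) ∣ V → D U V = 0) (U V : PowerSeries ℂ) : D U V = 0 := by
  -- `p + q` is a nonzero constant plus terms that raise the `X`-adic order of one argument, so the
  -- value at orders `(a, b)` reduces to orders `(a + 1, b)` and `(a, b + 1)`; once `a + b > s + j`
  -- the functional vanishes.
  have key : ∀ k a b : ℕ, s + j + 1 ≤ a + b + k → ∀ U V : PowerSeries ℂ, X ^ a ∣ U → X ^ b ∣ V →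
      D U V = 0 := by
    intro k
    induction k with
    | zero =>
      intro a b hab U V hU hV
      by_cases ha : s + 1 ≤ a
      · exact left U V ((pow_dvd_pow _ ha).trans hU)
      · exact right U V ((pow_dvd_pow _ (by omega)).trans hV)
    | succ k ih =>
      intro a b hab U V hU hV
      have hp : X ∣ p - C (constantCoeff p) := by simp [X_dvd_iff]
      have hq : X ∣ q - C (constantCoeff q) := by simp [X_dvd_iff]
      have h1 := ih (a + 1) b (by omega) ((p - C (constantCoeff p)) * U) V
        (by rw [pow_succ, mul_comm (X ^ a)]; exact mul_dvd_mul hp hU) hV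
      have h2 := ih a (b + 1) (by omega) U ((q - C (constantCoeff q)) * V) hU
        (by rw [pow_succ, mul_comm (X ^ b)]; exact mul_dvd_mul hq hV)
      have h3 := lyap U V
      have e1 : p * U = (p - C (constantCoeff p)) * U + C (constantCoeff p) * U := by ring
      have e2 : q * V = (q - C (constantCoeff q)) * V + C (constantCoeff q) * V := by ring
      rw [e1, e2, add_left, add_right, C_left, C_right, h1, h2, zero_add, zero_add, ← add_mul] at h3
      exact (mul_eq_zero.1 h3).resolve_left hpq
  exact key (s + j + 1) 0 0 (by omega) U V (by simp) (by simp)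

lemma coeff_mul_eq_zero_of_X_pow_dvd {U : PowerSeries ℂ} {s n : ℕ} (hs : s < n) (hU : X ^ n ∣ U)
    (F : PowerSeries ℂ) : coeff s (U * F) = 0 :=
  X_pow_dvd_iff.1 (hU.mul_right F) s hs

/-- Vanishing of one factor of the remainder is enough, so only the index `s` has to lie below the
truncation order. -/
lemma cauchyKernel_lyapunov {n : ℕ}
    (h : ∀ l < L, constantCoeff p + conj (z' l) ≠ 0)
    (h' : ∀ l < L, constantCoeff p' + conj (z l) ≠ 0)
    (hB : X ^ n ∣ blaschke z z' p L) {s j : ℕ} (hs : s < n) (U V : PowerSeries ℂ) :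
    cauchyKernel z z' L p p' (p * U) V s j + cauchyKernel z z' L p p' U (conjSeries p' * V) s j
      = coeff s U * coeff j V := by
  rw [cauchyKernel_lyapunov_remainder h h', mul_comm U (blaschke _ _ _ _),
    coeff_mul_eq_zero_of_X_pow_dvd hs hB, zero_mul, sub_zero]

/-- Two finite expansions of the Cauchy kernel agree. -/
lemma cauchyKernel_unique {w w' : ℕ → ℂ} {L' n : ℕ}
    (hpp : constantCoeff p + conj (constantCoeff p') ≠ 0)
    (h : ∀ l < L, constantCoeff p + conj (z' l) ≠ 0)
    (h' : ∀ l < L, constantCoeff p' + conj (z l) ≠ 0)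
    (hB : X ^ n ∣ blaschke z z' p L)
    (hw : ∀ l < L', constantCoeff p + conj (w' l) ≠ 0)
    (hw' : ∀ l < L', constantCoeff p' + conj (w l) ≠ 0)
    (hBw : X ^ n ∣ blaschke w w' p L') {s j : ℕ} (hs : s < n) (U V : PowerSeries ℂ) :
    cauchyKernel z z' L p p' U V s j = cauchyKernel w w' L' p p' U V s j := by
  have := bilinear_eq_zero (p := p) (q := conjSeries p') (by rwa [constantCoeff_conjSeries]) (s := s) (j := j)
    (fun U V => cauchyKernel z z' L p p' U V s j - cauchyKernel w w' L' p p' U V s j)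
    (fun U U' V => by simp only [cauchyKernel_add_left]; ring)
    (fun U V V' => by simp only [cauchyKernel_add_right]; ring)
    (fun c U V => by simp only [cauchyKernel_C_mul_left]; ring)
    (fun c U V => by simp only [cauchyKernel_C_mul_right]; ring)
    (fun U V => by
      have h1 := cauchyKernel_lyapunov h h' hB hs U V (j := j)
      have h2 := cauchyKernel_lyapunov hw hw' hBw hs U V (j := j)
      linear_combination h1 - h2)
    (fun U V hU => by
      simp [cauchyKernel, coeff_mul_eq_zero_of_X_pow_dvd (Nat.lt_succ_self s) hU])
    (fun U V hV => by
      simp [cauchyKernel, coeff_mul_eq_zero_of_X_pow_dvd (Nat.lt_succ_self j) hV]) U V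
  exact sub_eq_zero.1 this

/-- Multiplication by a series as a finite Toeplitz matrix. -/
lemma coeff_mul_eq_sum_range {s n : ℕ} (hs : s < n) (U F : PowerSeries ℂ) :
    coeff s (U * F) = ∑ ν ∈ Finset.range n, coeff s (U * X ^ ν) * coeff ν F := by
  rw [mul_comm U F, coeff_mul, Finset.Nat.sum_antidiagonal_eq_sum_range_succ_mk]
  have : Finset.range n = Finset.range (s + 1) ∪ Finset.Ico (s + 1) n := by
    ext i; simp; omega
  rw [this, Finset.sum_union (by
    rw [Finset.disjoint_left]; intro i; simp; omega)]
  rw [Finset.sum_eq_zero (s := Finset.Ico _ _), add_zero]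
  · refine Finset.sum_congr rfl fun i hi => ?_
    rw [coeff_mul_X_pow', if_pos (by simpa [Nat.lt_succ_iff] using hi), mul_comm]
  · intro i hi
    rw [coeff_mul_X_pow', if_neg (by simp at hi; omega), zero_mul]

/-- Multiplication by an even series preserves the odd coefficients. -/
lemma coeff_even_mul_eq_sum_range {s n : ℕ} (hs : s < n) {U : PowerSeries ℂ}
    (hU : ∀ r, Odd r → coeff r U = 0) (F : PowerSeries ℂ) :
    coeff (2 * s + 1) (U * F)
      = ∑ i ∈ Finset.range n, coeff (2 * s + 1) (U * X ^ (2 * i + 1)) * coeff (2 * i + 1) F := by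
  -- Here `2 s + 1 - 2 i` is odd, so the even series does not couple even to odd coefficients.
  have h0 : ∀ i ∈ Finset.range n,
      coeff (2 * s + 1) (U * X ^ (2 * i)) * coeff (2 * i) F = 0 := by
    intro i _
    rw [coeff_mul_X_pow']
    split_ifs with h
    · rw [hU _ ⟨s - i, by omega⟩, zero_mul]
    · rw [zero_mul]
  rw [coeff_mul_eq_sum_range (n := 2 * n) (by omega)]
  have key : ∀ (n : ℕ) (f : ℕ → ℂ), ∑ ν ∈ Finset.range (2 * n), f ν
      = ∑ i ∈ Finset.range n, f (2 * i) + ∑ i ∈ Finset.range n, f (2 * i + 1) := by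
    intro n f
    induction n with
    | zero => simp
    | succ n ih =>
      rw [show 2 * (n + 1) = 2 * n + 1 + 1 by ring, Finset.sum_range_succ, Finset.sum_range_succ,
        ih, Finset.sum_range_succ, Finset.sum_range_succ]
      ring
  rw [key, Finset.sum_eq_zero h0, zero_add]

end CauchyKernel

end

section

open PowerSeries

/-! ### Positivity of the Cauchy kernel at two points -/

/-- Two local parametrizations around distinct points in the right half plane. -/
structure LocalPair where
  p : Fin 2 → PowerSeries ℂ
  re_pos : ∀ α, 0 < (constantCoeff (p α)).re
  ne : constantCoeff (p 0) ≠ constantCoeff (p 1)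
  coeff_one : ∀ α, coeff 1 (p α) ≠ 0

namespace LocalPair

variable (S : LocalPair) (n : ℕ)

/-- The base points. -/
def p₀ (α : Fin 2) : ℂ := constantCoeff (S.p α)

/-- The nodes of the expansion: `n` times each base point. -/
def node (l : ℕ) : ℂ := if l < n then S.p₀ 0 else S.p₀ 1

lemma add_conj_ne_zero (α β : Fin 2) : S.p₀ α + conj (S.p₀ β) ≠ 0 := by
  intro h
  have := congrArg Complex.re h
  simp only [Complex.add_re, Complex.conj_re, Complex.zero_re] at this
  have h1 := S.re_pos α
  have h2 := S.re_pos β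
  simp only [p₀] at this
  linarith

lemma node_re_pos (l : ℕ) : 0 < (S.node n l).re := by
  unfold node; split_ifs <;> exact S.re_pos _

lemma add_conj_node_ne_zero (α : Fin 2) (l : ℕ) :
    constantCoeff (S.p α) + conj (S.node n l) ≠ 0 := by
  unfold node; split_ifs <;> exact S.add_conj_ne_zero _ _

/-- The vanishing order at the base point `α` of the Blaschke product with `l` factors. -/
def ord (α : Fin 2) (l : ℕ) : ℕ := if α = 0 then min l n else l - n

lemma constantCoeff_inv_ne_zero {F : PowerSeries ℂ} (h : constantCoeff F ≠ 0) :
    constantCoeff F⁻¹ ≠ 0 := by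
  rw [constantCoeff_inv]; exact inv_ne_zero h

/-- A factor whose node is the base point vanishes there to first order, because the linear
coefficient of `p` is nonzero; every other factor is a unit, because the base points are distinct.
So the order is exact. -/
lemma blaschke_node_eq (α : Fin 2) (l : ℕ) :
    ∃ G : PowerSeries ℂ, constantCoeff G ≠ 0 ∧
      blaschke (S.node n) (S.node n) (S.p α) l = X ^ ord n α l * G := by
  induction l with
  | zero => exact ⟨1, by simp, by simp [blaschke, ord]⟩
  | succ l ih =>
    obtain ⟨G, hG, hB⟩ := ih
    have hinv : constantCoeff (S.p α + C (conj (S.node n l)))⁻¹ ≠ 0 :=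
      constantCoeff_inv_ne_zero (by simpa using S.add_conj_node_ne_zero n α l)
    rw [blaschke, Finset.prod_range_succ, ← blaschke, hB]
    by_cases hz : S.node n l = S.p₀ α
    · have hord : ord n α (l + 1) = ord n α l + 1 := by
        have h01 : S.p₀ 0 ≠ S.p₀ 1 := S.ne
        unfold node at hz
        unfold ord
        fin_cases α <;> split_ifs at hz <;> simp_all <;> omega
      obtain ⟨g, hg⟩ : X ∣ S.p α - C (S.p₀ α) := by simp [X_dvd_iff, p₀]
      have hg0 : constantCoeff g ≠ 0 := by
        have h1 := congrArg (coeff 1) hg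
        rw [coeff_succ_X_mul 0 g] at h1
        simp only [map_sub, coeff_C, one_ne_zero, if_false, sub_zero] at h1
        rw [← coeff_zero_eq_constantCoeff_apply, ← h1]
        exact S.coeff_one α
      refine ⟨G * (g * (S.p α + C (conj (S.node n l)))⁻¹), ?_, ?_⟩
      · rw [map_mul, map_mul]; exact mul_ne_zero hG (mul_ne_zero hg0 hinv)
      · rw [hz, hg, hord, pow_succ]; ring
    · have hord : ord n α (l + 1) = ord n α l := by
        unfold node at hz
        unfold ord
        fin_cases α <;> split_ifs at hz <;> simp_all <;> omega
      refine ⟨G * ((S.p α - C (S.node n l)) * (S.p α + C (conj (S.node n l)))⁻¹), ?_, ?_⟩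
      · rw [map_mul, map_mul]
        refine mul_ne_zero hG (mul_ne_zero ?_ hinv)
        rw [map_sub, constantCoeff_C]
        exact sub_ne_zero.2 (Ne.symm hz)
      · rw [hord]; ring

/-- The Cauchy kernel `1 / (p_α(κ) + p_β^*(κ'))` with weights `U`, `V`. -/
def kernel (α β : Fin 2) (U V : PowerSeries ℂ) (s j : ℕ) : ℂ :=
  cauchyKernel (S.node n) (S.node n) (2 * n) (S.p α) (S.p β) U V s j

lemma X_pow_dvd_blaschke (α : Fin 2) :
    X ^ n ∣ blaschke (S.node n) (S.node n) (S.p α) (2 * n) := by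
  obtain ⟨G, -, hG⟩ := S.blaschke_node_eq n α (2 * n)
  have : ord n α (2 * n) = n := by unfold ord; split_ifs <;> omega
  rw [hG, this]
  exact Dvd.intro _ rfl

lemma kernel_lyapunov (α β : Fin 2) (U V : PowerSeries ℂ) {s : ℕ} (hs : s < n) (j : ℕ) :
    S.kernel n α β (S.p α * U) V s j + S.kernel n α β U (conjSeries (S.p β) * V) s j
      = coeff s U * coeff j V :=
  cauchyKernel_lyapunov (fun l _ => S.add_conj_node_ne_zero n α l)
    (fun l _ => S.add_conj_node_ne_zero n β l) (S.X_pow_dvd_blaschke n α) hs U V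

/-- The basis functions, expanded at both base points, as a square matrix. -/
def basisMatrix : Matrix (Fin (2 * n)) (Fin (2 * n)) ℂ := Matrix.of fun m l =>
  if (m : ℕ) < n then coeff m (tmBasis (S.node n) (S.node n) (S.p 0) l)
  else coeff (m - n : ℕ) (tmBasis (S.node n) (S.node n) (S.p 1) l)

/-- The `l`-th function has order exactly `l` at the first point for `l < n`, and order `n` there
and exactly `l - n` at the second point for `l ≥ n`: the matrix is lower triangular with nonzero
diagonal. -/
lemma basisMatrix_det_ne_zero : (S.basisMatrix n).det ≠ 0 := by
  have hG : ∀ (α : Fin 2) (l : ℕ), ∃ G : PowerSeries ℂ, constantCoeff G ≠ 0 ∧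
      tmBasis (S.node n) (S.node n) (S.p α) l = X ^ ord n α l * G := by
    intro α l
    obtain ⟨G, hG, hB⟩ := S.blaschke_node_eq n α l
    refine ⟨G * (S.p α + C (conj (S.node n l)))⁻¹, ?_, by rw [tmBasis, hB]; ring⟩
    rw [map_mul]
    exact mul_ne_zero hG
      (constantCoeff_inv_ne_zero (by simpa using S.add_conj_node_ne_zero n α l))
  have hdiag : ∀ (α : Fin 2) (l m : ℕ), ord n α l = m →
      coeff m (tmBasis (S.node n) (S.node n) (S.p α) l) ≠ 0 := by
    intro α l m h
    obtain ⟨G, hG0, hG⟩ := hG α l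
    rw [hG, h, coeff_X_pow_mul', if_pos le_rfl, Nat.sub_self, coeff_zero_eq_constantCoeff_apply]
    exact hG0
  have hzero : ∀ (α : Fin 2) (l m : ℕ), m < ord n α l →
      coeff m (tmBasis (S.node n) (S.node n) (S.p α) l) = 0 := by
    intro α l m h
    obtain ⟨G, -, hG⟩ := hG α l
    rw [hG, coeff_X_pow_mul', if_neg (by omega)]
  rw [Matrix.det_of_isLowerTriangular]
  · refine Finset.prod_ne_zero_iff.2 fun m _ => ?_
    simp only [basisMatrix, Matrix.of_apply]
    split_ifs with h
    · exact hdiag 0 m m (by unfold ord; simp; omega)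
    · exact hdiag 1 m _ (by unfold ord; simp)
  · intro m l hml
    have hml : m < l := hml
    have : (m : ℕ) < l := hml
    simp only [basisMatrix, Matrix.of_apply]
    split_ifs with h
    · exact hzero 0 l m (by unfold ord; simp; omega)
    · exact hzero 1 l _ (by unfold ord; simp; omega)

/-- Any pair of series agrees modulo `X ^ n` with a combination of the basis functions. -/
lemma exists_basis_combination (F : Fin 2 → PowerSeries ℂ) :
    ∃ x : Fin (2 * n) → ℂ, ∀ α, ∀ ν < n,
      coeff ν (F α) = ∑ l, x l * coeff ν (tmBasis (S.node n) (S.node n) (S.p α) l) := by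
  have hu : IsUnit (S.basisMatrix n).det := isUnit_iff_ne_zero.2 (S.basisMatrix_det_ne_zero n)
  set y : Fin (2 * n) → ℂ := fun m =>
    if (m : ℕ) < n then coeff m (F 0) else coeff (m - n : ℕ) (F 1) with hy
  have hx : (S.basisMatrix n).mulVec ((S.basisMatrix n)⁻¹.mulVec y) = y := by
    rw [Matrix.mulVec_mulVec, Matrix.mul_nonsing_inv _ hu, Matrix.one_mulVec]
  refine ⟨(S.basisMatrix n)⁻¹.mulVec y, fun α ν hν => ?_⟩
  fin_cases α
  · have := congrFun hx ⟨ν, by omega⟩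
    simp only [hy, Matrix.mulVec, dotProduct, basisMatrix, Matrix.of_apply, if_pos hν] at this
    simp only [Fin.zero_eta]
    rw [← this]
    exact Finset.sum_congr rfl fun l _ => mul_comm _ _
  · have := congrFun hx ⟨ν + n, by omega⟩
    simp only [hy, Matrix.mulVec, dotProduct, basisMatrix, Matrix.of_apply,
      if_neg (show ¬ ν + n < n by omega), Nat.add_sub_cancel] at this
    simp only [Fin.mk_one]
    rw [← this]
    exact Finset.sum_congr rfl fun l _ => mul_comm _ _

/-- The expansion of the kernel is a factorization `Y D Y^*` with diagonal entries `2 Re z_l > 0`.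
It remains that the rows of `Y` are independent, which holds because the basis functions interpolate
arbitrary jets at both points. -/
theorem kernel_posDef {ι : Type*} [Fintype ι] [DecidableEq ι] (blk : ι → Fin 2) (idx : ι → ℕ)
    (hinj : ∀ i j, blk i = blk j → idx i = idx j → i = j) (hidx : ∀ i, idx i < n)
    (U : Fin 2 → PowerSeries ℂ) (hU : ∀ α, constantCoeff (U α) ≠ 0) :
    (Matrix.of fun i j : ι => S.kernel n (blk i) (blk j) (U (blk i))
      (conjSeries (U (blk j))) (idx i) (idx j)).PosDef := by
  set Y : Matrix ι (Fin (2 * n)) ℂ := Matrix.of fun i l =>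
    coeff (idx i) (U (blk i) * tmBasis (S.node n) (S.node n) (S.p (blk i)) l) with hY
  set D : Matrix (Fin (2 * n)) (Fin (2 * n)) ℂ :=
    Matrix.diagonal fun l => ((2 * (S.node n l).re : ℝ) : ℂ) with hD
  have hM : (Matrix.of fun i j : ι => S.kernel n (blk i) (blk j) (U (blk i))
      (conjSeries (U (blk j))) (idx i) (idx j)) = Y * D * Y.conjTranspose := by
    ext i j
    rw [Matrix.mul_apply, Matrix.of_apply, kernel, cauchyKernel, Finset.sum_range]
    refine Finset.sum_congr rfl fun l _ => ?_
    rw [hD, Matrix.mul_diagonal, Matrix.conjTranspose_apply, Complex.add_conj,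
      ← map_mul conjSeries, coeff_conjSeries, RCLike.star_def]
    simp only [hY, Matrix.of_apply]
    ring
  rw [hM]
  refine Matrix.PosDef.mul_mul_conjTranspose_same ?_ ?_
  · refine Matrix.PosDef.diagonal fun l => ?_
    rw [Complex.zero_lt_real]
    have := S.node_re_pos n l
    linarith
  · rw [← Matrix.coe_vecMulLinear, injective_iff_map_eq_zero]
    intro y hy
    have hy : ∀ l : Fin (2 * n), ∑ i, y i * coeff (idx i)
        (U (blk i) * tmBasis (S.node n) (S.node n) (S.p (blk i)) l) = 0 := fun l => congrFun hy l
    -- A relation between the rows annihilates each basis function, hence every pair of series,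
    -- since only the coefficients below `n` enter.
    have hΛ : ∀ F : Fin 2 → PowerSeries ℂ,
        ∑ i, y i * coeff (idx i) (U (blk i) * F (blk i)) = 0 := by
      intro F
      obtain ⟨x, hx⟩ := S.exists_basis_combination n F
      have : ∀ i, coeff (idx i) (U (blk i) * F (blk i)) = ∑ l, x l * coeff (idx i)
          (U (blk i) * tmBasis (S.node n) (S.node n) (S.p (blk i)) l) := by
        intro i
        have e : ∑ l : Fin (2 * n), x l * coeff (idx i)
              (U (blk i) * tmBasis (S.node n) (S.node n) (S.p (blk i)) l)
            = ∑ l : Fin (2 * n), ∑ ν ∈ Finset.range n, x l * (coeff (idx i) (U (blk i) * X ^ ν)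
              * coeff ν (tmBasis (S.node n) (S.node n) (S.p (blk i)) l)) :=
          Finset.sum_congr rfl fun l _ => by
            rw [coeff_mul_eq_sum_range (hidx i), Finset.mul_sum]
        rw [coeff_mul_eq_sum_range (hidx i), e, Finset.sum_comm]
        refine Finset.sum_congr rfl fun ν hν => ?_
        rw [hx _ ν (Finset.mem_range.1 hν), Finset.mul_sum]
        exact Finset.sum_congr rfl fun l _ => by ring
      simp only [this, Finset.mul_sum]
      rw [Finset.sum_comm]
      refine Finset.sum_eq_zero fun l _ => ?_
      have := congrArg (x l * ·) (hy l)
      simp only [Finset.mul_sum, mul_zero] at this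
      rw [← this]
      exact Finset.sum_congr rfl fun i _ => by ring
    funext i₀
    -- This pair of jets is dual to the row `i₀`: it cancels the weight there and vanishes at the
    -- other base point.
    have := hΛ fun α => if α = blk i₀ then (U α)⁻¹ * X ^ idx i₀ else 0
    rw [Finset.sum_eq_single i₀] at this
    · rw [if_pos rfl, ← mul_assoc, PowerSeries.mul_inv_cancel _ (hU _), one_mul,
        coeff_X_pow_self, mul_one] at this
      exact this
    · intro i _ hi
      by_cases hb : blk i = blk i₀
      · rw [if_pos hb, ← mul_assoc, PowerSeries.mul_inv_cancel _ (hU _), one_mul, coeff_X_pow,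
          if_neg fun h => hi (hinj _ _ hb h), mul_zero]
      · rw [if_neg hb, mul_zero, map_zero, mul_zero]
    · simp

end LocalPair

end

section

open PowerSeries

namespace LocalPair

variable (S : LocalPair) (n : ℕ)

/-! ### Algebra of the Cauchy kernel -/

lemma kernel_add_left (α β : Fin 2) (U U' V : PowerSeries ℂ) (s j : ℕ) :
    S.kernel n α β (U + U') V s j = S.kernel n α β U V s j + S.kernel n α β U' V s j :=
  cauchyKernel_add_left _ _ _ _ _

lemma kernel_add_right (α β : Fin 2) (U V V' : PowerSeries ℂ) (s j : ℕ) :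
    S.kernel n α β U (V + V') s j = S.kernel n α β U V s j + S.kernel n α β U V' s j :=
  cauchyKernel_add_right _ _ _ _ _

lemma kernel_C_mul_left (α β : Fin 2) (c : ℂ) (U V : PowerSeries ℂ) (s j : ℕ) :
    S.kernel n α β (C c * U) V s j = c * S.kernel n α β U V s j :=
  cauchyKernel_C_mul_left _ _ _ _ _

lemma kernel_C_mul_right (α β : Fin 2) (c : ℂ) (U V : PowerSeries ℂ) (s j : ℕ) :
    S.kernel n α β U (C c * V) s j = c * S.kernel n α β U V s j :=
  cauchyKernel_C_mul_right _ _ _ _ _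

lemma conjSeries_conjSeries (F : PowerSeries ℂ) : conjSeries (conjSeries F) = F := by
  ext m; simp only [coeff_conjSeries, Complex.conj_conj]

lemma conj_kernel (α β : Fin 2) (U V : PowerSeries ℂ) (s j : ℕ) :
    conj (S.kernel n α β U V s j)
      = S.kernel n β α (conjSeries V) (conjSeries U) j s := by
  simp only [kernel, cauchyKernel, map_sum]
  refine Finset.sum_congr rfl fun l _ => ?_
  rw [map_mul (starRingEnd ℂ), map_mul (starRingEnd ℂ), ← coeff_conjSeries, ← coeff_conjSeries,
    map_mul conjSeries, map_mul conjSeries, conjSeries_conjSeries, map_add, Complex.conj_conj]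
  ring

/-- The resolvent series `1 / (p_α - i k)`. -/
def resolvent (k : ℝ) (α : Fin 2) : PowerSeries ℂ := (S.p α - C (Complex.I * k))⁻¹

lemma p_sub_ne_zero (k : ℝ) (α : Fin 2) : S.p₀ α - Complex.I * k ≠ 0 := by
  intro h
  have := congrArg Complex.re h
  have h1 := S.re_pos α
  simp only [Complex.sub_re, Complex.mul_re, Complex.I_re, Complex.I_im, Complex.ofReal_re,
    Complex.ofReal_im, Complex.zero_re, p₀] at this
  linarith

lemma p_mul_resolvent (k : ℝ) (α : Fin 2) :
    S.p α * S.resolvent k α = 1 + C (Complex.I * k) * S.resolvent k α := by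
  have : (S.p α - C (Complex.I * k)) * S.resolvent k α = 1 :=
    PowerSeries.mul_inv_cancel _ (by
      rw [map_sub, constantCoeff_C]; exact S.p_sub_ne_zero k α)
  linear_combination this

lemma conj_p_mul_resolvent (k : ℝ) (α : Fin 2) :
    conjSeries (S.p α) * conjSeries (S.resolvent k α)
      = 1 + C (-(Complex.I * k)) * conjSeries (S.resolvent k α) := by
  rw [← map_mul, p_mul_resolvent, map_add, map_one, map_mul conjSeries, PowerSeries.map_C]
  simp

/-- The Lyapunov identity applied to the pair with both resolvents inserted; since `k` is real the
two terms in `± i k` cancel. -/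
lemma kernel_resolvent (k : ℝ) (α β : Fin 2) (U V : PowerSeries ℂ) {s : ℕ} (hs : s < n) (j : ℕ) :
    S.kernel n α β (S.resolvent k α * U) V s j
      + S.kernel n α β U (conjSeries (S.resolvent k β) * V) s j
      = coeff s (S.resolvent k α * U) * coeff j (conjSeries (S.resolvent k β) * V) := by
  rw [← S.kernel_lyapunov n α β _ _ hs j, ← mul_assoc, p_mul_resolvent, ← mul_assoc,
    conj_p_mul_resolvent, add_mul, add_mul, one_mul, one_mul, mul_assoc, mul_assoc, kernel_add_left,
    kernel_add_right, kernel_C_mul_left, kernel_C_mul_right]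
  ring

/-- This is `p² - q² = (p + q)(p - q)`, and it makes the `t`-derivative of `M` a difference of two
rank one terms. -/
lemma kernel_sq (α β : Fin 2) (U V : PowerSeries ℂ) {s : ℕ} (hs : s < n) (j : ℕ) :
    S.kernel n α β (S.p α ^ 2 * U) V s j - S.kernel n α β U (conjSeries (S.p β) ^ 2 * V) s j
      = coeff s (S.p α * U) * coeff j V - coeff s U * coeff j (conjSeries (S.p β) * V) := by
  rw [← S.kernel_lyapunov n α β (S.p α * U) V hs j,
    ← S.kernel_lyapunov n α β U (conjSeries (S.p β) * V) hs j]
  rw [sq, sq, mul_assoc, mul_assoc]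
  ring

lemma hasDerivAt_coeff_mul {U : ℝ → PowerSeries ℂ} {U' : PowerSeries ℂ} {x : ℝ}
    (h : ∀ s, HasDerivAt (fun y => coeff s (U y)) (coeff s U') x) (F : PowerSeries ℂ) (s : ℕ) :
    HasDerivAt (fun y => coeff s (U y * F)) (coeff s (U' * F)) x := by
  simp only [coeff_mul]
  exact HasDerivAt.fun_sum fun a _ => (h a.1).mul_const _

lemma hasDerivAt_coeff_conjSeries {U : ℝ → PowerSeries ℂ} {U' : PowerSeries ℂ} {x : ℝ}
    (h : ∀ s, HasDerivAt (fun y => coeff s (U y)) (coeff s U') x) (s : ℕ) :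
    HasDerivAt (fun y => coeff s (conjSeries (U y))) (coeff s (conjSeries U')) x := by
  simp only [coeff_conjSeries]
  exact (h s).star

lemma hasDerivAt_kernel (α β : Fin 2) {U V : ℝ → PowerSeries ℂ} {U' V' : PowerSeries ℂ} {x : ℝ}
    (hU : ∀ s, HasDerivAt (fun y => coeff s (U y)) (coeff s U') x)
    (hV : ∀ s, HasDerivAt (fun y => coeff s (V y)) (coeff s V') x) (s j : ℕ) :
    HasDerivAt (fun y => S.kernel n α β (U y) (V y) s j)
      (S.kernel n α β U' (V x) s j + S.kernel n α β (U x) V' s j) x := by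
  simp only [kernel, cauchyKernel, ← Finset.sum_add_distrib]
  refine HasDerivAt.fun_sum fun l _ => ?_
  refine ((((hasDerivAt_coeff_mul hU _ s).const_mul _).fun_mul
    (hasDerivAt_coeff_mul hV _ j))).congr_deriv ?_
  ring

lemma contDiff_coeff_mul {U : ℝ × ℝ → PowerSeries ℂ}
    (h : ∀ s, ContDiff ℝ ∞ (fun y => coeff s (U y))) (F : PowerSeries ℂ) (s : ℕ) :
    ContDiff ℝ ∞ (fun y => coeff s (U y * F)) := by
  simp only [coeff_mul]
  exact ContDiff.sum fun a _ => (h a.1).mul contDiff_const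

lemma contDiff_coeff_conjSeries {U : ℝ × ℝ → PowerSeries ℂ}
    (h : ∀ s, ContDiff ℝ ∞ (fun y => coeff s (U y))) (s : ℕ) :
    ContDiff ℝ ∞ (fun y => coeff s (conjSeries (U y))) := by
  simp only [coeff_conjSeries]
  exact Complex.conjCLE.contDiff.comp (h s)

lemma contDiff_kernel (α β : Fin 2) {U V : ℝ × ℝ → PowerSeries ℂ}
    (hU : ∀ s, ContDiff ℝ ∞ (fun y => coeff s (U y)))
    (hV : ∀ s, ContDiff ℝ ∞ (fun y => coeff s (V y))) (s j : ℕ) :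
    ContDiff ℝ ∞ (fun y => S.kernel n α β (U y) (V y) s j) := by
  simp only [kernel, cauchyKernel]
  exact ContDiff.sum fun l _ => (contDiff_const.mul (contDiff_coeff_mul hU _ s)).mul
    (contDiff_coeff_mul hV _ j)

/-! ### The Gram flow of a local pair -/

/-- Exponential weights evolving by `E_x = p E`, `E_t = -i p² E`. -/
structure Weights where
  E : Fin 2 → ℝ → ℝ → PowerSeries ℂ
  ne_zero : ∀ α x t, constantCoeff (E α x t) ≠ 0
  E_x : ∀ α x t s, HasDerivAt (fun x' => coeff s (E α x' t)) (coeff s (S.p α * E α x t)) x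
  E_t : ∀ α x t s, HasDerivAt (fun t' => coeff s (E α x t'))
    (coeff s (C (-Complex.I) * (S.p α ^ 2 * E α x t))) t
  smooth : ∀ α s, ContDiff ℝ ∞ (fun z : ℝ × ℝ => coeff s (E α z.1 z.2))

variable (N : Fin 2 → ℕ)

/-- The row index `s` of the block `α` stands for the coefficient `2 s + 1`. -/
abbrev Row := Σ α : Fin 2, Fin (N α)

/-- A truncation order exceeding all indices of the matrix elements. -/
def order : ℕ := 2 * (N 0 + N 1)

variable {N}

/-- The order of the matrix element. -/
def Row.idx (i : Row N) : ℕ := 2 * (i.2 : ℕ) + 1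

lemma Row.le_order (i : Row N) : (i.2 : ℕ) < N 0 + N 1 := by
  obtain ⟨α, i, hi⟩ := i
  fin_cases α
  · exact Nat.lt_of_lt_of_le hi (Nat.le_add_right _ _)
  · exact Nat.lt_of_lt_of_le hi (Nat.le_add_left _ _)

lemma Row.idx_lt (i : Row N) : i.idx < order N := by
  have := i.le_order
  unfold Row.idx order
  omega

lemma Row.ext_val {i j : Row N} (h : i.1 = j.1) (h' : (i.2 : ℕ) = j.2) : i = j := by
  obtain ⟨α, i⟩ := i
  obtain ⟨β, j⟩ := j
  obtain rfl : α = β := h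
  congr 1
  exact Fin.ext h'

variable {S} in
/-- The vector of coefficients of `F_α E_α`. -/
def Weights.vec (W : S.Weights) (F : Fin 2 → PowerSeries ℂ) (x t : ℝ) (i : Row N) : ℂ :=
  coeff i.idx (W.E i.1 x t * F i.1)

variable {S}

lemma Weights.hasDerivAt_vec_x (W : S.Weights) (F : Fin 2 → PowerSeries ℂ) (x t : ℝ) (i : Row N) :
    HasDerivAt (fun x' => W.vec F x' t i) (W.vec (fun α => S.p α * F α) x t i) x := by
  refine (hasDerivAt_coeff_mul (W.E_x i.1 x t) (F i.1) i.idx).congr_deriv ?_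
  rw [Weights.vec]; congr 1; ring

lemma Weights.hasDerivAt_vec_t (W : S.Weights) (F : Fin 2 → PowerSeries ℂ) (x t : ℝ) (i : Row N) :
    HasDerivAt (fun t' => W.vec F x t' i)
      (-Complex.I * W.vec (fun α => S.p α ^ 2 * F α) x t i) t := by
  refine (hasDerivAt_coeff_mul (W.E_t i.1 x t) (F i.1) i.idx).congr_deriv ?_
  rw [Weights.vec, ← coeff_C_mul]; congr 1; ring

lemma Weights.smooth_vec (W : S.Weights) (F : Fin 2 → PowerSeries ℂ) (i : Row N) :
    ContDiff ℝ ∞ (fun z : ℝ × ℝ => W.vec F z.1 z.2 i) :=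
  contDiff_coeff_mul (W.smooth i.1) _ _

lemma Weights.vec_add (W : S.Weights) (F F' : Fin 2 → PowerSeries ℂ) (x t : ℝ) (i : Row N) :
    W.vec (fun α => F α + F' α) x t i = W.vec F x t i + W.vec F' x t i := by
  simp only [Weights.vec, mul_add, map_add]

lemma Weights.vec_C_mul (W : S.Weights) (c : ℂ) (F : Fin 2 → PowerSeries ℂ) (x t : ℝ) (i : Row N) :
    W.vec (fun α => C c * F α) x t i = c * W.vec F x t i := by
  rw [Weights.vec, Weights.vec, ← coeff_C_mul]; congr 1; ring

/-- The Gram flow built from the Cauchy kernel. -/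
def Weights.gramFlow (W : S.Weights) (N : Fin 2 → ℕ) : GramFlow (Row N) where
  M x t := Matrix.of fun i j => S.kernel (order N) i.1 j.1 (W.E i.1 x t)
    (conjSeries (W.E j.1 x t)) i.idx j.idx
  v j := W.vec fun α => S.p α ^ j
  posDef x t := S.kernel_posDef (order N) (fun i : Row N => i.1) Row.idx
    (fun i j h h' => Row.ext_val h (by unfold Row.idx at h'; omega)) Row.idx_lt
    (fun α => W.E α x t) (fun α => W.ne_zero α x t)
  M_x x t i j := by
    refine (S.hasDerivAt_kernel _ i.1 j.1 (W.E_x i.1 x t)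
      (hasDerivAt_coeff_conjSeries (W.E_x j.1 x t)) i.idx j.idx).congr_deriv ?_
    rw [map_mul conjSeries, S.kernel_lyapunov _ _ _ _ _ i.idx_lt]
    simp [outer, Weights.vec]
  M_t x t i j := by
    refine (S.hasDerivAt_kernel _ i.1 j.1 (W.E_t i.1 x t)
      (hasDerivAt_coeff_conjSeries (W.E_t j.1 x t)) i.idx j.idx).congr_deriv ?_
    have h := S.kernel_sq (order N) i.1 j.1 (W.E i.1 x t) (conjSeries (W.E j.1 x t)) i.idx_lt j.idx
    rw [map_mul conjSeries, map_mul conjSeries, PowerSeries.map_C, kernel_C_mul_left,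
      kernel_C_mul_right, map_neg, Complex.conj_I, neg_neg, map_pow]
    rw [← map_mul conjSeries (S.p j.1) (W.E j.1 x t), coeff_conjSeries, coeff_conjSeries] at h
    simp only [outer, Weights.vec, Matrix.add_apply, Matrix.smul_apply, Matrix.of_apply,
      smul_eq_mul, pow_zero, pow_one, mul_one, mul_comm (W.E _ x t) (S.p _)]
    linear_combination (-Complex.I) * h
  v_x j x t i := by
    refine (W.hasDerivAt_vec_x _ x t i).congr_deriv ?_
    simp only [pow_succ']
  v_t j x t i := by
    refine (W.hasDerivAt_vec_t _ x t i).congr_deriv ?_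
    simp only [pow_add, mul_comm]
  smooth_M i j := S.contDiff_kernel _ _ _ (W.smooth i.1) (contDiff_coeff_conjSeries (W.smooth j.1))
    _ _
  smooth_v j i := W.smooth_vec _ i

/-- With `r = 1 / (p - i k)` one has `p r = 1 + i k r` and `p² r = p + i k - k² r`; these are the
two evolution equations. -/
lemma Weights.isResolvent (W : S.Weights) (N : Fin 2 → ℕ) (k : ℝ) :
    (W.gramFlow N).IsResolvent k (W.vec (S.resolvent k)) where
  χ_x x t i := by
    refine (W.hasDerivAt_vec_x _ x t i).congr_deriv ?_
    simp only [S.p_mul_resolvent]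
    rw [W.vec_add, W.vec_C_mul]
    simp only [gramFlow, pow_zero]
  χ_t x t i := by
    refine (W.hasDerivAt_vec_t _ x t i).congr_deriv ?_
    have : ∀ α, S.p α ^ 2 * S.resolvent k α
        = (S.p α + C (Complex.I * k)) + C (-(k : ℂ) ^ 2) * S.resolvent k α := by
      intro α
      have e : C (-(k : ℂ) ^ 2) = C (Complex.I * k) * C (Complex.I * k) := by
        rw [← map_mul]; congr 1; linear_combination (-(k : ℂ) ^ 2) * Complex.I_sq
      rw [e]
      linear_combination (S.p α + C (Complex.I * k)) * S.p_mul_resolvent k α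
    simp only [this]
    rw [W.vec_add, W.vec_add, W.vec_C_mul]
    have e : W.vec (fun _ => C (Complex.I * k)) x t i
        = Complex.I * k * W.vec (fun _ => (1 : PowerSeries ℂ)) x t i := by
      rw [← W.vec_C_mul]; simp only [mul_one]
    rw [e]
    simp only [gramFlow, pow_zero, pow_one]
    ring
  smooth i := W.smooth_vec _ i

/-- Multiplication by `𝒬` along the branches. -/
def qSeries (S : LocalPair) (c : Params) (α : Fin 2) : PowerSeries ℂ :=
  C ((c.δ₁ * c.ρ₁ ^ 2 : ℝ) : ℂ) * S.resolvent c.k₁ α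
    + C ((c.δ₂ * c.ρ₂ ^ 2 : ℝ) : ℂ) * S.resolvent c.k₂ α + C Complex.I * S.p α ^ 2

/-- The matrix of multiplication by an even series on the odd coefficients. -/
def evenMul (N : Fin 2 → ℕ) (h : Fin 2 → PowerSeries ℂ) : Matrix (Row N) (Row N) ℂ :=
  Matrix.of fun i j => if i.1 = j.1 then coeff i.idx (h i.1 * X ^ j.idx) else 0

/-- Multiplication by an even series preserves parity and never lowers order, so its action on
finitely many odd coefficients is exactly a finite matrix. This is where restricting to odd indices
pays off. -/
lemma sum_evenMul {h : Fin 2 → PowerSeries ℂ} (hh : ∀ α r, Odd r → coeff r (h α) = 0)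
    (F : Fin 2 → PowerSeries ℂ) (i : Row N) :
    ∑ j, evenMul N h i j * coeff j.idx (F j.1) = coeff i.idx (h i.1 * F i.1) := by
  rw [Fintype.sum_sigma, Finset.sum_eq_single i.1]
  · rw [Row.idx, coeff_even_mul_eq_sum_range i.2.2 (hh i.1), Finset.sum_range]
    simp [evenMul, Row.idx]
  · intro β _ hβ
    refine Finset.sum_eq_zero fun s _ => ?_
    simp [evenMul, Ne.symm hβ]
  · simp

lemma evenMul_mul_gram {h : Fin 2 → PowerSeries ℂ} (hh : ∀ α r, Odd r → coeff r (h α) = 0)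
    (U : Fin 2 → PowerSeries ℂ) (β : Fin 2) (V : PowerSeries ℂ) (s : ℕ) (i : Row N) :
    ∑ j, evenMul N h i j * S.kernel n j.1 β (U j.1) V j.idx s
      = S.kernel n i.1 β (h i.1 * U i.1) V i.idx s := by
  simp only [kernel, cauchyKernel, Finset.mul_sum]
  rw [Finset.sum_comm]
  refine Finset.sum_congr rfl fun l _ => ?_
  rw [mul_assoc (h i.1), ← sum_evenMul hh (fun α => U α * tmBasis (S.node n) (S.node n) (S.p α) l),
    Finset.mul_sum, Finset.sum_mul]
  exact Finset.sum_congr rfl fun j _ => by ring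

/-- If `𝒬` is even along both branches, the Gram flow is reduced. -/
def Weights.reduction (W : S.Weights) (N : Fin 2 → ℕ) (c : Params)
    (hQ : ∀ α r, Odd r → coeff r (S.qSeries c α) = 0) : (W.gramFlow N).Reduction c where
  χ₁ := W.vec (S.resolvent c.k₁)
  χ₂ := W.vec (S.resolvent c.k₂)
  res₁ := W.isResolvent N c.k₁
  res₂ := W.isResolvent N c.k₂
  Θ := evenMul N (S.qSeries c)
  lyapunov x t := by
    have h1 : ∀ i j, (evenMul N (S.qSeries c) * (W.gramFlow N).M x t) i j
        = S.kernel (order N) i.1 j.1 (S.qSeries c i.1 * W.E i.1 x t)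
          (conjSeries (W.E j.1 x t)) i.idx j.idx := by
      intro i j
      rw [Matrix.mul_apply]
      exact evenMul_mul_gram (order N) hQ (fun α => W.E α x t) j.1 _ j.idx i
    -- `M` is Hermitian, so the second term of the Lyapunov equation is the adjoint of the first.
    have h2 : (W.gramFlow N).M x t * (evenMul N (S.qSeries c)).conjTranspose
        = (evenMul N (S.qSeries c) * (W.gramFlow N).M x t).conjTranspose := by
      rw [Matrix.conjTranspose_mul, ((W.gramFlow N).posDef x t).isHermitian.eq]
    rw [h2]
    ext i j
    rw [Matrix.add_apply, Matrix.conjTranspose_apply, h1, h1, RCLike.star_def, conj_kernel,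
      conjSeries_conjSeries]
    have r1 := S.kernel_resolvent (order N) c.k₁ i.1 j.1 (W.E i.1 x t)
      (conjSeries (W.E j.1 x t)) i.idx_lt j.idx
    have r2 := S.kernel_resolvent (order N) c.k₂ i.1 j.1 (W.E i.1 x t)
      (conjSeries (W.E j.1 x t)) i.idx_lt j.idx
    have r3 := S.kernel_sq (order N) i.1 j.1 (W.E i.1 x t)
      (conjSeries (W.E j.1 x t)) i.idx_lt j.idx
    simp only [qSeries, add_mul, mul_assoc, kernel_add_left, kernel_add_right, kernel_C_mul_left,
      kernel_C_mul_right, map_add, map_mul, map_pow, PowerSeries.map_C, Complex.conj_ofReal,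
      Complex.conj_I]
    rw [← map_mul conjSeries, coeff_conjSeries, map_mul conjSeries] at r1 r2
    rw [← map_mul conjSeries, coeff_conjSeries, coeff_conjSeries] at r3
    simp only [outer, Weights.vec, gramFlow, Matrix.add_apply, Matrix.smul_apply, Matrix.of_apply,
      smul_eq_mul, pow_zero, pow_one, mul_one, mul_comm (W.E _ x t) (S.p _),
      mul_comm (W.E _ x t) (S.resolvent _ _)]
    linear_combination ((c.δ₁ * c.ρ₁ ^ 2 : ℝ) : ℂ) * r1 + ((c.δ₂ * c.ρ₂ ^ 2 : ℝ) : ℂ) * r2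
      + Complex.I * r3
  mulVec x t := by
    funext i
    have := sum_evenMul hQ (fun α => W.E α x t * 1) i
    have e : (evenMul N (S.qSeries c)).mulVec ((W.gramFlow N).v 0 x t) i
        = W.vec (S.qSeries c) x t i := by
      rw [Weights.vec, mul_comm, ← mul_one (W.E i.1 x t), ← this]
      simp only [Matrix.mulVec, dotProduct, gramFlow, pow_zero, Weights.vec]
    rw [e]
    simp only [Pi.add_apply, Pi.smul_apply, smul_eq_mul, gramFlow]
    rw [show S.qSeries c = fun α => C ((c.δ₁ * c.ρ₁ ^ 2 : ℝ) : ℂ) * S.resolvent c.k₁ α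
      + C ((c.δ₂ * c.ρ₂ ^ 2 : ℝ) : ℂ) * S.resolvent c.k₂ α + C Complex.I * S.p α ^ 2 from rfl,
      W.vec_add, W.vec_add, W.vec_C_mul, W.vec_C_mul, W.vec_C_mul]

end LocalPair

end

/-! ### Limits of pairings and the algebra of the limiting Gram matrix -/

section

open PowerSeries Filter

section MatrixLimits

variable {ι κ : Type*} [Fintype ι] [DecidableEq ι] [Fintype κ]

/-- A pairing depends only on the row space: an invertible change of rows drops out, however it
behaves at infinity. -/
lemma sesq_congr_mul {A : Matrix ι ι ℂ} (hA : IsUnit A.det) {M : Matrix ι ι ℂ}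
    (u v : ι → ℂ) :
    sesq (A * M * A.conjTranspose)⁻¹ (A.mulVec u) (A.mulVec v) = sesq M⁻¹ u v := by
  have hA' : IsUnit (A.conjTranspose).det := by
    rw [Matrix.det_conjTranspose]; exact hA.star
  have h1 : Matrix.vecMul (star u) A.conjTranspose = star (A.mulVec u) := (Matrix.star_mulVec _ _).symm
  rw [Matrix.mul_inv_rev, Matrix.mul_inv_rev, sesq_eq_dotProduct, sesq_eq_dotProduct, ← h1,
    ← Matrix.dotProduct_mulVec, Matrix.mulVec_mulVec, Matrix.mulVec_mulVec]
  congr 2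
  rw [← Matrix.mul_assoc, ← Matrix.mul_assoc, Matrix.mul_nonsing_inv _ hA', Matrix.one_mul,
    Matrix.mul_assoc, Matrix.nonsing_inv_mul _ hA, Matrix.mul_one]

lemma tendsto_sesq_inv {X : Type*} {l : Filter X} {Γ : X → Matrix ι κ ℂ} {Γ' : Matrix ι κ ℂ}
    (h : Tendsto Γ l (nhds Γ')) (C : Matrix κ κ ℂ)
    (hdet : (Γ' * C * Γ'.conjTranspose).det ≠ 0) (a b : κ → ℂ) :
    Tendsto (fun z => sesq (Γ z * C * (Γ z).conjTranspose)⁻¹ ((Γ z).mulVec a) ((Γ z).mulVec b)) l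
      (nhds (sesq (Γ' * C * Γ'.conjTranspose)⁻¹ (Γ'.mulVec a) (Γ'.mulVec b))) := by
  have hcont : ContinuousAt (fun Γ : Matrix ι κ ℂ =>
      sesq (Γ * C * Γ.conjTranspose)⁻¹ (Γ.mulVec a) (Γ.mulVec b)) Γ' := by
    have hM : Continuous fun Γ : Matrix ι κ ℂ => Γ * C * Γ.conjTranspose := by fun_prop
    have hv : ∀ a : κ → ℂ, Continuous fun Γ : Matrix ι κ ℂ => Γ.mulVec a := fun a => by fun_prop
    simp only [sesq, Matrix.inv_def, Matrix.smul_apply, smul_eq_mul, Ring.inverse_eq_inv']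
    refine tendsto_finsetSum _ fun i _ => tendsto_finsetSum _ fun j _ => ?_
    refine ContinuousAt.mul (ContinuousAt.mul ?_ (ContinuousAt.mul ?_ ?_)) ?_
    · exact (Complex.continuous_conj.comp ((continuous_apply i).comp (hv a))).continuousAt
    · exact (hM.matrix_det.continuousAt).inv₀ hdet
    · exact (hM.matrix_adjugate.matrix_elem i j).continuousAt
    · exact ((continuous_apply j).comp (hv b)).continuousAt
  exact hcont.tendsto.comp h

lemma sum_blockDiagonal' {m : Fin 2 → Type*} [∀ α, Fintype (m α)] {n : ℕ}
    (B : ∀ α, Matrix (m α) (Fin n) ℂ) (i : Σ α, m α) (f : (Σ _ : Fin 2, Fin n) → ℂ) :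
    ∑ c, Matrix.blockDiagonal' B i c * f c = ∑ ν, B i.1 i.2 ν * f ⟨i.1, ν⟩ := by
  obtain ⟨α, i⟩ := i
  rw [Fintype.sum_sigma, Finset.sum_eq_single α]
  · simp only [Matrix.blockDiagonal'_apply_eq]
  · intro β _ hβ
    refine Finset.sum_eq_zero fun s _ => ?_
    rw [Matrix.blockDiagonal'_apply_ne _ _ _ (Ne.symm hβ), zero_mul]
  · simp

end MatrixLimits

namespace LocalPair

variable {S : LocalPair} {N : Fin 2 → ℕ}

/-- Columns: coefficients below the truncation order at both base points. -/
abbrev Col (N : Fin 2 → ℕ) := Σ _ : Fin 2, Fin (order N)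

/-- The coefficient vector of a pair of series. -/
def coeffVec (N : Fin 2 → ℕ) (F : Fin 2 → PowerSeries ℂ) (i : Col N) : ℂ := coeff (i.2 : ℕ) (F i.1)

/-- The constant Gram matrix of the Cauchy kernel. -/
def constGram (S : LocalPair) (N : Fin 2 → ℕ) : Matrix (Col N) (Col N) ℂ :=
  Matrix.of fun i j => S.kernel (order N) i.1 j.1 1 1 i.2 j.2

/-- The Toeplitz matrix extracting the coefficients `f s` of a product with `U α`. -/
def toeplitz (N : Fin 2 → ℕ) (f : ℕ → ℕ) (U : Fin 2 → PowerSeries ℂ) : Matrix (Row N) (Col N) ℂ :=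
  Matrix.blockDiagonal' fun α => Matrix.of fun s ν => coeff (f s) (U α * X ^ (ν : ℕ))

lemma toeplitz_mulVec {f : ℕ → ℕ} (hf : ∀ i : Row N, f i.2 < order N) (U F : Fin 2 → PowerSeries ℂ)
    (i : Row N) : (toeplitz N f U).mulVec (coeffVec N F) i = coeff (f i.2) (U i.1 * F i.1) := by
  rw [coeff_mul_eq_sum_range (hf i), Finset.sum_range]
  exact sum_blockDiagonal' _ i _

/-- All dependence on the weights sits in the Toeplitz factors; the middle matrix is fixed, so
limits of Gram data reduce to limits of Toeplitz matrices. -/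
lemma toeplitz_mul_constGram_mul {f : ℕ → ℕ} (hf : ∀ i : Row N, f i.2 < order N)
    (U : Fin 2 → PowerSeries ℂ) (i j : Row N) :
    (toeplitz N f U * S.constGram N * (toeplitz N f U).conjTranspose) i j
      = S.kernel (order N) i.1 j.1 (U i.1) (conjSeries (U j.1)) (f i.2) (f j.2) := by
  have h1 : ∀ (i : Row N) (c : Col N), (toeplitz N f U * S.constGram N) i c
      = S.kernel (order N) i.1 c.1 (U i.1) 1 (f i.2) c.2 := by
    intro i c
    rw [Matrix.mul_apply]
    refine (sum_blockDiagonal' _ i _).trans ?_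
    simp only [constGram, Matrix.of_apply, kernel, cauchyKernel, Finset.mul_sum, one_mul]
    rw [Finset.sum_comm]
    refine Finset.sum_congr rfl fun l _ => ?_
    rw [coeff_mul_eq_sum_range (hf i), Finset.sum_range, Finset.mul_sum, Finset.sum_mul]
    exact Finset.sum_congr rfl fun ν _ => by ring
  rw [Matrix.mul_apply]
  simp only [h1, Matrix.conjTranspose_apply]
  have h2 : ∀ c : Col N, S.kernel (order N) i.1 c.1 (U i.1) 1 (f i.2) c.2
      * star (toeplitz N f U j c)
      = conj (toeplitz N f U j c * S.kernel (order N) c.1 i.1 1 (conjSeries (U i.1)) c.2 (f i.2)) := by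
    intro c
    rw [map_mul, conj_kernel, conjSeries_conjSeries, map_one, mul_comm]
    rfl
  simp only [h2, ← map_sum]
  rw [← conjSeries_conjSeries (U i.1), ← conj_kernel]
  congr 1
  refine (sum_blockDiagonal' _ j _).trans ?_
  simp only [Matrix.of_apply, kernel, cauchyKernel, Finset.mul_sum, one_mul, conjSeries_conjSeries]
  rw [Finset.sum_comm]
  refine Finset.sum_congr rfl fun l _ => ?_
  rw [coeff_mul_eq_sum_range (hf j), Finset.sum_range, Finset.mul_sum, Finset.sum_mul]
  exact Finset.sum_congr rfl fun ν _ => by ring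

lemma Row.val_lt_order (i : Row N) : (i.2 : ℕ) < order N := by
  have := i.le_order
  unfold order
  omega

/-- The Gram matrix governing the behaviour at infinity. -/
def limitGram (S : LocalPair) (N : Fin 2 → ℕ) : Matrix (Row N) (Row N) ℂ :=
  Matrix.of fun i j => S.kernel (order N) i.1 j.1 1 1 i.2 j.2

lemma limitGram_eq :
    toeplitz N id (fun _ => 1) * S.constGram N * (toeplitz N id fun _ => 1).conjTranspose
      = S.limitGram N := by
  ext i j
  rw [toeplitz_mul_constGram_mul (fun i => i.val_lt_order)]
  simp [limitGram]

lemma limitGram_posDef : (S.limitGram N).PosDef := by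
  have := S.kernel_posDef (order N) (fun i : Row N => i.1) (fun i => (i.2 : ℕ))
    (fun i j h h' => Row.ext_val h h') (fun i => i.val_lt_order) (fun _ => 1) (fun _ => by simp)
  simp only [map_one] at this
  exact this

lemma limitGram_det_ne_zero : (S.limitGram N).det ≠ 0 :=
  ((Matrix.isUnit_iff_isUnit_det _).1 (limitGram_posDef (S := S)).isUnit).ne_zero

/-- Multiplication by a pair of series, truncated to the first `N α` coefficients. -/
def truncMul (N : Fin 2 → ℕ) (h : Fin 2 → PowerSeries ℂ) : Matrix (Row N) (Row N) ℂ :=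
  Matrix.of fun i j => if i.1 = j.1 then coeff (i.2 : ℕ) (h i.1 * X ^ (j.2 : ℕ)) else 0

/-- Initial segments of coefficients are stable under multiplication by any series, with no parity
condition; hence the limit admits more Lyapunov identities than the flow itself. -/
lemma sum_truncMul (h F : Fin 2 → PowerSeries ℂ) (i : Row N) :
    ∑ j, truncMul N h i j * coeff (j.2 : ℕ) (F j.1) = coeff (i.2 : ℕ) (h i.1 * F i.1) := by
  rw [Fintype.sum_sigma, Finset.sum_eq_single i.1]
  · rw [coeff_mul_eq_sum_range i.2.2, Finset.sum_range]
    simp [truncMul]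
  · intro β _ hβ
    refine Finset.sum_eq_zero fun s _ => ?_
    simp [truncMul, Ne.symm hβ]
  · simp

lemma truncMul_mul_limitGram (h : Fin 2 → PowerSeries ℂ) (i j : Row N) :
    (truncMul N h * S.limitGram N) i j = S.kernel (order N) i.1 j.1 (h i.1) 1 i.2 j.2 := by
  rw [Matrix.mul_apply]
  simp only [limitGram, Matrix.of_apply, kernel, cauchyKernel, Finset.mul_sum]
  rw [Finset.sum_comm]
  refine Finset.sum_congr rfl fun l _ => ?_
  rw [← sum_truncMul h (fun α => tmBasis (S.node (order N)) (S.node (order N)) (S.p α) l),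
    Finset.mul_sum, Finset.sum_mul]
  exact Finset.sum_congr rfl fun j _ => by ring_nf

lemma truncMul_lyapunov (h : Fin 2 → PowerSeries ℂ) :
    truncMul N h * S.limitGram N + S.limitGram N * (truncMul N h).conjTranspose
      = Matrix.of fun i j => S.kernel (order N) i.1 j.1 (h i.1 * 1) 1 i.2 j.2
        + S.kernel (order N) i.1 j.1 1 (conjSeries (h j.1) * 1) i.2 j.2 := by
  have h2 : S.limitGram N * (truncMul N h).conjTranspose
      = (truncMul N h * S.limitGram N).conjTranspose := by
    rw [Matrix.conjTranspose_mul, limitGram_posDef.isHermitian.eq]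
  rw [h2]
  ext i j
  rw [Matrix.add_apply, Matrix.conjTranspose_apply, truncMul_mul_limitGram, truncMul_mul_limitGram,
    RCLike.star_def, conj_kernel, map_one]
  simp only [Matrix.of_apply, mul_one]

/-- The truncated coefficient vector. -/
def limitVec (N : Fin 2 → ℕ) (F : Fin 2 → PowerSeries ℂ) (i : Row N) : ℂ :=
  coeff (i.2 : ℕ) (F i.1)

lemma truncMul_mulVec (h : Fin 2 → PowerSeries ℂ) :
    (truncMul N h).mulVec (limitVec N fun _ => 1) = limitVec N h := by
  funext i
  have := sum_truncMul h (fun _ => 1) i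
  rw [mul_one] at this
  exact this

/-- The limit of the pairings. -/
def limitPairing (S : LocalPair) (N : Fin 2 → ℕ) (F F' : Fin 2 → PowerSeries ℂ) : ℂ :=
  sesq (S.limitGram N)⁻¹ (limitVec N F) (limitVec N F')

/-- The Lyapunov identity for multiplication by `p`; it says that the limit of `wx` is zero. -/
lemma limitPairing_p : S.limitPairing N (fun _ => 1) (fun _ => 1) ^ 2
    = S.limitPairing N (fun _ => 1) S.p + S.limitPairing N S.p (fun _ => 1) := by
  have h := sesq_lyapunov limitGram_det_ne_zero (truncMul_lyapunov (S := S) (N := N) S.p)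
    (limitVec N fun _ => 1)
  have e : (Matrix.of fun i j : Row N => S.kernel (order N) i.1 j.1 (S.p i.1 * 1) 1 i.2 j.2
      + S.kernel (order N) i.1 j.1 1 (conjSeries (S.p j.1) * 1) i.2 j.2)
      = outer (limitVec N fun _ => 1) (limitVec N fun _ => 1) := by
    ext i j
    rw [Matrix.of_apply, S.kernel_lyapunov _ _ _ _ _ i.val_lt_order]
    simp only [outer, Matrix.of_apply, limitVec, ← coeff_conjSeries, map_one]
  rw [e, sesq_mul_outer_mul, truncMul_mulVec] at h
  rw [sq]
  exact h

lemma limitPairing_resolvent (k : ℝ) :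
    S.limitPairing N (fun _ => 1) (S.resolvent k) * S.limitPairing N (S.resolvent k) (fun _ => 1)
    = S.limitPairing N (fun _ => 1) (S.resolvent k)
      + S.limitPairing N (S.resolvent k) (fun _ => 1) := by
  have h := sesq_lyapunov limitGram_det_ne_zero
    (truncMul_lyapunov (S := S) (N := N) (S.resolvent k)) (limitVec N fun _ => 1)
  have e : (Matrix.of fun i j : Row N =>
      S.kernel (order N) i.1 j.1 (S.resolvent k i.1 * 1) 1 i.2 j.2
      + S.kernel (order N) i.1 j.1 1 (conjSeries (S.resolvent k j.1) * 1) i.2 j.2)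
      = outer (limitVec N (S.resolvent k)) (limitVec N (S.resolvent k)) := by
    ext i j
    rw [Matrix.of_apply, S.kernel_resolvent _ _ _ _ _ _ i.val_lt_order]
    simp only [outer, Matrix.of_apply, limitVec, ← coeff_conjSeries, mul_one]
  rw [e, sesq_mul_outer_mul, truncMul_mulVec] at h
  exact h

/-- For `z` the limit of `χ^* M⁻¹ v₀`, the Lyapunov identity of the resolvent reads `|z|² = z + conj
z`, which is `|1 - z| = 1`. -/
lemma norm_one_sub_limitPairing (k : ℝ) :
    ‖1 - S.limitPairing N (S.resolvent k) (fun _ => 1)‖ = 1 := by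
  have h := limitPairing_resolvent (S := S) (N := N) k
  have hc : conj (S.limitPairing N (S.resolvent k) (fun _ => 1))
      = S.limitPairing N (fun _ => 1) (S.resolvent k) :=
    conj_sesq limitGram_posDef.isHermitian.inv _ _
  have : (1 - S.limitPairing N (S.resolvent k) (fun _ => 1))
      * conj (1 - S.limitPairing N (S.resolvent k) (fun _ => 1)) = 1 := by
    rw [map_sub, map_one, hc]; linear_combination h
  rw [Complex.mul_conj, Complex.normSq_eq_norm_sq] at this
  have h1 : ‖1 - S.limitPairing N (S.resolvent k) (fun _ => 1)‖ ^ 2 = 1 := by exact_mod_cast this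
  exact (pow_eq_one_iff_of_nonneg (norm_nonneg _) two_ne_zero).1 h1

/-- At infinity the coefficient matrix of the weights reduces, up to an invertible factor, to the
projection onto the first `N α` coefficients. -/
def Weights.Reduces (W : S.Weights) (N : Fin 2 → ℕ) : Prop :=
  ∃ (A : ℝ × ℝ → Matrix (Row N) (Row N) ℂ) (Γ : ℝ × ℝ → Matrix (Row N) (Col N) ℂ),
    (∀ᶠ z in cocompact (ℝ × ℝ), IsUnit (A z).det ∧
      toeplitz N (fun s => 2 * s + 1) (fun α => W.E α z.1 z.2) = A z * Γ z) ∧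
    Tendsto Γ (cocompact (ℝ × ℝ)) (nhds (toeplitz N id fun _ => 1))

/-- The factor `A` cancels by `sesq_congr_mul`, and the pairing is continuous in `Γ` at the limit
because the limiting Gram matrix is invertible. -/
lemma Weights.Reduces.tendsto_pairing {W : S.Weights} (h : W.Reduces N)
    (F F' : Fin 2 → PowerSeries ℂ) :
    Tendsto (fun z : ℝ × ℝ => (W.gramFlow N).pairing (W.vec F) (W.vec F') z.1 z.2)
      (cocompact (ℝ × ℝ)) (nhds (S.limitPairing N F F')) := by
  obtain ⟨A, Γ, hA, hΓ⟩ := h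
  have hlim := tendsto_sesq_inv hΓ (S.constGram N)
    (by rw [limitGram_eq]; exact limitGram_det_ne_zero) (coeffVec N F) (coeffVec N F')
  have e : ∀ F, (toeplitz N id fun _ => 1).mulVec (coeffVec N F) = limitVec N F := by
    intro F; funext i
    rw [toeplitz_mulVec (fun i => i.val_lt_order), one_mul]; rfl
  rw [limitGram_eq, e, e] at hlim
  refine hlim.congr' ?_
  filter_upwards [hA] with z hz
  obtain ⟨hu, hT⟩ := hz
  have hM : (W.gramFlow N).M z.1 z.2
      = A z * (Γ z * S.constGram N * (Γ z).conjTranspose) * (A z).conjTranspose := by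
    have : A z * (Γ z * S.constGram N * (Γ z).conjTranspose) * (A z).conjTranspose
        = (A z * Γ z) * S.constGram N * (A z * Γ z).conjTranspose := by
      rw [Matrix.conjTranspose_mul]; simp only [Matrix.mul_assoc]
    rw [this, ← hT]
    ext i j
    rw [toeplitz_mul_constGram_mul (fun i => i.idx_lt)]
    rfl
  have hv : ∀ F, W.vec F z.1 z.2 = (A z).mulVec ((Γ z).mulVec (coeffVec N F)) := by
    intro F
    rw [Matrix.mulVec_mulVec, ← hT]
    funext i
    rw [toeplitz_mulVec (fun i => i.idx_lt)]
    rfl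
  rw [GramFlow.pairing, hM, hv, hv, sesq_congr_mul hu]

lemma Weights.gramFlow_v (W : S.Weights) (j : ℕ) :
    (W.gramFlow N).v j = W.vec fun α => S.p α ^ j := rfl

/-- A reduced Gram flow whose weights degenerate at infinity generates bounded rogue waves. -/
theorem Weights.Reduces.isBoundedRogueWave {W : S.Weights} (h : W.Reduces N) {c : Params}
    (hQ : ∀ α r, Odd r → coeff r (S.qSeries c α) = 0) {τ : ℤ → ℤ → ℝ → ℝ → ℂ}
    (hτ : (W.reduction N c hQ).Generates τ) : IsBoundedRogueWave c τ := by
  have hratio : ∀ k : ℝ, Tendsto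
      (fun z : ℝ × ℝ => ‖(W.gramFlow N).ratio (W.vec (S.resolvent k)) z.1 z.2‖)
      (cocompact (ℝ × ℝ)) (nhds 1) := by
    intro k
    rw [← norm_one_sub_limitPairing (S := S) (N := N) k]
    have := h.tendsto_pairing (S.resolvent k) (fun α => S.p α ^ 0)
    rw [← W.gramFlow_v (N := N)] at this
    simp only [pow_zero] at this
    exact (tendsto_const_nhds.sub this).norm
  have hw : ∀ i j, Tendsto (fun z : ℝ × ℝ => (W.gramFlow N).w i j z.1 z.2) (cocompact (ℝ × ℝ))
      (nhds (S.limitPairing N (fun α => S.p α ^ i) fun α => S.p α ^ j)) := by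
    intro i j
    rw [GramFlow.w, W.gramFlow_v, W.gramFlow_v]
    exact h.tendsto_pairing _ _
  have hwx : Tendsto (fun z : ℝ × ℝ => (W.gramFlow N).wx z.1 z.2) (cocompact (ℝ × ℝ))
      (nhds 0) := by
    have := ((hw 1 0).add (hw 0 1)).sub ((hw 0 0).pow 2)
    simp only [pow_zero, pow_one] at this
    rw [limitPairing_p, add_comm (S.limitPairing N S.p _), sub_self] at this
    exact this
  exact hτ.isBoundedRogueWave (hratio c.k₁) (hratio c.k₂) hwx

end LocalPair

end

section

open PowerSeries Filter

/-! ### Exponential weights -/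

/-- The Taylor series of `exp (y f)`. -/
def expSeries (f : ℂ → ℂ) (y : ℝ) : PowerSeries ℂ :=
  taylorSeries fun κ => Complex.exp (y * f κ)

/-- The coefficients of the expansion of `exp (y (f - f 0))` in powers of `y`. -/
def expCoeff (f : ℂ → ℂ) (j m : ℕ) : ℂ :=
  coeff j (taylorSeries (fun κ => f κ - f 0) ^ m) / (m ! : ℂ)

/-- Each coefficient is an exponential times a polynomial in `y`, which makes smoothness and the
derivative at `0` a finite computation. -/
lemma coeff_expSeries {f : ℂ → ℂ} (hf : AnalyticAt ℂ f 0) (y : ℝ) (j : ℕ) :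
    coeff j (expSeries f y)
      = Complex.exp (y * f 0) * ∑ m ∈ Finset.range (j + 1), (y : ℂ) ^ m * expCoeff f j m := by
  have hg : AnalyticAt ℂ (fun κ => (y : ℂ) * (f κ - f 0)) 0 :=
    analyticAt_const.mul (hf.sub analyticAt_const)
  have e : (fun κ => Complex.exp (y * f κ))
      = fun κ => Complex.exp (y * f 0) * Complex.exp (y * (f κ - f 0)) := by
    funext κ; rw [← Complex.exp_add]; congr 1; ring
  rw [expSeries, e, taylorSeries_const_mul, coeff_C_mul, coeff_taylorSeries,
    ← schur_taylor hg (by simp)]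
  congr 1
  rw [schur]
  refine Finset.sum_congr rfl fun m _ => ?_
  have hser : (PowerSeries.mk fun k => if k = 0 then 0 else
      taylor (fun κ => (y : ℂ) * (f κ - f 0)) k)
      = C (y : ℂ) * taylorSeries (fun κ => f κ - f 0) := by
    rw [← taylorSeries_const_mul]
    ext n
    rcases n with _ | n <;> simp
  rw [hser, mul_pow, ← map_pow, coeff_C_mul, expCoeff, mul_div_assoc]

lemma contDiff_coeff_expSeries {f : ℂ → ℂ} (hf : AnalyticAt ℂ f 0) (j : ℕ) :
    ContDiff ℝ ∞ (fun y : ℝ => coeff j (expSeries f y)) := by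
  simp only [coeff_expSeries hf]
  have : ContDiff ℝ ∞ (fun y : ℝ => (y : ℂ)) := Complex.ofRealCLM.contDiff
  exact (this.mul contDiff_const).cexp.mul
    (ContDiff.sum fun m _ => (this.pow m).mul contDiff_const)

lemma expSeries_add {f : ℂ → ℂ} (hf : AnalyticAt ℂ f 0) (y y' : ℝ) :
    expSeries f (y + y') = expSeries f y * expSeries f y' := by
  have h : ∀ y : ℝ, AnalyticAt ℂ (fun κ => Complex.exp (y * f κ)) 0 := fun y =>
    (analyticAt_const.mul hf).cexp'
  rw [expSeries, expSeries, expSeries, ← taylorSeries_mul (h y) (h y')]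
  congr 1
  funext κ
  rw [← Complex.exp_add]; push_cast; ring_nf

lemma hasDerivAt_coeff_expSeries_zero {f : ℂ → ℂ} (hf : AnalyticAt ℂ f 0) (j : ℕ) :
    HasDerivAt (fun y => coeff j (expSeries f y)) (coeff j (taylorSeries f)) 0 := by
  simp only [coeff_expSeries hf]
  have hid : HasDerivAt (fun y : ℝ => (y : ℂ)) 1 0 := Complex.ofRealCLM.hasDerivAt
  have h1 : HasDerivAt (fun y : ℝ => Complex.exp (y * f 0)) (f 0) 0 := by
    simpa using (hid.mul_const (f 0)).cexp
  have h2 : HasDerivAt (fun y : ℝ => ∑ m ∈ Finset.range (j + 1), (y : ℂ) ^ m * expCoeff f j m)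
      (∑ m ∈ Finset.range (j + 1), if m = 1 then expCoeff f j 1 else 0) 0 := by
    refine HasDerivAt.fun_sum fun m _ => ?_
    refine ((hid.pow m).mul_const (expCoeff f j m)).congr_deriv ?_
    rcases m with _ | _ | m
    · simp
    · simp
    · simp
  refine (h1.mul h2).congr_deriv ?_
  have e : ∀ j, coeff j (taylorSeries fun κ => f κ - f 0) = if j = 0 then 0 else taylor f j := by
    intro j
    rw [taylorSeries_sub hf analyticAt_const, taylorSeries_const, map_sub, coeff_C]
    rcases j with _ | j <;> simp
  rcases j with _ | j
  · simp [expCoeff]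
  · rw [Finset.sum_ite_eq' _ 1, if_pos (by simp)]
    rw [Finset.sum_range_succ', Finset.sum_eq_zero (fun m _ => by simp)]
    simp [expCoeff, coeff_one, e]

/-- The group law `expSeries_add` transports the derivative at `0` to every `y`. -/
lemma hasDerivAt_coeff_expSeries {f : ℂ → ℂ} (hf : AnalyticAt ℂ f 0) (y : ℝ) (j : ℕ) :
    HasDerivAt (fun y => coeff j (expSeries f y)) (coeff j (taylorSeries f * expSeries f y)) y := by
  have e : ∀ y', expSeries f y' = expSeries f (y' - y) * expSeries f y := by
    intro y'; rw [← expSeries_add hf, sub_add_cancel]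
  have h : ∀ s, HasDerivAt (fun y' => coeff s (expSeries f (y' - y))) (coeff s (taylorSeries f)) y := by
    intro s
    have h0 := hasDerivAt_coeff_expSeries_zero hf s
    rw [← sub_self y] at h0
    exact h0.comp_sub_const y y
  have := LocalPair.hasDerivAt_coeff_mul h (expSeries f y) j
  refine this.congr_of_eventuallyEq (Eventually.of_forall fun y' => ?_)
  simp only
  rw [e y']

/-- Two local branches `P α` with phases `a α`. -/
structure BranchPair where
  P : Fin 2 → ℂ → ℂ
  a : Fin 2 → ℂ → ℂ
  analytic_P : ∀ α, AnalyticAt ℂ (P α) 0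
  analytic_a : ∀ α, AnalyticAt ℂ (a α) 0
  re_pos : ∀ α, 0 < (P α 0).re
  ne : P 0 0 ≠ P 1 0
  deriv_ne_zero : ∀ α, deriv (P α) 0 ≠ 0

namespace BranchPair

variable (B : BranchPair)

/-- The local pair of Taylor series. -/
def localPair : LocalPair where
  p α := taylorSeries (B.P α)
  re_pos α := by rw [constantCoeff_taylorSeries]; exact B.re_pos α
  ne := by rw [constantCoeff_taylorSeries, constantCoeff_taylorSeries]; exact B.ne
  coeff_one α := by rw [coeff_taylorSeries, taylor_one_right]; exact B.deriv_ne_zero α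

/-- The exponential `exp (P x - i P² t + a)` along the branch. -/
def expFun (α : Fin 2) (x t : ℝ) (κ : ℂ) : ℂ :=
  Complex.exp (B.P α κ * x - Complex.I * B.P α κ ^ 2 * t + B.a α κ)

lemma analyticAt_expFun (α : Fin 2) (x t : ℝ) : AnalyticAt ℂ (B.expFun α x t) 0 := by
  have h1 := B.analytic_P α
  have h2 := B.analytic_a α
  unfold expFun
  fun_prop

lemma taylorSeries_expFun (α : Fin 2) (x t : ℝ) :
    taylorSeries (B.expFun α x t) = expSeries (B.P α) x
      * (expSeries (fun κ => -Complex.I * B.P α κ ^ 2) t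
        * taylorSeries fun κ => Complex.exp (B.a α κ)) := by
  have h1 := B.analytic_P α
  have h2 := B.analytic_a α
  rw [expSeries, expSeries, ← taylorSeries_mul (by fun_prop) (by fun_prop),
    ← taylorSeries_mul (by fun_prop) (by fun_prop)]
  congr 1
  funext κ
  rw [expFun, ← Complex.exp_add, ← Complex.exp_add]
  congr 1; ring

/-- The exponential weights of a pair of branches. -/
def weights : B.localPair.Weights where
  E α x t := taylorSeries (B.expFun α x t)
  ne_zero α x t := by rw [constantCoeff_taylorSeries]; exact Complex.exp_ne_zero _
  E_x α x t s := by
    simp only [taylorSeries_expFun]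
    refine (LocalPair.hasDerivAt_coeff_mul (fun s => hasDerivAt_coeff_expSeries (B.analytic_P α) x s)
      _ s).congr_deriv ?_
    rw [mul_assoc]; rfl
  E_t α x t s := by
    have hP := B.analytic_P α
    simp only [taylorSeries_expFun, mul_left_comm (expSeries (B.P α) x)]
    refine (LocalPair.hasDerivAt_coeff_mul
      (fun s => hasDerivAt_coeff_expSeries (f := fun κ => -Complex.I * B.P α κ ^ 2)
        (by fun_prop) t s) _ s).congr_deriv ?_
    rw [taylorSeries_const_mul, taylorSeries_pow hP, mul_assoc, mul_assoc]
    congr 1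
  smooth α s := by
    have hP := B.analytic_P α
    simp only [taylorSeries_expFun]
    simp only [coeff_mul]
    refine ContDiff.sum fun a _ => ?_
    refine ((contDiff_coeff_expSeries hP _).comp contDiff_fst).mul ?_
    refine ContDiff.sum fun b _ => ?_
    exact ((contDiff_coeff_expSeries (f := fun κ => -Complex.I * B.P α κ ^ 2)
      (by fun_prop) _).comp contDiff_snd).mul contDiff_const

end BranchPair

end

/-! ### Asymptotics of the exponential weights at infinity -/

section

open PowerSeries Filter

section SchurLimits

lemma tendsto_coeff_pow {X : Type*} {l : Filter X} {f : X → PowerSeries ℂ} {g : PowerSeries ℂ}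
    (h : ∀ j, Tendsto (fun x => coeff j (f x)) l (nhds (coeff j g))) (m j : ℕ) :
    Tendsto (fun x => coeff j (f x ^ m)) l (nhds (coeff j (g ^ m))) := by
  induction m generalizing j with
  | zero => simp only [pow_zero]; exact tendsto_const_nhds
  | succ m ih =>
    simp only [pow_succ, coeff_mul]
    exact tendsto_finsetSum _ fun a _ => (ih _).mul (h _)

lemma tendsto_schur {X : Type*} {l : Filter X} {ξ : X → ℕ → ℂ} {η : ℕ → ℂ}
    (h : ∀ r, 1 ≤ r → Tendsto (fun x => ξ x r) l (nhds (η r))) (j : ℕ) :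
    Tendsto (fun x => schur j (ξ x)) l (nhds (schur j η)) := by
  unfold schur
  refine tendsto_finsetSum _ fun m _ => (tendsto_coeff_pow (fun j => ?_) m j).div_const _
  simp only [coeff_mk]
  rcases j with _ | j
  · simpa using tendsto_const_nhds
  · simpa using h (j + 1) (by omega)

/-- Weighted homogeneity; it allows the growth in the plane coordinate to be taken out of each
coefficient. -/
lemma schur_rescale (c : ℂ) (ξ : ℕ → ℂ) (j : ℕ) :
    schur j (fun r => c ^ r * ξ r) = c ^ j * schur j ξ := by
  have e : (PowerSeries.mk fun k => if k = 0 then 0 else c ^ k * ξ k)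
      = rescale c (PowerSeries.mk fun k => if k = 0 then 0 else ξ k) := by
    ext k; rw [coeff_rescale, coeff_mk, coeff_mk]; split_ifs <;> simp
  simp only [schur, e, ← map_pow, coeff_rescale, Finset.mul_sum, mul_div_assoc]

lemma schur_single (j : ℕ) : schur j (fun r => if r = 1 then 1 else 0) = 1 / (j ! : ℂ) := by
  have e : (PowerSeries.mk fun k => if k = 0 then 0 else if k = 1 then 1 else 0)
      = (X : PowerSeries ℂ) := by
    ext k; rw [coeff_X, coeff_mk]; split_ifs <;> simp_all
  simp only [schur, e, coeff_X_pow]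
  rw [Finset.sum_eq_single j]
  · simp
  · intro m _ hm; rw [if_neg (Ne.symm hm), zero_div]
  · simp

end SchurLimits

section Scaling

/-- Let `R` be the first `M` columns of `F`, invertible near the limit. Moving `R`, the row factors
and the powers `z^{-s'}` into `A` leaves `Γ = diag(z^s) R⁻¹ F diag(z^{-ν})`: its first `M` columns
are the identity, and in the others the exponent `s - ν` is negative. -/
lemma exists_scaled_factorization {Y : Type*} {l : Filter Y} {M n : ℕ} (hMn : M ≤ n)
    {F : Y → Matrix (Fin M) (Fin n) ℂ} {F' : Matrix (Fin M) (Fin n) ℂ}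
    (hF : Tendsto F l (nhds F')) (hdet : (F'.submatrix id (Fin.castLE hMn)).det ≠ 0)
    {z e : Y → ℂ} (hz : Tendsto (fun y => (z y)⁻¹) l (nhds 0)) (hz0 : ∀ᶠ y in l, z y ≠ 0)
    (he : ∀ y, e y ≠ 0) (d : Fin M → ℕ) :
    ∃ (A : Y → Matrix (Fin M) (Fin M) ℂ) (Γ : Y → Matrix (Fin M) (Fin n) ℂ),
      (∀ᶠ y in l, IsUnit (A y) ∧
        (Matrix.of fun s ν => e y * z y ^ d s * F y s ν * ((z y)⁻¹) ^ (ν : ℕ)) = A y * Γ y) ∧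
      Tendsto Γ l (nhds (Matrix.of fun s ν => if (s : ℕ) = ν then 1 else 0)) := by
  set R : Y → Matrix (Fin M) (Fin M) ℂ := fun y => (F y).submatrix id (Fin.castLE hMn) with hR
  have hRc : Continuous fun F : Matrix (Fin M) (Fin n) ℂ => F.submatrix id (Fin.castLE hMn) := by
    fun_prop
  have hRdet : ∀ᶠ y in l, (R y).det ≠ 0 :=
    ((hRc.matrix_det.tendsto F').comp hF).eventually_ne hdet
  have hinv : Tendsto (fun y => (R y)⁻¹ * F y) l
      (nhds ((F'.submatrix id (Fin.castLE hMn))⁻¹ * F')) := by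
    have hc : ContinuousAt (fun F : Matrix (Fin M) (Fin n) ℂ =>
        (F.submatrix id (Fin.castLE hMn))⁻¹ * F) F' := by
      simp only [Matrix.inv_def, Ring.inverse_eq_inv', Matrix.smul_mul]
      exact (hRc.matrix_det.continuousAt.inv₀ hdet).smul
        ((hRc.matrix_adjugate.matrix_mul continuous_id).continuousAt)
    exact hc.tendsto.comp hF
  refine ⟨fun y => Matrix.of fun s s' => e y * z y ^ d s * R y s s' * ((z y)⁻¹) ^ (s' : ℕ),
    fun y => Matrix.of fun s ν => z y ^ (s : ℕ) * ((R y)⁻¹ * F y) s ν * ((z y)⁻¹) ^ (ν : ℕ),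
    ?_, ?_⟩
  · filter_upwards [hz0, hRdet] with y hy hRy
    constructor
    · have : (Matrix.of fun s s' => e y * z y ^ d s * R y s s' * ((z y)⁻¹) ^ (s' : ℕ))
          = Matrix.diagonal (fun s => e y * z y ^ d s) * R y
            * Matrix.diagonal fun s' : Fin M => ((z y)⁻¹) ^ (s' : ℕ) := by
        ext s s'
        rw [Matrix.mul_diagonal, Matrix.diagonal_mul, Matrix.of_apply]
      rw [this, Matrix.isUnit_iff_isUnit_det, Matrix.det_mul, Matrix.det_mul, Matrix.det_diagonal,
        Matrix.det_diagonal, isUnit_iff_ne_zero]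
      refine mul_ne_zero (mul_ne_zero (Finset.prod_ne_zero_iff.2 fun s _ => ?_) hRy)
        (Finset.prod_ne_zero_iff.2 fun s _ => pow_ne_zero _ (inv_ne_zero hy))
      exact mul_ne_zero (he y) (pow_ne_zero _ hy)
    · have h1 : F y = R y * ((R y)⁻¹ * F y) := by
        rw [← Matrix.mul_assoc, Matrix.mul_nonsing_inv _ (isUnit_iff_ne_zero.2 hRy), Matrix.one_mul]
      ext s ν
      rw [Matrix.mul_apply, Matrix.of_apply]
      conv_lhs => rw [h1, Matrix.mul_apply, Finset.mul_sum, Finset.sum_mul]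
      refine Finset.sum_congr rfl fun s' _ => ?_
      simp only [Matrix.of_apply]
      have : ((z y)⁻¹) ^ (s' : ℕ) * z y ^ (s' : ℕ) = 1 := by
        rw [← mul_pow, inv_mul_cancel₀ hy, one_pow]
      linear_combination -(e y * z y ^ d s * R y s s' * ((R y)⁻¹ * F y) s' ν
        * ((z y)⁻¹) ^ (ν : ℕ)) * this
  · refine tendsto_pi_nhds.2 fun s => tendsto_pi_nhds.2 fun ν => ?_
    simp only [Matrix.of_apply]
    by_cases hν : (ν : ℕ) < M
    · refine tendsto_const_nhds.congr' ?_
      filter_upwards [hz0, hRdet] with y hy hRy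
      have h1 : ((R y)⁻¹ * F y) s ν = ((R y)⁻¹ * R y) s ⟨ν, hν⟩ := by
        rw [Matrix.mul_apply, Matrix.mul_apply]; rfl
      rw [h1, Matrix.nonsing_inv_mul _ (isUnit_iff_ne_zero.2 hRy), Matrix.one_apply]
      by_cases h : (s : ℕ) = ν
      · rw [if_pos h, if_pos (Fin.ext h), h, mul_one, ← mul_pow, mul_inv_cancel₀ hy, one_pow]
      · rw [if_neg h, if_neg (fun h' => h (congrArg Fin.val h')), mul_zero, zero_mul]
    · have hs : (s : ℕ) < ν := by omega
      rw [if_neg hs.ne]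
      have hlim := (hz.pow (ν - s : ℕ)).mul
        ((tendsto_pi_nhds.1 ((tendsto_pi_nhds.1 hinv) s)) ν)
      rw [zero_pow (by omega), zero_mul] at hlim
      refine hlim.congr' ?_
      filter_upwards [hz0] with y hy
      have h2 : ((z y)⁻¹) ^ (ν : ℕ) = ((z y)⁻¹) ^ (ν - s : ℕ) * ((z y)⁻¹) ^ (s : ℕ) := by
        rw [← pow_add]; congr 1; omega
      have h3 : ((z y)⁻¹) ^ (s : ℕ) * z y ^ (s : ℕ) = 1 := by
        rw [← mul_pow, inv_mul_cancel₀ hy, one_pow]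
      rw [h2]
      linear_combination -(((z y)⁻¹) ^ (ν - s : ℕ) * ((R y)⁻¹ * F y) s ν) * h3

/-- The inverse factorials `1 / (2 s + 1 - ν)!` form an invertible square matrix. -/
lemma det_inv_factorial_ne_zero (M : ℕ) :
    (Matrix.of fun s ν : Fin M =>
      if (ν : ℕ) ≤ 2 * (s : ℕ) + 1 then 1 / ((2 * (s : ℕ) + 1 - ν)! : ℂ) else 0).det ≠ 0 := by
  -- Extracting `1 / (2 s + 1)!` from each row leaves falling factorials of `2 s + 1`, monic
  -- polynomials of degree `ν`; the determinant is then that of a Vandermonde matrix with distinct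
  -- nodes.
  have e : (Matrix.of fun s ν : Fin M =>
      if (ν : ℕ) ≤ 2 * (s : ℕ) + 1 then 1 / ((2 * (s : ℕ) + 1 - ν)! : ℂ) else 0)
      = Matrix.diagonal (fun s : Fin M => 1 / ((2 * (s : ℕ) + 1)! : ℂ))
        * Matrix.of fun s ν : Fin M => (descPochhammer ℂ ν).eval (((2 * (s : ℕ) + 1 : ℕ) : ℂ)) := by
    ext s ν
    rw [Matrix.diagonal_mul, Matrix.of_apply, Matrix.of_apply,
      descPochhammer_eval_eq_descFactorial]
    split_ifs with h
    · rw [← Nat.factorial_mul_descFactorial h]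
      have h1 : ((2 * (s : ℕ) + 1 - ν)! : ℂ) ≠ 0 := by exact_mod_cast Nat.factorial_ne_zero _
      have h2 : ((2 * (s : ℕ) + 1).descFactorial ν : ℂ) ≠ 0 := by
        exact_mod_cast (Nat.descFactorial_pos.2 h).ne'
      push_cast
      field_simp
    · rw [Nat.descFactorial_of_lt (by omega)]; simp
  rw [e, Matrix.det_mul, Matrix.det_diagonal,
    ← Matrix.det_eval_matrixOfPolynomials_eq_det_vandermonde _ (fun ν : Fin M => descPochhammer ℂ ν)
      (fun ν => descPochhammer_natDegree ℂ ν) (fun ν => monic_descPochhammer ℂ ν)]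
  refine mul_ne_zero (Finset.prod_ne_zero_iff.2 fun s _ => ?_)
    (Matrix.det_vandermonde_ne_zero_iff.2 fun s s' h => ?_)
  · exact one_div_ne_zero (by exact_mod_cast Nat.factorial_ne_zero _)
  · have : 2 * (s : ℕ) + 1 = 2 * (s' : ℕ) + 1 := by exact_mod_cast h
    exact Fin.ext (by omega)

end Scaling

section PlaneAtInfinity

/-- The complex coordinate `l (x - 2 i p t)` on the plane. -/
def planeCoord (l p : ℂ) (y : ℝ × ℝ) : ℂ := l * (y.1 - 2 * Complex.I * p * y.2)

variable {l p : ℂ}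

/-- The imaginary part of `x - 2 i p t` is `-2 t Re p`, so for `Re p > 0` the coordinate controls
`t`, and then `x`. -/
lemma exists_norm_le_planeCoord (hl : l ≠ 0) (hp : 0 < p.re) :
    ∃ C : ℝ, ∀ y : ℝ × ℝ, ‖y‖ ≤ C * ‖planeCoord l p y‖ := by
  have hl' : 0 < ‖l‖ := norm_pos_iff.2 hl
  have h2 : ∀ y : ℝ × ℝ, |y.2| ≤ ‖planeCoord l p y‖ / (2 * p.re * ‖l‖) := by
    intro y
    rw [le_div_iff₀ (by positivity), planeCoord, norm_mul]
    have h := Complex.abs_im_le_norm ((y.1 : ℂ) - 2 * Complex.I * p * y.2)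
    have e : ((y.1 : ℂ) - 2 * Complex.I * p * y.2).im = -(2 * p.re * y.2) := by simp
    rw [e, abs_neg, abs_mul, abs_of_pos (by positivity : 0 < 2 * p.re)] at h
    nlinarith
  have h1 : ∀ y : ℝ × ℝ, |y.1| ≤ ‖planeCoord l p y‖ / ‖l‖ + 2 * ‖p‖ * |y.2| := by
    intro y
    have e : (y.1 : ℂ) = planeCoord l p y / l + 2 * Complex.I * p * y.2 := by
      rw [planeCoord, mul_div_cancel_left₀ _ hl]; ring
    calc |y.1| = ‖(y.1 : ℂ)‖ := by rw [Complex.norm_real, Real.norm_eq_abs]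
      _ ≤ _ := by
        rw [e]
        refine (norm_add_le _ _).trans ?_
        simp
  refine ⟨1 / (2 * p.re * ‖l‖) + 1 / ‖l‖ + 2 * ‖p‖ * (1 / (2 * p.re * ‖l‖)), fun y => ?_⟩
  have hn := norm_nonneg (planeCoord l p y)
  have h3 := h2 y
  have h4 := h1 y
  have h5 : 2 * ‖p‖ * |y.2| ≤ 2 * ‖p‖ * (‖planeCoord l p y‖ / (2 * p.re * ‖l‖)) := by gcongr
  have h6 : 0 ≤ ‖planeCoord l p y‖ / (2 * p.re * ‖l‖) := by positivity
  have h7 : 0 ≤ ‖planeCoord l p y‖ / ‖l‖ := by positivity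
  have h8 : 0 ≤ 2 * ‖p‖ * (‖planeCoord l p y‖ / (2 * p.re * ‖l‖)) := by positivity
  rw [Prod.norm_def, Real.norm_eq_abs, Real.norm_eq_abs]
  have e : (1 / (2 * p.re * ‖l‖) + 1 / ‖l‖ + 2 * ‖p‖ * (1 / (2 * p.re * ‖l‖)))
      * ‖planeCoord l p y‖ = ‖planeCoord l p y‖ / (2 * p.re * ‖l‖) + ‖planeCoord l p y‖ / ‖l‖
        + 2 * ‖p‖ * (‖planeCoord l p y‖ / (2 * p.re * ‖l‖)) := by ring
  rw [e]
  exact max_le (by linarith) (by linarith)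

lemma tendsto_norm_planeCoord (hl : l ≠ 0) (hp : 0 < p.re) :
    Tendsto (fun y => ‖planeCoord l p y‖) (cocompact (ℝ × ℝ)) atTop := by
  obtain ⟨C, hC⟩ := exists_norm_le_planeCoord hl hp
  have hC' : ∀ y : ℝ × ℝ, ‖y‖ ≤ max C 1 * ‖planeCoord l p y‖ := fun y =>
    (hC y).trans (mul_le_mul_of_nonneg_right (le_max_left _ _) (norm_nonneg _))
  have h1 := tendsto_atTop_mono hC' (tendsto_norm_cocompact_atTop (E := ℝ × ℝ))
  exact (tendsto_const_mul_atTop_of_pos (by positivity)).1 h1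

lemma tendsto_inv_planeCoord (hl : l ≠ 0) (hp : 0 < p.re) :
    Tendsto (fun y => (planeCoord l p y)⁻¹) (cocompact (ℝ × ℝ)) (nhds 0) := by
  rw [tendsto_zero_iff_norm_tendsto_zero]
  simp only [norm_inv]
  exact (tendsto_norm_planeCoord hl hp).inv_tendsto_atTop

lemma planeCoord_ne_zero (hl : l ≠ 0) (hp : 0 < p.re) :
    ∀ᶠ y in cocompact (ℝ × ℝ), planeCoord l p y ≠ 0 := by
  filter_upwards [(tendsto_norm_planeCoord hl hp).eventually_gt_atTop 0] with y hy
  exact norm_pos_iff.1 hy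

/-- Affine functions of `(x, t)` are negligible against higher powers of the coordinate. -/
lemma tendsto_affine_mul_inv_pow (hl : l ≠ 0) (hp : 0 < p.re) (u v w : ℂ) {r : ℕ} (hr : 2 ≤ r) :
    Tendsto (fun y : ℝ × ℝ => ((planeCoord l p y)⁻¹) ^ r * (u * y.1 + v * y.2 + w))
      (cocompact (ℝ × ℝ)) (nhds 0) := by
  obtain ⟨C, hC⟩ := exists_norm_le_planeCoord hl hp
  have hz := tendsto_inv_planeCoord hl hp
  have h1 : Tendsto (fun y => ((planeCoord l p y)⁻¹) ^ (r - 1)) (cocompact (ℝ × ℝ)) (nhds 0) := by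
    have := hz.pow (r - 1)
    rwa [zero_pow (by omega)] at this
  have h2 : IsBoundedUnder (· ≤ ·) (cocompact (ℝ × ℝ))
      (norm ∘ fun y : ℝ × ℝ => (planeCoord l p y)⁻¹ * (u * y.1 + v * y.2 + w)) := by
    refine isBoundedUnder_of_eventually_le (a := (‖u‖ + ‖v‖) * C + ‖w‖) ?_
    filter_upwards [(tendsto_norm_planeCoord hl hp).eventually_ge_atTop 1] with y hy
    have hpos : 0 < ‖planeCoord l p y‖ := by linarith
    simp only [Function.comp, norm_mul, norm_inv]
    rw [inv_mul_le_iff₀ hpos]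
    have hy1 : |y.1| ≤ ‖y‖ := norm_fst_le y
    have hy2 : |y.2| ≤ ‖y‖ := norm_snd_le y
    calc ‖u * y.1 + v * y.2 + w‖ ≤ ‖u * y.1‖ + ‖v * y.2‖ + ‖w‖ := norm_add₃_le
      _ = ‖u‖ * |y.1| + ‖v‖ * |y.2| + ‖w‖ := by simp
      _ ≤ ‖u‖ * (C * ‖planeCoord l p y‖) + ‖v‖ * (C * ‖planeCoord l p y‖)
          + ‖w‖ * ‖planeCoord l p y‖ := by
        have := hC y
        gcongr
        · linarith
        · linarith
        · nlinarith [norm_nonneg w]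
      _ = _ := by ring
  refine (h1.zero_mul_isBoundedUnder_le h2).congr fun y => ?_
  rw [← mul_assoc, ← pow_succ]
  congr 2
  omega

end PlaneAtInfinity

namespace BranchPair

variable (B : BranchPair)

/-- The exponents of the expansion of `expFun`. -/
def exponent (α : Fin 2) (y : ℝ × ℝ) (r : ℕ) : ℂ :=
  taylor (B.P α) r * y.1 + -Complex.I * taylor (fun κ => B.P α κ ^ 2) r * y.2 + taylor (B.a α) r

lemma coeff_weights (α : Fin 2) (y : ℝ × ℝ) (j : ℕ) :
    coeff j (B.weights.E α y.1 y.2) = B.expFun α y.1 y.2 0 * schur j (B.exponent α y) := by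
  have h1 := B.analytic_P α
  have h2 := B.analytic_a α
  set F : ℂ → ℂ := fun κ => B.P α κ * y.1 - Complex.I * B.P α κ ^ 2 * y.2 + B.a α κ with hF
  have hFa : AnalyticAt ℂ F 0 := by fun_prop
  have e : B.expFun α y.1 y.2 = fun κ => Complex.exp (F 0) * Complex.exp (F κ - F 0) := by
    funext κ; rw [← Complex.exp_add]; simp [expFun, hF]
  change coeff j (taylorSeries (B.expFun α y.1 y.2)) = _
  conv_lhs => rw [e]
  rw [taylorSeries_const_mul, coeff_C_mul, coeff_taylorSeries,
    ← schur_taylor (F := fun κ => F κ - F 0) (hFa.sub analyticAt_const) (by simp), expFun]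
  congr 1
  refine schur_congr fun r hr _ => ?_
  rw [← coeff_taylorSeries]
  have e2 : (fun κ => F κ - F 0) = fun κ => (y.1 : ℂ) * B.P α κ
      + (-Complex.I * y.2) * B.P α κ ^ 2 + B.a α κ - F 0 := by
    funext κ; simp only [hF]; ring
  rw [e2, taylorSeries_sub (by fun_prop) (by fun_prop), taylorSeries_add (by fun_prop) (by fun_prop),
    taylorSeries_add (by fun_prop) (by fun_prop), taylorSeries_const_mul, taylorSeries_const_mul,
    taylorSeries_const]
  simp only [map_add, map_sub, coeff_C_mul, coeff_taylorSeries, coeff_C, exponent]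
  rw [if_neg (by omega)]
  ring

/-- The growing coordinate at the base point `α`. -/
def coord (α : Fin 2) (y : ℝ × ℝ) : ℂ := planeCoord (deriv (B.P α) 0) (B.P α 0) y

/-- The first exponent equals the coordinate up to a constant, since the coefficient of `κ` in `P²`
is `2 P(0) P'(0)`. All exponents are affine in `(x, t)`, so those with `r ≥ 2` are negligible
against the `r`-th power of the coordinate. -/
lemma tendsto_scaled_exponent (α : Fin 2) (r : ℕ) (hr : 1 ≤ r) :
    Tendsto (fun y => ((B.coord α y)⁻¹) ^ r * B.exponent α y r) (cocompact (ℝ × ℝ))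
      (nhds (if r = 1 then 1 else 0)) := by
  have hl := B.deriv_ne_zero α
  have hp := B.re_pos α
  rcases hr.eq_or_lt with rfl | hr
  · rw [if_pos rfl]
    have h1 : taylor (fun κ => B.P α κ ^ 2) 1 = 2 * B.P α 0 * deriv (B.P α) 0 := by
      rw [taylor_one_right]
      exact ((B.analytic_P α).differentiableAt.hasDerivAt.pow 2).deriv.trans (by simp)
    have h2 := ((tendsto_inv_planeCoord hl hp).mul_const (taylor (B.a α) 1)).const_add 1
    rw [zero_mul, add_zero] at h2
    refine h2.congr' ?_
    filter_upwards [planeCoord_ne_zero hl hp] with y hy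
    have e : B.exponent α y 1 = B.coord α y + taylor (B.a α) 1 := by
      rw [exponent, h1, taylor_one_right (B.P α), coord, planeCoord]; ring
    rw [e, pow_one, mul_add, coord, inv_mul_cancel₀ hy]
  · rw [if_neg (by omega)]
    exact tendsto_affine_mul_inv_pow hl hp _ _ _ hr

/-- The rescaled coefficients of the weights. -/
def scaled (N : Fin 2 → ℕ) (α : Fin 2) (y : ℝ × ℝ) :
    Matrix (Fin (N α)) (Fin (LocalPair.order N)) ℂ :=
  Matrix.of fun s ν => if (ν : ℕ) ≤ 2 * (s : ℕ) + 1 then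
    schur (2 * (s : ℕ) + 1 - ν) (fun r => ((B.coord α y)⁻¹) ^ r * B.exponent α y r) else 0

lemma tendsto_scaled (N : Fin 2 → ℕ) (α : Fin 2) :
    Tendsto (B.scaled N α) (cocompact (ℝ × ℝ)) (nhds (Matrix.of fun s ν =>
      if (ν : ℕ) ≤ 2 * (s : ℕ) + 1 then 1 / ((2 * (s : ℕ) + 1 - ν)! : ℂ) else 0)) := by
  refine tendsto_pi_nhds.2 fun s => tendsto_pi_nhds.2 fun ν => ?_
  simp only [scaled, Matrix.of_apply]
  split_ifs
  · rw [← schur_single]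
    exact tendsto_schur (fun r hr => B.tendsto_scaled_exponent α r hr) _
  · exact tendsto_const_nhds

lemma coeff_weights_mul_X_pow (N : Fin 2 → ℕ) (α : Fin 2) {y : ℝ × ℝ} (hy : B.coord α y ≠ 0)
    (s : Fin (N α)) (ν : Fin (LocalPair.order N)) :
    coeff (2 * (s : ℕ) + 1) (B.weights.E α y.1 y.2 * X ^ (ν : ℕ))
      = B.expFun α y.1 y.2 0 * B.coord α y ^ (2 * (s : ℕ) + 1) * B.scaled N α y s ν
        * ((B.coord α y)⁻¹) ^ (ν : ℕ) := by
  rw [coeff_mul_X_pow', scaled, Matrix.of_apply]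
  split_ifs with h
  · rw [coeff_weights, schur_rescale]
    have e : B.coord α y ^ (2 * (s : ℕ) + 1) * ((B.coord α y)⁻¹) ^ (2 * (s : ℕ) + 1 - ν)
        * ((B.coord α y)⁻¹) ^ (ν : ℕ) = 1 := by
      rw [mul_assoc, ← pow_add, Nat.sub_add_cancel h, ← mul_pow, mul_inv_cancel₀ hy, one_pow]
    linear_combination -(B.expFun α y.1 y.2 0 * schur (2 * (s : ℕ) + 1 - ν) (B.exponent α y)) * e
  · simp

/-- The weights of a pair of branches reduce to normal form at infinity. -/
theorem weights_reduces (N : Fin 2 → ℕ) : B.weights.Reduces N := by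
  have hle : ∀ α, N α ≤ LocalPair.order N := by
    intro α; unfold LocalPair.order; fin_cases α <;> simp <;> omega
  have h := fun α => exists_scaled_factorization (hle α) (B.tendsto_scaled N α)
    (det_inv_factorial_ne_zero (N α))
    (tendsto_inv_planeCoord (B.deriv_ne_zero α) (B.re_pos α))
    (planeCoord_ne_zero (B.deriv_ne_zero α) (B.re_pos α))
    (e := fun y => B.expFun α y.1 y.2 0) (fun y => Complex.exp_ne_zero _)
    (fun s => 2 * (s : ℕ) + 1)
  choose A Γ hA hΓ using h
  refine ⟨fun y => Matrix.blockDiagonal' fun α => A α y,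
    fun y => Matrix.blockDiagonal' fun α => Γ α y, ?_, ?_⟩
  · filter_upwards [eventually_all.2 hA, eventually_all.2 fun α =>
      planeCoord_ne_zero (B.deriv_ne_zero α) (B.re_pos α)] with y hy hz
    constructor
    · rw [← Matrix.isUnit_iff_isUnit_det]
      exact (Pi.isUnit_iff.2 fun α => (hy α).1 : IsUnit fun α => A α y).map
        (Matrix.blockDiagonal'RingHom (fun α => Fin (N α)) ℂ)
    · rw [← Matrix.blockDiagonal'_mul]
      refine congrArg Matrix.blockDiagonal' (funext fun α => ?_)
      rw [← (hy α).2]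
      ext s ν
      exact B.coeff_weights_mul_X_pow N α (hz α) s ν
  · have hc : Continuous fun Γ : ∀ α, Matrix (Fin (N α)) (Fin (LocalPair.order N)) ℂ =>
        Matrix.blockDiagonal' Γ := continuous_id.matrix_blockDiagonal'
    have h2 := (hc.tendsto _).comp (tendsto_pi_nhds.2 hΓ)
    have e : LocalPair.toeplitz N id (fun _ => 1) = Matrix.blockDiagonal' fun α =>
        (Matrix.of fun (s : Fin (N α)) (ν : Fin (LocalPair.order N)) =>
          if (s : ℕ) = ν then (1 : ℂ) else 0) := by
      refine congrArg Matrix.blockDiagonal' (funext fun α => ?_)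
      ext s ν
      simp [coeff_X_pow]
    rw [e]
    exact h2

end BranchPair

end

/-! ### Holomorphic branches at a simple critical point of `𝒬` -/

section

open PowerSeries Filter Topology

section AnalyticRoots

/-- A nonvanishing analytic function has an analytic square root. -/
lemma exists_analytic_sqrt {h : ℂ → ℂ} {z₀ : ℂ} (hh : AnalyticAt ℂ h z₀) (h0 : h z₀ ≠ 0) :
    ∃ g, AnalyticAt ℂ g z₀ ∧ ∀ᶠ z in nhds z₀, g z ^ 2 = h z := by
  obtain ⟨w, hw⟩ := IsAlgClosed.exists_pow_nat_eq (h z₀) (n := 2) (by norm_num)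
  have h1 : AnalyticAt ℂ (fun z => h z / h z₀) z₀ := hh.fun_div analyticAt_const h0
  refine ⟨fun z => w * Complex.exp (Complex.log (h z / h z₀) / 2), ?_, ?_⟩
  · refine analyticAt_const.mul ((AnalyticAt.clog h1 ?_).fun_div analyticAt_const two_ne_zero).cexp'
    rw [div_self h0]; exact Complex.one_mem_slitPlane
  · filter_upwards [hh.continuousAt.eventually_ne h0] with z hz
    rw [mul_pow, hw, ← Complex.exp_nat_mul]
    have : ((2 : ℕ) : ℂ) * (Complex.log (h z / h z₀) / 2) = Complex.log (h z / h z₀) := by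
      push_cast; ring
    rw [this, Complex.exp_log (div_ne_zero hz h0), mul_div_cancel₀ _ h0]

/-- If the product of two analytic functions vanishes near a point, one of the factors does. -/
lemma eventually_eq_zero_of_mul {f g : ℂ → ℂ} {z₀ : ℂ} (hf : AnalyticAt ℂ f z₀)
    (hg : AnalyticAt ℂ g z₀) (h : ∀ᶠ z in 𝓝[≠] z₀, f z * g z = 0) :
    (∀ᶠ z in nhds z₀, f z = 0) ∨ ∀ᶠ z in nhds z₀, g z = 0 := by
  rcases hf.eventually_eq_zero_or_eventually_ne_zero with h1 | h1
  · exact Or.inl h1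
  · refine Or.inr (hg.frequently_zero_iff_eventually_zero.1 (Eventually.frequently ?_))
    filter_upwards [h, h1] with z hz hz1
    exact (mul_eq_zero.1 hz).resolve_left hz1

end AnalyticRoots

section Dispersion

variable {c : Params} {p₀ : ℂ}

lemma sub_I_mul_ne_zero {p : ℂ} (hp : 0 < p.re) (k : ℝ) : p - Complex.I * k ≠ 0 := by
  intro h
  have := congrArg Complex.re h
  simp at this
  exact hp.ne' this

lemma analyticAt_Q (c : Params) {p : ℂ} (hp : 0 < p.re) : AnalyticAt ℂ (Q c) p := by
  have h1 := sub_I_mul_ne_zero hp c.k₁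
  have h2 := sub_I_mul_ne_zero hp c.k₂
  unfold Q
  fun_prop (disch := assumption)

lemma hasDerivAt_Q (c : Params) {p : ℂ} (hp : 0 < p.re) :
    HasDerivAt (Q c) (-((c.δ₁ : ℂ) * (c.ρ₁ : ℂ) ^ 2) / (p - Complex.I * c.k₁) ^ 2
      - (c.δ₂ : ℂ) * (c.ρ₂ : ℂ) ^ 2 / (p - Complex.I * c.k₂) ^ 2 + 2 * Complex.I * p) p := by
  have h : ∀ (u : ℂ) (k : ℝ), HasDerivAt (fun p : ℂ => u / (p - Complex.I * k))
      (-u / (p - Complex.I * k) ^ 2) p := by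
    intro u k
    have := (((hasDerivAt_id p).sub_const (Complex.I * (k : ℂ))).inv
      (sub_I_mul_ne_zero hp k)).const_mul u
    simpa [div_eq_mul_inv] using this
  refine (((h _ c.k₁).add (h _ c.k₂)).add (((hasDerivAt_id p).pow 2).const_mul Complex.I)).congr_deriv ?_
  simp
  ring

/-- At a critical point off the imaginary axis `𝒬` does not vanish. -/
lemma Q_ne_zero_of_deriv_eq_zero (hp : 0 < p₀.re) (h : deriv (Q c) p₀ = 0) : Q c p₀ ≠ 0 := by
  intro hQ
  rw [(hasDerivAt_Q c hp).deriv] at h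
  have h1 := sub_I_mul_ne_zero hp c.k₁
  have h2 := sub_I_mul_ne_zero hp c.k₂
  unfold Q at hQ
  set d₁ := p₀ - Complex.I * c.k₁ with hd₁
  set d₂ := p₀ - Complex.I * c.k₂ with hd₂
  obtain ⟨u₁, hu₁⟩ : ∃ u, u * d₁ = (c.δ₁ : ℂ) * (c.ρ₁ : ℂ) ^ 2 := ⟨_, div_mul_cancel₀ _ h1⟩
  obtain ⟨u₂, hu₂⟩ : ∃ u, u * d₂ = (c.δ₂ : ℂ) * (c.ρ₂ : ℂ) ^ 2 := ⟨_, div_mul_cancel₀ _ h2⟩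
  rw [← hu₁, ← hu₂, mul_div_cancel_right₀ _ h1, mul_div_cancel_right₀ _ h2] at hQ
  rw [← hu₁, ← hu₂] at h
  have h' : u₁ * d₂ + u₂ * d₁ = 2 * Complex.I * p₀ * (d₁ * d₂) := by
    field_simp at h
    linear_combination -h
  -- `r0` and `r1` state that `p₀` is a double root of the polynomial `d₁ d₂ 𝒬`, of degree four in
  -- `p`.
  have r0 : u₁ * d₁ * d₂ + u₂ * d₂ * d₁ + Complex.I * p₀ ^ 2 * (d₁ * d₂) = 0 := by
    linear_combination d₁ * d₂ * hQ
  have r1 : u₁ * d₁ + u₂ * d₂ + 2 * Complex.I * p₀ * (d₁ * d₂)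
      + Complex.I * p₀ ^ 2 * (d₁ + d₂) = 0 := by
    linear_combination (d₁ + d₂) * hQ - h'
  rw [hu₁, hu₂] at r0 r1
  obtain ⟨a, ha⟩ : ∃ a : ℝ, (c.δ₁ : ℂ) * (c.ρ₁ : ℂ) ^ 2 = a := ⟨c.δ₁ * c.ρ₁ ^ 2, by push_cast; ring⟩
  obtain ⟨b, hb⟩ : ∃ b : ℝ, (c.δ₂ : ℂ) * (c.ρ₂ : ℂ) ^ 2 = b := ⟨c.δ₂ * c.ρ₂ ^ 2, by push_cast; ring⟩
  rw [ha, hb] at r0 r1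
  rw [hd₁, hd₂] at r0 r1
  generalize c.k₁ = k at *
  generalize c.k₂ = m at *
  obtain ⟨x, y⟩ := p₀
  simp only at hp
  have e0 := (Complex.ext_iff.1 r0)
  have e1 := (Complex.ext_iff.1 r1)
  simp only [pow_two, Complex.add_re, Complex.add_im, Complex.mul_re, Complex.mul_im,
    Complex.sub_re, Complex.sub_im, Complex.I_re, Complex.I_im, Complex.ofReal_re,
    Complex.ofReal_im, Complex.re_ofNat, Complex.im_ofNat, Complex.zero_re, Complex.zero_im]
    at e0 e1
  obtain ⟨e0, -⟩ := e0
  obtain ⟨e1, e2⟩ := e1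
  -- Eliminating the real numbers `a`, `b` between the real parts. Conceptually, `-conj p₀` is also
  -- a double root by reflection symmetry, and this is the sum of the four roots.
  have hs : 4 * y = k + m := by
    have : 2 * x ^ 3 * (4 * y - (k + m)) = 0 := by linear_combination e0 - x * e1
    have := (mul_eq_zero.1 this).resolve_left (by positivity)
    linarith
  have hk : k = 4 * y - m := by linarith
  subst hk
  have : 4 * (3 * y ^ 2 - x ^ 2) - 24 * y ^ 2 + 2 * ((4 * y - m) * m) = 0 := by
    have : x * (4 * (3 * y ^ 2 - x ^ 2) - 24 * y ^ 2 + 2 * ((4 * y - m) * m)) = 0 := by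
      linear_combination -e2
    exact (mul_eq_zero.1 this).resolve_left hp.ne'
  -- After substitution the equation reads `4 x² + 4 y² + 2 (2 y - m)² = 0`, impossible for `x > 0`.
  nlinarith [sq_nonneg (2 * y - m), sq_nonneg y, mul_pos hp hp]

/-- Near a simple critical point, `𝒬' = (p - p₀) K`. -/
lemma IsSimpleRoot.deriv_factor (hp : 0 < p₀.re) (hroot : IsSimpleRoot c p₀) :
    ∃ K, AnalyticAt ℂ K p₀ ∧ K p₀ ≠ 0 ∧ ∀ᶠ p in nhds p₀, deriv (Q c) p = (p - p₀) * K p := by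
  have h1 := (analyticAt_Q c hp).deriv
  have h2 := h1.analyticOrderAt_deriv_add_one
  rw [h1.deriv.analyticOrderAt_eq_zero.2 hroot.2, hroot.1, zero_add] at h2
  simp only [sub_zero] at h2
  obtain ⟨K, hK, hK0, he⟩ := (h1.analyticOrderAt_eq_natCast (n := 1)).1 (by simpa using h2.symm)
  exact ⟨K, hK, hK0, by simpa using he⟩

/-- Near a simple critical point, `𝒬 - 𝒬(p₀) = (p - p₀)² K`. -/
lemma IsSimpleRoot.factor (hp : 0 < p₀.re) (hroot : IsSimpleRoot c p₀) :
    ∃ K, AnalyticAt ℂ K p₀ ∧ K p₀ ≠ 0 ∧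
      ∀ᶠ p in nhds p₀, Q c p = Q c p₀ + (p - p₀) ^ 2 * K p := by
  have h0 := analyticAt_Q c hp
  have h1 := h0.deriv
  have h2 := h1.analyticOrderAt_deriv_add_one
  rw [h1.deriv.analyticOrderAt_eq_zero.2 hroot.2, hroot.1, zero_add] at h2
  simp only [sub_zero] at h2
  have h3 := h0.analyticOrderAt_deriv_add_one
  rw [← h2, one_add_one_eq_two] at h3
  obtain ⟨K, hK, hK0, he⟩ := ((h0.fun_sub analyticAt_const).analyticOrderAt_eq_natCast (n := 2)).1
    (by simpa using h3.symm)
  refine ⟨K, hK, hK0, ?_⟩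
  filter_upwards [he] with p hp
  rw [smul_eq_mul] at hp
  rw [← hp]; ring

/-- A holomorphic branch of `√(𝒬² - 𝒬(p₀)²)` with a simple zero. -/
lemma IsSimpleRoot.exists_sqrt (hp : 0 < p₀.re) (hroot : IsSimpleRoot c p₀) :
    ∃ S, AnalyticAt ℂ S p₀ ∧
      ∀ᶠ p in nhds p₀, ((p - p₀) * S p) ^ 2 = Q c p ^ 2 - Q c p₀ ^ 2 := by
  obtain ⟨K, hK, hK0, he⟩ := hroot.factor hp
  have hQ := Q_ne_zero_of_deriv_eq_zero hp hroot.1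
  -- In `(𝒬 - 𝒬(p₀))(𝒬 + 𝒬(p₀))` the first factor is `(p - p₀)²` times a unit and the second equals
  -- `2 𝒬(p₀) ≠ 0` at `p₀`, so the square root is single valued.
  obtain ⟨S, hS, hS2⟩ := exists_analytic_sqrt
    (h := fun p => K p * (Q c p + Q c p₀)) (z₀ := p₀)
    (hK.mul ((analyticAt_Q c hp).add analyticAt_const))
    (mul_ne_zero hK0 (by rw [← two_mul]; exact mul_ne_zero two_ne_zero hQ))
  refine ⟨S, hS, ?_⟩
  filter_upwards [he, hS2] with p h1 h2
  rw [mul_pow, h2]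
  linear_combination -(Q c p + Q c p₀) * h1

/-- The square root of `𝒬² - 𝒬(p₀)²` has a factor `p - p₀`, which cancels the simple zero of `𝒬'`.
-/
lemma IsSimpleRoot.exists_branchT (hp : 0 < p₀.re) (hroot : IsSimpleRoot c p₀) :
    ∃ T, IsBranchT c p₀ T := by
  obtain ⟨S, hS, hS2⟩ := hroot.exists_sqrt hp
  obtain ⟨K, hK, hK0, he⟩ := hroot.deriv_factor hp
  refine ⟨fun p => S p / K p, hS.fun_div hK hK0, ?_⟩
  filter_upwards [hS2, he, hK.continuousAt.eventually_ne hK0] with p h1 h2 h3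
  rw [← h1, h2]
  field_simp

lemma IsSimpleRoot.exists_branchW (hp : 0 < p₀.re) (hroot : IsSimpleRoot c p₀) :
    ∃ W, IsBranchW c p₀ W := by
  obtain ⟨S, hS, hS2⟩ := hroot.exists_sqrt hp
  have hQ := Q_ne_zero_of_deriv_eq_zero hp hroot.1
  have hQa := analyticAt_Q c hp
  refine ⟨fun p => (Q c p + (p - p₀) * S p) / Q c p₀, ?_, ?_, ?_⟩
  · fun_prop (disch := assumption)
  · simp [hQ]
  · filter_upwards [hS2] with p h1
    rw [← h1]
    field_simp
    ring

lemma cosh_eq_one_add (κ : ℂ) : Complex.cosh κ = 1 + 2 * Complex.sinh (κ / 2) ^ 2 := by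
  have h := Complex.cosh_two_mul (κ / 2)
  rw [mul_div_cancel₀ _ two_ne_zero] at h
  rw [h]
  linear_combination Complex.cosh_sq (κ / 2)

/-- Write `𝒬 = 𝒬(p₀)(1 + 2 ψ²)` with `ψ` a local coordinate at `p₀`, and `cosh κ = 1 + 2
sinh²(κ/2)`; then `p(κ) = ψ⁻¹(sinh(κ/2))` is a solution. -/
lemma IsSimpleRoot.exists_branchP (hp : 0 < p₀.re) (hroot : IsSimpleRoot c p₀) :
    ∃ P, IsBranchP c p₀ P := by
  obtain ⟨K, hK, hK0, he⟩ := hroot.factor hp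
  have hQ := Q_ne_zero_of_deriv_eq_zero hp hroot.1
  obtain ⟨g, hg, hg2⟩ := exists_analytic_sqrt (h := fun p => K p / (2 * Q c p₀)) (z₀ := p₀)
    (hK.fun_div analyticAt_const (by simp [hQ])) (div_ne_zero hK0 (by simp [hQ]))
  have hg0 : g p₀ ≠ 0 := by
    have := hg2.self_of_nhds
    intro h
    rw [h, zero_pow two_ne_zero, eq_comm, div_eq_zero_iff] at this
    simp [hK0, hQ] at this
  set ψ : ℂ → ℂ := fun p => (p - p₀) * g p with hψ
  have hψa : AnalyticAt ℂ ψ p₀ := by fun_prop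
  have hψ' : deriv ψ p₀ ≠ 0 := by
    have h1 := (((hasDerivAt_id p₀).sub_const p₀).mul hg.differentiableAt.hasDerivAt).deriv
    have h2 : deriv ψ p₀ = g p₀ := by
      rw [hψ]; refine Eq.trans ?_ (h1.trans (by simp)); rfl
    rw [h2]; exact hg0
  have hψ0 : ψ p₀ = 0 := by simp [hψ]
  set r := hψa.hasStrictDerivAt.localInverse _ _ _ hψ' with hφ
  have hφa : AnalyticAt ℂ r 0 := hψ0 ▸ hψa.analyticAt_localInverse hψ'
  have hφ0 : r 0 = p₀ := by
    rw [← hψ0]; exact HasStrictFDerivAt.localInverse_apply_image ..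
  have hr : ∀ᶠ y in nhds (0 : ℂ), ψ (r y) = y := by
    have := HasStrictDerivAt.eventually_right_inverse hψa.hasStrictDerivAt hψ'
    rwa [hψ0] at this
  have hs : AnalyticAt ℂ (fun κ : ℂ => Complex.sinh (κ / 2)) 0 := by fun_prop
  have hst : Tendsto (fun κ : ℂ => Complex.sinh (κ / 2)) (nhds 0) (nhds 0) := by
    simpa using hs.continuousAt.tendsto
  have hφt : Tendsto r (nhds 0) (nhds p₀) := by
    simpa [hφ0] using hφa.continuousAt.tendsto
  refine ⟨fun κ => r (Complex.sinh (κ / 2)), ?_, by simpa using hφ0, ?_⟩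
  · exact AnalyticAt.fun_comp (by simpa using hφa) hs
  · filter_upwards [hst.eventually hr, (hφt.comp hst).eventually he,
      (hφt.comp hst).eventually hg2] with κ h1 h2 h3
    simp only [Function.comp] at h2 h3
    rw [h2, cosh_eq_one_add]
    generalize r (Complex.sinh (κ / 2)) = q at *
    rw [← h1]
    simp only [hψ]
    rw [mul_pow, h3]
    field_simp

variable {P : ℂ → ℂ}

lemma IsBranchP.tendsto (hP : IsBranchP c p₀ P) : Tendsto P (nhds 0) (nhds p₀) := by
  have := hP.1.continuousAt.tendsto
  rwa [hP.2.1] at this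

lemma IsBranchP.re_pos (hp : 0 < p₀.re) (hP : IsBranchP c p₀ P) : 0 < (P 0).re := by
  rw [hP.2.1]; exact hp

lemma IsBranchP.deriv_mul (hp : 0 < p₀.re) (hP : IsBranchP c p₀ P) :
    ∀ᶠ κ in nhds (0 : ℂ), deriv (Q c) (P κ) * deriv P κ = Q c p₀ * Complex.sinh κ := by
  have hQ : ∀ᶠ κ in nhds (0 : ℂ), AnalyticAt ℂ (Q c) (P κ) :=
    hP.tendsto.eventually (analyticAt_Q c hp).eventually_analyticAt
  filter_upwards [hP.2.2.eventually_nhds, hP.1.eventually_analyticAt, hQ] with κ h1 h2 h3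
  have h4 := h3.differentiableAt.hasDerivAt.comp κ h2.differentiableAt.hasDerivAt
  have h5 : HasDerivAt (fun κ => Q c p₀ * Complex.cosh κ) (Q c p₀ * Complex.sinh κ) κ :=
    (Complex.hasDerivAt_cosh κ).const_mul _
  exact h4.unique (h5.congr_of_eventuallyEq h1)

/-- Differentiating `𝒬'(P) P' = 𝒬(p₀) sinh κ` at `0` gives `𝒬''(p₀) P'(0)² = 𝒬(p₀) ≠ 0`. -/
lemma IsBranchP.deriv_ne_zero (hp : 0 < p₀.re) (hroot : IsSimpleRoot c p₀)
    (hP : IsBranchP c p₀ P) : deriv P 0 ≠ 0 := by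
  intro h0
  have h1 : HasDerivAt (fun κ => deriv (Q c) (P κ)) (deriv (deriv (Q c)) (P 0) * deriv P 0) 0 := by
    refine HasDerivAt.comp (h₂ := deriv (Q c)) 0 ?_ hP.1.differentiableAt.hasDerivAt
    rw [hP.2.1]
    exact (analyticAt_Q c hp).deriv.differentiableAt.hasDerivAt
  have h2 := h1.mul hP.1.deriv.differentiableAt.hasDerivAt
  have h3 : HasDerivAt (fun κ => Q c p₀ * Complex.sinh κ) (Q c p₀ * Complex.cosh 0) 0 :=
    (Complex.hasDerivAt_sinh 0).const_mul _
  have h4 := h2.unique (h3.congr_of_eventuallyEq (hP.deriv_mul hp))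
  rw [h0, hP.2.1, hroot.1] at h4
  simp at h4
  exact Q_ne_zero_of_deriv_eq_zero hp hroot.1 h4.symm

lemma IsBranchP.comp_neg (hP : IsBranchP c p₀ P) : IsBranchP c p₀ fun κ => P (-κ) := by
  have ht : Tendsto (fun κ : ℂ => -κ) (nhds 0) (nhds 0) := by
    simpa using (continuous_neg (G := ℂ)).tendsto 0
  refine ⟨?_, by simpa using hP.2.1, ?_⟩
  · exact AnalyticAt.fun_comp (by simpa using hP.1) (by fun_prop)
  · filter_upwards [ht.eventually hP.2.2] with κ hκ
    rw [hκ, Complex.cosh_neg]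

/-- A branch of `𝒯` is the vector field of a suitable branch of `p(κ)`. -/
lemma IsBranchT.exists_branchP {T : ℂ → ℂ} (hp : 0 < p₀.re) (hroot : IsSimpleRoot c p₀)
    (hT : IsBranchT c p₀ T) :
    ∃ P, IsBranchP c p₀ P ∧ ∀ᶠ κ in nhds (0 : ℂ), T (P κ) = deriv P κ := by
  obtain ⟨P, hP⟩ := hroot.exists_branchP hp
  have hQ0 := Q_ne_zero_of_deriv_eq_zero hp hroot.1
  have hTP : AnalyticAt ℂ (fun κ => T (P κ)) 0 :=
    AnalyticAt.fun_comp (by rw [hP.2.1]; exact hT.1) hP.1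
  have hsinh : ∀ᶠ κ in 𝓝[≠] (0 : ℂ), Complex.sinh κ ≠ 0 := by
    have h1 : AnalyticAt ℂ Complex.sinh 0 := by fun_prop
    refine h1.eventually_eq_zero_or_eventually_ne_zero.resolve_left fun h => ?_
    have h3 : HasDerivAt Complex.sinh 0 0 :=
      (hasDerivAt_const (0 : ℂ) (0 : ℂ)).congr_of_eventuallyEq h
    have := (Complex.hasDerivAt_sinh 0).unique h3
    simp at this
  -- `T(P)` and `P'` have the same square: multiplied by `𝒬'(P)²` both squares equal `𝒬(p₀)² sinh²
  -- κ`. Away from `0` the factor `𝒬'(P)` can be cancelled; if the signs disagree, `P(-κ)` is the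
  -- right branch.
  have hmul : ∀ᶠ κ in 𝓝[≠] (0 : ℂ), (T (P κ) - deriv P κ) * (T (P κ) + deriv P κ) = 0 := by
    filter_upwards [(hP.deriv_mul hp).filter_mono nhdsWithin_le_nhds,
      (hP.tendsto.eventually hT.2).filter_mono nhdsWithin_le_nhds, hsinh,
      hP.2.2.filter_mono nhdsWithin_le_nhds] with κ h1 h2 h3 h4
    have h5 : deriv (Q c) (P κ) ≠ 0 := fun h => by
      rw [h, zero_mul] at h1
      exact mul_ne_zero hQ0 h3 h1.symm
    have h6 : (T (P κ) - deriv P κ) * (T (P κ) + deriv P κ) * deriv (Q c) (P κ) ^ 2 = 0 := by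
      rw [h4] at h2
      linear_combination h2 - (deriv (Q c) (P κ) * deriv P κ + Q c p₀ * Complex.sinh κ) * h1
        + Q c p₀ ^ 2 * Complex.cosh_sq κ
    exact (mul_eq_zero.1 h6).resolve_right (pow_ne_zero _ h5)
  rcases eventually_eq_zero_of_mul (hTP.sub hP.1.deriv) (hTP.add hP.1.deriv) hmul with h | h
  · exact ⟨P, hP, h.mono fun κ hκ => sub_eq_zero.1 hκ⟩
  · refine ⟨_, hP.comp_neg, ?_⟩
    have ht : Tendsto (fun κ : ℂ => -κ) (nhds 0) (nhds 0) := by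
      simpa using (continuous_neg (G := ℂ)).tendsto 0
    filter_upwards [ht.eventually h] with κ hκ
    rw [deriv_comp_neg]
    exact eq_neg_of_add_eq_zero_left hκ

/-- Along a branch of `p(κ)` the logarithm of a branch of `𝒲` is `± κ`. -/
lemma IsBranchW.exists_log {W : ℂ → ℂ} (hp : 0 < p₀.re) (hroot : IsSimpleRoot c p₀)
    (hW : IsBranchW c p₀ W) (hP : IsBranchP c p₀ P) :
    ∃ e : ℂ, ∀ᶠ κ in nhds (0 : ℂ), Complex.log (W (P κ)) = e * κ := by
  have hQ0 := Q_ne_zero_of_deriv_eq_zero hp hroot.1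
  have hWP : AnalyticAt ℂ (fun κ => W (P κ)) 0 :=
    AnalyticAt.fun_comp (by rw [hP.2.1]; exact hW.1) hP.1
  -- On the branch, `W` solves `w² - 2 w cosh κ + 1 = 0`, whose roots are `exp(±κ)`.
  have hmul : ∀ᶠ κ in nhds (0 : ℂ),
      (W (P κ) - Complex.exp (1 * κ)) * (W (P κ) - Complex.exp (-1 * κ)) = 0 := by
    filter_upwards [hP.2.2, hP.tendsto.eventually hW.2.2] with κ h1 h2
    rw [h1] at h2
    have h3 : Q c p₀ ^ 2 * ((W (P κ) - Complex.exp (1 * κ)) * (W (P κ) - Complex.exp (-1 * κ)))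
        = 0 := by
      rw [Complex.cosh] at h2
      have h4 : Complex.exp (1 * κ) * Complex.exp (-1 * κ) = 1 := by
        rw [← Complex.exp_add]; simp
      rw [one_mul] at *
      rw [neg_one_mul] at *
      linear_combination h2 + Q c p₀ ^ 2 * h4
    exact (mul_eq_zero.1 h3).resolve_left (pow_ne_zero _ hQ0)
  have hlog : ∀ e : ℂ, (∀ᶠ κ in nhds (0 : ℂ), W (P κ) - Complex.exp (e * κ) = 0) →
      ∀ᶠ κ in nhds (0 : ℂ), Complex.log (W (P κ)) = e * κ := by
    intro e h
    have ht : Tendsto (fun κ : ℂ => (e * κ).im) (nhds 0) (nhds 0) := by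
      have : Continuous fun κ : ℂ => (e * κ).im := by fun_prop
      simpa using this.tendsto 0
    filter_upwards [h, ht.eventually (Ioo_mem_nhds (neg_lt_zero.2 Real.pi_pos) Real.pi_pos)]
      with κ h1 h2
    rw [sub_eq_zero.1 h1, Complex.log_exp h2.1 h2.2.le]
  rcases eventually_eq_zero_of_mul (hWP.sub (by fun_prop)) (hWP.sub (by fun_prop))
    (hmul.filter_mono nhdsWithin_le_nhds) with h | h
  · exact ⟨1, hlog 1 h⟩
  · exact ⟨-1, hlog (-1) h⟩

lemma taylorSeries_Q_comp {P : ℂ → ℂ} (hP : AnalyticAt ℂ P 0) (hp : 0 < (P 0).re) :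
    taylorSeries (fun κ => Q c (P κ))
      = C ((c.δ₁ * c.ρ₁ ^ 2 : ℝ) : ℂ) * (taylorSeries P - C (Complex.I * c.k₁))⁻¹
        + C ((c.δ₂ * c.ρ₂ ^ 2 : ℝ) : ℂ) * (taylorSeries P - C (Complex.I * c.k₂))⁻¹
        + C Complex.I * taylorSeries P ^ 2 := by
  have h1 := sub_I_mul_ne_zero hp c.k₁
  have h2 := sub_I_mul_ne_zero hp c.k₂
  simp only [Q, div_eq_mul_inv]
  rw [taylorSeries_add (by fun_prop (disch := assumption)) (by fun_prop),
    taylorSeries_add (by fun_prop (disch := assumption)) (by fun_prop (disch := assumption)),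
    taylorSeries_const_mul, taylorSeries_const_mul, taylorSeries_const_mul, taylorSeries_pow hP,
    taylorSeries_inv (by fun_prop) h1, taylorSeries_inv (by fun_prop) h2,
    taylorSeries_sub hP analyticAt_const, taylorSeries_sub hP analyticAt_const,
    taylorSeries_const, taylorSeries_const]
  push_cast
  rfl

lemma taylor_cosh_of_odd {r : ℕ} (hr : Odd r) : taylor Complex.cosh r = 0 := by
  have h := iteratedDeriv_comp_neg r Complex.cosh 0
  simp only [Complex.cosh_neg, hr.neg_one_pow, neg_zero, smul_eq_mul, neg_mul, one_mul] at h
  rw [taylor, self_eq_neg.1 h, zero_div]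

/-- The series is that of `𝒬(P(κ)) = 𝒬(p₀) cosh κ`, which is even; this is the hypothesis of the
dimension reduction. -/
lemma IsBranchP.coeff_odd (hp : 0 < p₀.re) (hP : IsBranchP c p₀ P) {r : ℕ} (hr : Odd r) :
    coeff r (C ((c.δ₁ * c.ρ₁ ^ 2 : ℝ) : ℂ) * (taylorSeries P - C (Complex.I * c.k₁))⁻¹
        + C ((c.δ₂ * c.ρ₂ ^ 2 : ℝ) : ℂ) * (taylorSeries P - C (Complex.I * c.k₂))⁻¹
        + C Complex.I * taylorSeries P ^ 2) = 0 := by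
  rw [← taylorSeries_Q_comp hP.1 (hP.re_pos hp), taylorSeries_congr hP.2.2, taylorSeries_const_mul,
    coeff_C_mul, coeff_taylorSeries, taylor_cosh_of_odd hr, mul_zero]

end Dispersion

end

/-! ### Operator matrix elements as coefficients of the Cauchy kernel -/

section

open PowerSeries Filter Topology

section RationalExpansion

/-- The finite Blaschke product of the right half plane. -/
def blaschkeFun (z : ℕ → ℂ) (l : ℕ) (p : ℂ) : ℂ :=
  ∏ m ∈ Finset.range l, (p - z m) / (p + conj (z m))

/-- The Takenaka-Malmquist functions of the right half plane. -/
def tmFun (z : ℕ → ℂ) (l : ℕ) (p : ℂ) : ℂ := blaschkeFun z l p / (p + conj (z l))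

variable {z : ℕ → ℂ}

lemma conjFun_blaschkeFun (l : ℕ) (q : ℂ) :
    conjFun (blaschkeFun z l) q = ∏ m ∈ Finset.range l, (q - conj (z m)) / (q + z m) := by
  simp [conjFun, blaschkeFun]

lemma conjFun_tmFun (l : ℕ) (q : ℂ) :
    conjFun (tmFun z l) q = conjFun (blaschkeFun z l) q / (q + z l) := by
  simp [conjFun, tmFun]

/-- A telescoping identity: one more term replaces the remainder by the remainder with one more
Blaschke factor in each variable. -/
lemma one_div_add_expansion {p q : ℂ} (hpq : p + q ≠ 0) (hp : ∀ l, p + conj (z l) ≠ 0)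
    (hq : ∀ l, q + z l ≠ 0) (L : ℕ) :
    1 / (p + q) = ∑ l ∈ Finset.range L, (z l + conj (z l)) * tmFun z l p * conjFun (tmFun z l) q
      + blaschkeFun z L p * conjFun (blaschkeFun z L) q / (p + q) := by
  induction L with
  | zero => simp [blaschkeFun, conjFun]
  | succ L ih =>
    rw [ih, Finset.sum_range_succ, add_assoc]
    congr 1
    have e1 : blaschkeFun z (L + 1) p = blaschkeFun z L p * ((p - z L) / (p + conj (z L))) := by
      rw [blaschkeFun, Finset.prod_range_succ, ← blaschkeFun]
    have e2 : conjFun (blaschkeFun z (L + 1)) q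
        = conjFun (blaschkeFun z L) q * ((q - conj (z L)) / (q + z L)) := by
      rw [conjFun_blaschkeFun, Finset.prod_range_succ, ← conjFun_blaschkeFun]
    rw [e1, e2, conjFun_tmFun, tmFun]
    have h1 := hp L
    have h2 := hq L
    field_simp
    ring

lemma analyticAt_blaschkeFun {p : ℂ} (hp : ∀ l, p + conj (z l) ≠ 0) (l : ℕ) :
    AnalyticAt ℂ (blaschkeFun z l) p := by
  have : ∀ m, AnalyticAt ℂ (fun p => (p - z m) / (p + conj (z m))) p := fun m => by
    have := hp m
    fun_prop (disch := assumption)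
  exact Finset.analyticAt_fun_prod _ fun m _ => this m

lemma analyticAt_tmFun {p : ℂ} (hp : ∀ l, p + conj (z l) ≠ 0) (l : ℕ) :
    AnalyticAt ℂ (tmFun z l) p :=
  (analyticAt_blaschkeFun hp l).fun_div (analyticAt_id.add analyticAt_const) (hp l)

lemma taylorSeries_tmFun {P : ℂ → ℂ} (hP : AnalyticAt ℂ P 0) (h : ∀ l, P 0 + conj (z l) ≠ 0)
    (l : ℕ) : taylorSeries (fun κ => tmFun z l (P κ)) = tmBasis z z (taylorSeries P) l := by
  have h1 : ∀ l, taylorSeries (fun κ => P κ + conj (z l)) = taylorSeries P + C (conj (z l)) :=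
    fun l => by rw [taylorSeries_add hP analyticAt_const, taylorSeries_const]
  have ha : ∀ l, AnalyticAt ℂ (fun κ => blaschkeFun z l (P κ)) 0 := fun l =>
    AnalyticAt.fun_comp (analyticAt_blaschkeFun h l) hP
  have h2 : ∀ l, taylorSeries (fun κ => blaschkeFun z l (P κ)) = blaschke z z (taylorSeries P) l := by
    intro l
    induction l with
    | zero => simp [blaschkeFun, blaschke, taylorSeries_const]
    | succ l ih =>
      have hl := h l
      have e : (fun κ => blaschkeFun z (l + 1) (P κ))
          = fun κ => blaschkeFun z l (P κ) * ((P κ - z l) / (P κ + conj (z l))) := by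
        funext κ; rw [blaschkeFun, Finset.prod_range_succ, ← blaschkeFun]
      rw [e, taylorSeries_mul (ha l) (by fun_prop (disch := assumption)), ih,
        taylorSeries_div (by fun_prop) (by fun_prop) hl, h1, taylorSeries_sub hP analyticAt_const,
        taylorSeries_const, blaschke, blaschke, Finset.prod_range_succ]
  simp only [tmFun]
  rw [taylorSeries_div (ha l) (by fun_prop) (h l), h1, h2, tmBasis]

end RationalExpansion

/-- Iterated derivations of a function of `p` and `q` that is separable up to terms of high order
in `q`. -/
lemma opPow_opPow_of_separable {ι : Type*} [Fintype ι] {A B : ι → ℂ → ℂ} {P P' T T' : ℂ → ℂ}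
    {p₀ p₀' : ℂ} {G : ℂ → ℂ → ℂ} (hP : AnalyticAt ℂ P 0) (hP0 : P 0 = p₀)
    (hT : AnalyticAt ℂ T p₀) (hTP : ∀ᶠ z in nhds 0, T (P z) = deriv P z)
    (hP' : AnalyticAt ℂ P' 0) (hP0' : P' 0 = p₀') (hT' : AnalyticAt ℂ T' p₀')
    (hTP' : ∀ᶠ z in nhds 0, T' (P' z) = deriv P' z) (hA : ∀ l, AnalyticAt ℂ (A l) p₀)
    (hB : ∀ l, AnalyticAt ℂ (B l) p₀') {n j : ℕ} (hj : j < n)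
    (hG : ∀ᶠ p in nhds p₀, ∃ H, AnalyticAt ℂ H (conj p₀') ∧ ∀ᶠ q in nhds (conj p₀'),
      G p q = (∑ l, A l p * conjFun (B l) q) + (q - conj p₀') ^ n * H q) (s : ℕ) :
    opPow T s (fun p => opPow (conjFun T') j (G p) (conj p₀')) p₀
      = ∑ l, taylor (fun κ => A l (P κ)) s * conj (taylor (fun κ => B l (P' κ)) j) := by
  subst hP0 hP0'
  have hconj : Tendsto (starRingEnd ℂ) (nhds 0) (nhds 0) := by
    simpa using Complex.continuous_conj.tendsto 0
  have hQ : AnalyticAt ℂ (conjFun P') 0 := analyticAt_conjFun (by simpa using hP')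
  have hQ0 : conjFun P' 0 = conj (P' 0) := by simp [conjFun]
  have hTQ : ∀ᶠ z in nhds 0, conjFun T' (conjFun P' z) = deriv (conjFun P') z := by
    filter_upwards [hconj.eventually hTP'] with z hz
    have := congrFun (iteratedDeriv_conjFun P' 1) z
    rw [iteratedDeriv_one, iteratedDeriv_one] at this
    rw [this]
    simp only [conjFun, Complex.conj_conj]
    rw [hz]
  have hB' : ∀ l, AnalyticAt ℂ (conjFun (B l)) (conj (P' 0)) := fun l =>
    analyticAt_conjFun (by simpa using hB l)
  -- For fixed `p` the inner operator takes the coefficient `j < n` along the conjugate branch and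
  -- so annihilates the remainder of order `n`; what is left is a finite sum of functions of `p`.
  have hinner : ∀ᶠ p in nhds (P 0), opPow (conjFun T') j (G p) (conj (P' 0))
      = ∑ l, A l p * conj (taylor (fun κ => B l (P' κ)) j) := by
    filter_upwards [hG] with p hp
    obtain ⟨H, hH, he⟩ := hp
    have hS : AnalyticAt ℂ (fun q => ∑ l, A l p * conjFun (B l) q) (conj (P' 0)) :=
      Finset.analyticAt_fun_sum _ fun l _ => analyticAt_const.mul (hB' l)
    have hR : AnalyticAt ℂ (fun q => (q - conj (P' 0)) ^ n * H q) (conj (P' 0)) := by fun_prop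
    rw [opPow_congr he, opPow_eq_taylor hQ hQ0 (analyticAt_conjFun (by simpa using hT')) hTQ
      (hS.fun_add hR), ← coeff_taylorSeries]
    rw [← hQ0] at hS hB' hH
    have hR' : AnalyticAt ℂ (fun q => (q - conj (P' 0)) ^ n * H q) (conjFun P' 0) := by fun_prop
    rw [taylorSeries_add (hS.fun_comp hQ) (hR'.fun_comp hQ), map_add]
    have h0 : coeff j (taylorSeries fun κ => (conjFun P' κ - conj (P' 0)) ^ n * H (conjFun P' κ))
        = 0 := by
      have hd : AnalyticAt ℂ (fun κ => conjFun P' κ - conj (P' 0)) 0 := hQ.sub analyticAt_const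
      rw [taylorSeries_mul (hd.fun_pow n) (hH.fun_comp hQ), taylorSeries_pow hd]
      refine coeff_mul_eq_zero_of_X_pow_dvd hj (pow_dvd_pow_of_dvd (X_dvd_iff.2 ?_) n) _
      rw [constantCoeff_taylorSeries, hQ0, sub_self]
    rw [h0, add_zero, taylorSeries_sum _ fun l _ => analyticAt_const.fun_mul ((hB' l).fun_comp hQ), map_sum]
    refine Finset.sum_congr rfl fun l _ => ?_
    rw [taylorSeries_const_mul, coeff_C_mul, coeff_taylorSeries, ← taylor_conjFun]
    simp only [conjFun, Complex.conj_conj]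
    rfl
  have hout : ∀ l, AnalyticAt ℂ
      (fun p => A l p * conj (taylor (fun κ => B l (P' κ)) j)) (P 0) := fun l =>
    (hA l).mul analyticAt_const
  rw [opPow_congr hinner, opPow_eq_taylor hP rfl hT hTP (Finset.analyticAt_fun_sum _ fun l _ => hout l),
    ← coeff_taylorSeries, taylorSeries_sum _ fun l _ => (hout l).fun_comp hP, map_sum]
  refine Finset.sum_congr rfl fun l _ => ?_
  simp only [mul_comm (A l _)]
  rw [taylorSeries_const_mul, coeff_C_mul, coeff_taylorSeries, mul_comm]

lemma conj_add_ne_zero_of_re_pos {p q : ℂ} (hp : 0 < p.re) (hq : 0 < q.re) : p + conj q ≠ 0 := by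
  intro h
  have := congrArg Complex.re h
  simp only [Complex.add_re, Complex.conj_re, Complex.zero_re] at this
  linarith

lemma eventually_re_pos {p : ℂ} (hp : 0 < p.re) : ∀ᶠ q in nhds p, 0 < q.re :=
  Complex.continuous_re.continuousAt.eventually (lt_mem_nhds hp)

namespace BranchPair

variable (B : BranchPair)

lemma p₀_localPair (α : Fin 2) : B.localPair.p₀ α = B.P α 0 := constantCoeff_taylorSeries _

/-- The nodes of the expansion of the Cauchy kernel. -/
abbrev node (n : ℕ) : ℕ → ℂ := B.localPair.node n

lemma add_conj_node_ne_zero (n : ℕ) {p : ℂ} (hp : 0 < p.re) (l : ℕ) : p + conj (B.node n l) ≠ 0 :=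
  conj_add_ne_zero_of_re_pos hp (B.localPair.node_re_pos n l)

/-- The node list contains each base point `n` times; the factors of the other base point, indexed
by `1 - β`, and the denominators go into `R`. -/
lemma blaschkeFun_node (n : ℕ) (β : Fin 2) : ∃ R : ℂ → ℂ, AnalyticAt ℂ R (B.P β 0) ∧
    ∀ p, blaschkeFun (B.node n) (2 * n) p = (p - B.P β 0) ^ n * R p := by
  have e : ∀ p, ∏ m ∈ Finset.range (2 * n), (p - B.node n m)
      = (p - B.P 0 0) ^ n * (p - B.P 1 0) ^ n := by
    intro p
    rw [two_mul, Finset.prod_range_add]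
    congr 1
    · rw [Finset.prod_congr rfl fun m hm => by
        rw [node, LocalPair.node, if_pos (Finset.mem_range.1 hm), p₀_localPair]]
      simp
    · rw [Finset.prod_congr rfl fun m _ => by
        rw [node, LocalPair.node, if_neg (by omega), p₀_localPair]]
      simp
  have hd : AnalyticAt ℂ (fun p => ∏ m ∈ Finset.range (2 * n), (p + conj (B.node n m)))
      (B.P β 0) := Finset.analyticAt_fun_prod _ fun m _ => by fun_prop
  have hd0 : ∏ m ∈ Finset.range (2 * n), (B.P β 0 + conj (B.node n m)) ≠ 0 :=
    Finset.prod_ne_zero_iff.2 fun m _ => B.add_conj_node_ne_zero n (B.re_pos β) m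
  refine ⟨fun p => (p - B.P (1 - β) 0) ^ n
    / ∏ m ∈ Finset.range (2 * n), (p + conj (B.node n m)), ?_, fun p => ?_⟩
  · exact AnalyticAt.fun_div (by fun_prop) hd hd0
  · rw [blaschkeFun, Finset.prod_div_distrib, e, ← mul_div_assoc]
    congr 1
    fin_cases β
    · rfl
    · exact mul_comm _ _

lemma coeff_weights_mul (α : Fin 2) (x t : ℝ) {F : ℂ → ℂ} (hF : AnalyticAt ℂ F (B.P α 0)) (s : ℕ) :
    coeff s (B.weights.E α x t * taylorSeries fun κ => F (B.P α κ))
      = taylor (fun κ => F (B.P α κ) * B.expFun α x t κ) s := by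
  rw [← coeff_taylorSeries, taylorSeries_mul (hF.fun_comp (B.analytic_P α)) (B.analyticAt_expFun α x t),
    mul_comm]
  rfl

/-- Iterated derivations of a weighted Cauchy kernel, modified by a function of `q`. -/
lemma opPow_opPow_eq_kernel {α β : Fin 2} {T T' φ₁ φ₂ g : ℂ → ℂ} {G : ℂ → ℂ → ℂ} {x t : ℝ}
    (hT : AnalyticAt ℂ T (B.P α 0)) (hTP : ∀ᶠ κ in nhds 0, T (B.P α κ) = deriv (B.P α) κ)
    (hT' : AnalyticAt ℂ T' (B.P β 0)) (hTP' : ∀ᶠ κ in nhds 0, T' (B.P β κ) = deriv (B.P β) κ)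
    (h₁ : AnalyticAt ℂ φ₁ (B.P α 0)) (hE₁ : ∀ᶠ κ in nhds 0, φ₁ (B.P α κ) = B.expFun α x t κ)
    (h₂ : AnalyticAt ℂ φ₂ (B.P β 0)) (hE₂ : ∀ᶠ κ in nhds 0, φ₂ (B.P β κ) = B.expFun β x t κ)
    (hg : AnalyticAt ℂ g (B.P β 0))
    (hG : ∀ p q, 0 < p.re → 0 < q.re →
      G p q = (1 / (p + q) - conjFun g q) * (φ₁ p * conjFun φ₂ q))
    {n j : ℕ} (hj : j < n) (s : ℕ) :
    opPow T s (fun p => opPow (conjFun T') j (G p) (conj (B.P β 0))) (B.P α 0)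
      = B.localPair.kernel n α β (B.weights.E α x t) (conjSeries (B.weights.E β x t)) s j
        - coeff s (B.weights.E α x t)
          * conj (coeff j (B.weights.E β x t * taylorSeries fun κ => g (B.P β κ))) := by
  set z := B.node n with hz
  have hzα : ∀ {p : ℂ}, 0 < p.re → ∀ l, p + conj (z l) ≠ 0 := fun hp =>
    B.add_conj_node_ne_zero n hp
  have hzq : ∀ {q : ℂ}, 0 < q.re → ∀ l, q + z l ≠ 0 := fun {q} hq l h => by
    refine hzα (p := conj q) (by simpa using hq) l ?_
    rw [← map_add, h, map_zero]
  obtain ⟨R, hR, hRe⟩ := B.blaschkeFun_node n β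
  rw [← hz] at hRe
  have hβ : 0 < (conj (B.P β 0)).re := by simpa using B.re_pos β
  -- The index `none` carries the rank one correction by `g`, the indices `some l` the terms of the
  -- Cauchy expansion.
  have key := opPow_opPow_of_separable (ι := Option (Fin (2 * n)))
    (A := fun o => o.elim (fun p => -φ₁ p)
      fun l p => (z l + conj (z l)) * (tmFun z l p * φ₁ p))
    (B := fun o => o.elim (fun p => g p * φ₂ p) fun l p => tmFun z l p * φ₂ p)
    (G := G) (n := n) (j := j)
    (B.analytic_P α) rfl hT hTP (B.analytic_P β) rfl hT' hTP' ?_ ?_ hj ?_ s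
  · rw [key, Fintype.sum_option, add_comm, sub_eq_add_neg]
    simp only [Option.elim]
    congr 1
    · rw [LocalPair.kernel, cauchyKernel, Finset.sum_range]
      refine Finset.sum_congr rfl fun l _ => ?_
      rw [← map_mul conjSeries, coeff_conjSeries]
      change _ = (z l + conj (z l)) * coeff s (B.weights.E α x t * tmBasis z z (taylorSeries (B.P α)) l)
        * conj (coeff j (B.weights.E β x t * tmBasis z z (taylorSeries (B.P β)) l))
      rw [← taylorSeries_tmFun (B.analytic_P α) (hzα (B.re_pos α)),
        ← taylorSeries_tmFun (B.analytic_P β) (hzα (B.re_pos β)),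
        B.coeff_weights_mul α x t (analyticAt_tmFun (hzα (B.re_pos α)) l),
        B.coeff_weights_mul β x t (analyticAt_tmFun (hzα (B.re_pos β)) l)]
      congr 1
      · rw [← coeff_taylorSeries, taylorSeries_const_mul, coeff_C_mul, coeff_taylorSeries]
        congr 1
        exact taylor_congr (hE₁.mono fun κ hκ => by simp only [hκ]) s
      · congr 1
        exact taylor_congr (hE₂.mono fun κ hκ => by simp only [hκ]) j
    · rw [B.coeff_weights_mul β x t hg, ← neg_mul]
      congr 1
      · change _ = -coeff s (taylorSeries (B.expFun α x t))
        rw [← neg_one_mul, ← coeff_C_mul, ← taylorSeries_const_mul, coeff_taylorSeries]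
        exact taylor_congr (hE₁.mono fun κ hκ => by simp only [hκ, neg_one_mul]) s
      · congr 1
        exact taylor_congr (hE₂.mono fun κ hκ => by simp only [hκ]) j
  · rintro (_ | l)
    · exact h₁.neg
    · exact analyticAt_const.mul ((analyticAt_tmFun (hzα (B.re_pos α)) l).mul h₁)
  · rintro (_ | l)
    · exact hg.mul h₂
    · exact (analyticAt_tmFun (hzα (B.re_pos β)) l).mul h₂
  · filter_upwards [eventually_re_pos (B.re_pos α)] with p hp
    have hR' : AnalyticAt ℂ (conjFun R) (conj (B.P β 0)) := analyticAt_conjFun (by simpa using hR)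
    have hφ' : AnalyticAt ℂ (conjFun φ₂) (conj (B.P β 0)) := analyticAt_conjFun (by simpa using h₂)
    have hpq := conj_add_ne_zero_of_re_pos hp (B.re_pos β)
    refine ⟨fun q => blaschkeFun z (2 * n) p * conjFun R q / (p + q) * (φ₁ p * conjFun φ₂ q), ?_, ?_⟩
    · fun_prop (disch := assumption)
    · filter_upwards [eventually_re_pos hβ] with q hq
      have hpq' : p + q ≠ 0 := by
        simpa using conj_add_ne_zero_of_re_pos (q := conj q) hp (by simpa using hq)
      rw [hG p q hp hq, one_div_add_expansion hpq' (hzα hp) (hzq hq) (2 * n), Fintype.sum_option]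
      have hb : conjFun (blaschkeFun z (2 * n)) q = (q - conj (B.P β 0)) ^ n * conjFun R q := by
        simp only [conjFun, hRe, map_mul, map_pow, map_sub, Complex.conj_conj]
      have hm : ∀ (F F' : ℂ → ℂ) q, conjFun (fun p => F p * F' p) q = conjFun F q * conjFun F' q :=
        fun F F' q => by simp [conjFun]
      simp only [Option.elim, hm, hb, Finset.sum_range]
      have hs : ∑ l : Fin (2 * n), (z l + conj (z l)) * (tmFun z l p * φ₁ p)
            * (conjFun (tmFun z l) q * conjFun φ₂ q)
          = (∑ l : Fin (2 * n), (z l + conj (z l)) * tmFun z l p * conjFun (tmFun z l) q)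
            * (φ₁ p * conjFun φ₂ q) := by
        rw [Finset.sum_mul]
        exact Finset.sum_congr rfl fun l _ => by ring
      rw [hs]
      ring

end BranchPair

end

/-! ### Rogue waves in differential operator form -/

section

open PowerSeries Filter Topology

/-- The rows of the two blocks. -/
def rowEquiv (N : Fin 2 → ℕ) : Fin (N 0) ⊕ Fin (N 1) ≃ LocalPair.Row N where
  toFun := Sum.elim (fun i => ⟨0, i⟩) (fun i => ⟨1, i⟩)
  invFun i := match i with
    | ⟨0, i⟩ => Sum.inl i
    | ⟨1, i⟩ => Sum.inr i
  left_inv i := by rcases i with i | i <;> rfl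
  right_inv i := by
    obtain ⟨α, i⟩ := i
    fin_cases α <;> rfl

lemma blockDet_eq_det (N : Fin 2 → ℕ) (m : Fin 2 → Fin 2 → ℕ → ℕ → ℂ) :
    blockDet N m
      = (Matrix.of fun i j : LocalPair.Row N => m i.1 j.1 i.idx j.idx).det := by
  rw [← Matrix.det_submatrix_equiv_self (rowEquiv N), blockDet]
  congr 1
  ext i j
  rcases i with i | i <;> rcases j with j | j <;> rfl

/-- Convergence at one `z ≠ 0` bounds `a r z^r`, hence gives the shifted series a positive radius;
the sum in question is `w` times that series. -/
lemma analyticAt_tsum_pow {a : ℕ → ℂ} (h : ∃ z : ℂ, z ≠ 0 ∧ Summable fun r : ℕ => a r * z ^ r) :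
    AnalyticAt ℂ (fun w => ∑' r : ℕ, a (r + 1) * w ^ (r + 1)) 0 := by
  obtain ⟨z, hz, hs⟩ := h
  obtain ⟨K, hK⟩ := hs.tendsto_atTop_zero.norm.bddAbove_range
  have hK : ∀ r, ‖a r‖ * ‖z‖ ^ r ≤ K := fun r => by
    rw [← norm_pow, ← norm_mul]; exact hK ⟨r, rfl⟩
  set b : ℕ → ℂ := fun r => a (r + 1) with hb
  set p := FormalMultilinearSeries.ofScalars ℂ b with hp
  have hr : 0 < p.radius := by
    refine lt_of_lt_of_le ?_ (p.le_radius_of_bound (K / ‖z‖) (r := ‖z‖₊) fun r => ?_)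
    · exact_mod_cast nnnorm_pos.2 hz
    · rw [hp, FormalMultilinearSeries.ofScalars_norm, le_div_iff₀ (norm_pos_iff.2 hz), coe_nnnorm,
        mul_assoc, ← pow_succ]
      exact hK (r + 1)
  have hsum : AnalyticAt ℂ p.sum 0 := (p.hasFPowerSeriesOnBall hr).analyticAt
  have e : (fun w => ∑' r : ℕ, a (r + 1) * w ^ (r + 1)) = fun w => w * p.sum w := by
    funext w
    have := FormalMultilinearSeries.ofScalars_sum_eq b w
    rw [FormalMultilinearSeries.ofScalarsSum, ← hp] at this
    rw [this, ← tsum_mul_left]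
    refine tsum_congr fun r => ?_
    rw [smul_eq_mul, hb, pow_succ]
    ring
  rw [e]
  exact analyticAt_id.fun_mul hsum

section OperatorForm

variable {c : Params} {p₀ : Fin 2 → ℂ} {N : Fin 2 → ℕ}

lemma genFun_zero_zero (W W' : ℂ → ℂ) (a a' : ℕ → ℂ) (x t : ℝ) (p q : ℂ) :
    genFun c W W' a a' 0 0 x t p q = (1 / (p + q) - conjFun (fun _ => 0) q)
      * (Complex.exp (xi W a x t p) * conjFun (fun p => Complex.exp (xi W' a' x t p)) q) := by
  simp [genFun, conjFun, Complex.exp_add, ← Complex.exp_conj]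

/-- Partial fractions: the shift in `n` or `k` changes the kernel by a function of `q` alone, hence
the Gram matrix by a rank one term. -/
lemma kernel_shift {p q : ℂ} (hp : 0 < p.re) (hq : 0 < q.re) (k : ℝ) :
    1 / (p + q) * -((p - Complex.I * k) / (q + Complex.I * k))
      = 1 / (p + q) - conjFun (fun p => 1 / (p - Complex.I * k)) q := by
  have h1 : p + q ≠ 0 := by
    simpa using conj_add_ne_zero_of_re_pos (q := conj q) hp (by simpa using hq)
  have h2 : q + Complex.I * k ≠ 0 := by
    simpa using sub_I_mul_ne_zero hq (-k)
  have e : conjFun (fun p => 1 / (p - Complex.I * k)) q = 1 / (q + Complex.I * k) := by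
    simp [conjFun]
  rw [e]
  field_simp
  ring

lemma genFun_one_zero (W W' : ℂ → ℂ) (a a' : ℕ → ℂ) (x t : ℝ) {p q : ℂ} (hp : 0 < p.re)
    (hq : 0 < q.re) :
    genFun c W W' a a' 1 0 x t p q
      = (1 / (p + q) - conjFun (fun p => 1 / (p - Complex.I * c.k₁)) q)
      * (Complex.exp (xi W a x t p) * conjFun (fun p => Complex.exp (xi W' a' x t p)) q) := by
  rw [← kernel_shift hp hq]
  simp [genFun, conjFun, Complex.exp_add, ← Complex.exp_conj]

lemma genFun_zero_one (W W' : ℂ → ℂ) (a a' : ℕ → ℂ) (x t : ℝ) {p q : ℂ} (hp : 0 < p.re)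
    (hq : 0 < q.re) :
    genFun c W W' a a' 0 1 x t p q
      = (1 / (p + q) - conjFun (fun p => 1 / (p - Complex.I * c.k₂)) q)
      * (Complex.exp (xi W a x t p) * conjFun (fun p => Complex.exp (xi W' a' x t p)) q) := by
  rw [← kernel_shift hp hq]
  simp [genFun, conjFun, Complex.exp_add, ← Complex.exp_conj]

/-- A pair of branches of `p(κ)` with phases. -/
def branchPair (hre : ∀ α, 0 < (p₀ α).re) (hne : p₀ 0 ≠ p₀ 1)
    (hroot : ∀ α, IsSimpleRoot c (p₀ α)) {P a : Fin 2 → ℂ → ℂ}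
    (hP : ∀ α, IsBranchP c (p₀ α) (P α)) (ha : ∀ α, AnalyticAt ℂ (a α) 0) : BranchPair where
  P := P
  a := a
  analytic_P α := (hP α).1
  analytic_a := ha
  re_pos α := (hP α).re_pos (hre α)
  ne := by rw [(hP 0).2.1, (hP 1).2.1]; exact hne
  deriv_ne_zero α := (hP α).deriv_ne_zero (hre α) (hroot α)

lemma BranchPair.resolvent_localPair (B : BranchPair) (k : ℝ) (α : Fin 2) :
    B.localPair.resolvent k α
      = taylorSeries fun κ => (fun p => 1 / (p - Complex.I * k)) (B.P α κ) := by
  have h := sub_I_mul_ne_zero (B.re_pos α) k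
  simp only [one_div]
  rw [taylorSeries_inv ((B.analytic_P α).fun_sub analyticAt_const) h,
    taylorSeries_sub (B.analytic_P α) analyticAt_const, taylorSeries_const]
  rfl

/-- The rogue waves in differential operator form. -/
theorem isBoundedRogueWave_tauOp (hre : ∀ α, 0 < (p₀ α).re) (hne : p₀ 0 ≠ p₀ 1)
    (hroot : ∀ α, IsSimpleRoot c (p₀ α)) {T W : Fin 2 → ℂ → ℂ} {a : Fin 2 → ℕ → ℂ}
    (hT : ∀ α, IsBranchT c (p₀ α) (T α)) (hW : ∀ α, IsBranchW c (p₀ α) (W α))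
    (ha : ∀ α, ∃ z : ℂ, z ≠ 0 ∧ Summable fun r : ℕ => a α r * z ^ r) :
    IsBoundedRogueWave c (tauOp c p₀ N T W a) := by
  -- The branch of `p(κ)` is adapted to the sign of `T`; the independent sign of `W` is then
  -- absorbed in the phase through `e`.
  choose P hP hTP using fun α => (hT α).exists_branchP (hre α) (hroot α)
  choose e he using fun α => (hW α).exists_log (hre α) (hroot α) (hP α)
  have hf := fun α => analyticAt_tsum_pow (ha α)
  have hphase : ∀ α, AnalyticAt ℂ (fun κ => ∑' r : ℕ, a α (r + 1) * (e α * κ) ^ (r + 1)) 0 :=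
    fun α => AnalyticAt.fun_comp (g := fun w => ∑' r : ℕ, a α (r + 1) * w ^ (r + 1))
      (f := fun κ => e α * κ) (by simpa using hf α) (by fun_prop)
  set B := branchPair hre hne hroot hP hphase with hB
  have hP0 : ∀ α, B.P α 0 = p₀ α := fun α => (hP α).2.1
  have hlog : ∀ α, AnalyticAt ℂ (fun p => Complex.log (W α p)) (p₀ α) := fun α =>
    (hW α).1.clog (by rw [(hW α).2.1]; exact Complex.one_mem_slitPlane)
  have hξ : ∀ α x t, AnalyticAt ℂ (fun p => Complex.exp (xi (W α) (a α) x t p)) (B.P α 0) := by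
    intro α x t
    rw [hP0]
    have h1 : AnalyticAt ℂ (fun p => ∑' r : ℕ, a α (r + 1) * Complex.log (W α p) ^ (r + 1)) (p₀ α) :=
      AnalyticAt.fun_comp (g := fun w => ∑' r : ℕ, a α (r + 1) * w ^ (r + 1))
        (f := fun p => Complex.log (W α p))
        (by rw [(hW α).2.1, Complex.log_one]; exact hf α) (hlog α)
    unfold xi
    fun_prop
  have hE : ∀ α x t, ∀ᶠ κ in nhds 0,
      Complex.exp (xi (W α) (a α) x t (B.P α κ)) = B.expFun α x t κ := by
    intro α x t
    filter_upwards [he α] with κ hκ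
    change Complex.exp (xi (W α) (a α) x t (P α κ)) = _
    rw [xi, hκ]
    rfl
  have hres : ∀ (k : ℝ) (β : Fin 2), AnalyticAt ℂ (fun p => 1 / (p - Complex.I * k)) (B.P β 0) := by
    intro k β
    have := sub_I_mul_ne_zero (B.re_pos β) k
    fun_prop (disch := assumption)
  have hodd : ∀ α r, Odd r → coeff r (B.localPair.qSeries c α) = 0 := fun α r hr =>
    (hP α).coeff_odd (hre α) hr
  have hT' : ∀ α, AnalyticAt ℂ (T α) (B.P α 0) := fun α => by rw [hP0]; exact (hT α).1
  -- In this form the determinants coincide with those of the Gram flow, so the gauge is trivial.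
  refine (B.weights_reduces N).isBoundedRogueWave hodd ⟨0, 0, 0, 1, 1, by simp, by simp,
    fun x t => ⟨?_, ?_, ?_⟩⟩
  all_goals
    simp only [zero_mul, add_zero, Real.exp_zero, Complex.ofReal_one, one_mul, tauOp]
    rw [blockDet_eq_det]
    congr 1
    ext i j
    simp only [Matrix.of_apply, mOp, ← hP0, Matrix.sub_apply]
  · rw [B.opPow_opPow_eq_kernel (hT' _) (hTP _) (hT' _) (hTP _) (hξ _ x t) (hE _ x t) (hξ _ x t)
      (hE _ x t) analyticAt_const (fun p q _ _ => genFun_zero_zero _ _ _ _ x t p q) j.idx_lt]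
    simp [taylorSeries_const, LocalPair.Weights.gramFlow]
  · rw [B.opPow_opPow_eq_kernel (hT' _) (hTP _) (hT' _) (hTP _) (hξ _ x t) (hE _ x t) (hξ _ x t)
      (hE _ x t) (hres _ _) (fun p q hp hq => genFun_one_zero _ _ _ _ x t hp hq) j.idx_lt,
      ← B.resolvent_localPair]
    simp [LocalPair.Weights.gramFlow, outer, LocalPair.Weights.vec, LocalPair.Weights.reduction]
  · rw [B.opPow_opPow_eq_kernel (hT' _) (hTP _) (hT' _) (hTP _) (hξ _ x t) (hE _ x t) (hξ _ x t)
      (hE _ x t) (hres _ _) (fun p q hp hq => genFun_zero_one _ _ _ _ x t hp hq) j.idx_lt,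
      ← B.resolvent_localPair]
    simp [LocalPair.Weights.gramFlow, outer, LocalPair.Weights.vec, LocalPair.Weights.reduction]

end OperatorForm

end

/-! ### Schur matrix elements as coefficients of the Cauchy kernel -/

section

open PowerSeries Filter Topology

section SchurForm

variable {c : Params} {P P' : ℂ → ℂ}

/-- The generating function of the Schur form without the factors depending on both base points. -/
def schurWeight (c : Params) (P f : ℂ → ℂ) (n k : ℤ) (x t : ℝ) (κ : ℂ) : ℂ :=
  Complex.exp ((P κ - P 0) * x - Complex.I * (P κ ^ 2 - P 0 ^ 2) * t + f κ)
    * ((P κ - Complex.I * c.k₁) / (P 0 - Complex.I * c.k₁)) ^ n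
    * ((P κ - Complex.I * c.k₂) / (P 0 - Complex.I * c.k₂)) ^ k

lemma lamCoeff_one (P : ℂ → ℂ) : lamCoeff P 1 = deriv P 0 := by
  rw [lamCoeff, taylor_one_right, deriv_sub_const]

lemma analyticAt_dslope (hP : AnalyticAt ℂ P 0) : AnalyticAt ℂ (dslope P 0) 0 := by
  obtain ⟨p, hp⟩ := hP
  exact ⟨_, hp.has_fpower_series_dslope_fslope⟩

lemma mul_dslope_zero (P : ℂ → ℂ) (κ : ℂ) : κ * dslope P 0 κ = P κ - P 0 := by
  have := sub_smul_dslope P 0 κ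
  simpa using this

lemma analyticAt_log_div {F : ℂ → ℂ} (hF : AnalyticAt ℂ F 0) (h0 : F 0 ≠ 0) :
    AnalyticAt ℂ (fun κ => Complex.log (F κ / F 0)) 0 :=
  (hF.fun_div analyticAt_const h0).clog (by rw [div_self h0]; exact Complex.one_mem_slitPlane)

lemma exp_int_mul_log_div {F : ℂ → ℂ} (hF : AnalyticAt ℂ F 0) (h0 : F 0 ≠ 0) (n : ℤ) :
    ∀ᶠ κ in nhds 0, Complex.exp (n * Complex.log (F κ / F 0)) = (F κ / F 0) ^ n := by
  filter_upwards [hF.continuousAt.eventually_ne h0] with κ hκ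
  rw [Complex.exp_int_mul, Complex.exp_log (div_ne_zero hκ h0)]

/-- The Schur polynomials of the vectors `x^+ + ν s` as Taylor coefficients. -/
lemma schur_xPlus (hP : AnalyticAt ℂ P 0) (hP0 : 0 < (P 0).re) (hP0' : 0 < (P' 0).re)
    (hd : deriv P 0 ≠ 0) {f : ℂ → ℂ} (hf : AnalyticAt ℂ f 0) (hf0 : f 0 = 0) {a : ℕ → ℂ} {m : ℕ}
    (hfa : ∀ r, 1 ≤ r → r ≤ m → taylor f r = a r) (n k : ℤ) (x t : ℝ) (ν : ℕ) :
    schur m (fun r => xPlus c P P' a n k x t r + ν * sCoeff P P' r)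
      = taylor (fun κ => schurWeight c P f n k x t κ
        * ((P 0 + conj (P' 0)) / (P κ + conj (P' 0)))
        * ((P 0 + conj (P' 0)) / deriv P 0 * (dslope P 0 κ / (P κ + conj (P' 0)))) ^ ν) m := by
  have hc := conj_add_ne_zero_of_re_pos hP0 hP0'
  have h1 := sub_I_mul_ne_zero hP0 c.k₁
  have h2 := sub_I_mul_ne_zero hP0 c.k₂
  have hD := analyticAt_dslope hP
  have hk : ∀ k : ℝ, AnalyticAt ℂ (fun κ => P κ - Complex.I * k) 0 := fun k => by fun_prop
  have hb : AnalyticAt ℂ (fun κ => P κ + conj (P' 0)) 0 := by fun_prop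
  have hs : AnalyticAt ℂ (fun κ => (P 0 + conj (P' 0)) / deriv P 0
      * (dslope P 0 κ / (P κ + conj (P' 0)))) 0 := by fun_prop (disch := assumption)
  have hs0 : (P 0 + conj (P' 0)) / deriv P 0 * (dslope P 0 0 / (P 0 + conj (P' 0))) = 1 := by
    rw [dslope_same]; field_simp
  set θ₁ : ℂ → ℂ := fun κ => Complex.log ((P κ - Complex.I * c.k₁) / (P 0 - Complex.I * c.k₁))
  set θ₂ : ℂ → ℂ := fun κ => Complex.log ((P κ - Complex.I * c.k₂) / (P 0 - Complex.I * c.k₂))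
  set b : ℂ → ℂ := fun κ => Complex.log ((P κ + conj (P' 0)) / (P 0 + conj (P' 0)))
  set σ' : ℂ → ℂ := fun κ => Complex.log ((P 0 + conj (P' 0)) / deriv P 0
      * (dslope P 0 κ / (P κ + conj (P' 0))))
  have hθ₁ : AnalyticAt ℂ θ₁ 0 := analyticAt_log_div (hk c.k₁) h1
  have hθ₂ : AnalyticAt ℂ θ₂ 0 := analyticAt_log_div (hk c.k₂) h2
  have hba : AnalyticAt ℂ b 0 := analyticAt_log_div hb hc
  have hσ : AnalyticAt ℂ σ' 0 := hs.clog (by rw [hs0]; exact Complex.one_mem_slitPlane)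
  -- `F` is the function whose Taylor coefficients are `x^+ + ν s`; its exponential is the product
  -- of rational factors, the logarithms disappearing.
  set F : ℂ → ℂ := fun κ => (x : ℂ) * (P κ - P 0) + (-Complex.I * t) * (P κ ^ 2 - P 0 ^ 2)
    + n * θ₁ κ + k * θ₂ κ + (-1) * b κ + f κ + ν * σ' κ with hF
  have hFa : AnalyticAt ℂ F 0 := by fun_prop
  have hF0 : F 0 = 0 := by
    simp only [hF, θ₁, θ₂, b, σ', hs0, div_self h1, div_self h2, div_self hc, hf0]
    simp
  have hFt : ∀ r, 1 ≤ r → r ≤ m →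
      xPlus c P P' a n k x t r + ν * sCoeff P P' r = taylor F r := by
    intro r hr hrm
    rw [← coeff_taylorSeries, hF]
    rw [taylorSeries_add (by fun_prop) (by fun_prop), taylorSeries_add (by fun_prop) (by fun_prop),
      taylorSeries_add (by fun_prop) (by fun_prop), taylorSeries_add (by fun_prop) (by fun_prop),
      taylorSeries_add (by fun_prop) (by fun_prop), taylorSeries_add (by fun_prop) (by fun_prop)]
    simp only [taylorSeries_const_mul, map_add, coeff_C_mul, coeff_taylorSeries, hfa r hr hrm]
    rw [xPlus, sCoeff, lamCoeff_one]
    simp only [lamCoeff, betaCoeff, thetaCoeff, bCoeff, θ₁, θ₂, b, σ']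
    ring
  rw [schur_congr hFt, schur_taylor hFa hF0]
  refine taylor_congr ?_ m
  have hPt := hP.continuousAt.tendsto
  filter_upwards [exp_int_mul_log_div (hk c.k₁) h1 n, exp_int_mul_log_div (hk c.k₂) h2 k,
    hb.continuousAt.eventually_ne hc, hs.continuousAt.eventually_ne (by rw [hs0]; exact one_ne_zero)]
    with κ e1 e2 e3 e4
  have e : F κ = ((P κ - P 0) * x - Complex.I * (P κ ^ 2 - P 0 ^ 2) * t + f κ)
      + n * θ₁ κ + k * θ₂ κ + -b κ + ν * σ' κ := by simp only [hF]; ring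
  rw [e, Complex.exp_add, Complex.exp_add, Complex.exp_add, Complex.exp_add, Complex.exp_neg,
    Complex.exp_nat_mul, e1, e2]
  simp only [b, σ']
  rw [Complex.exp_log (div_ne_zero e3 hc), Complex.exp_log e4, inv_div]
  rfl

/-- Up to conjugation, `x^-` is `x^+` with the base points exchanged and `n`, `k` negated, so the
analysis of `x^+` covers both. -/
lemma conj_xMinus (a' : ℕ → ℂ) (n k : ℤ) (x t : ℝ) (ν r : ℕ) :
    xMinus c P P' a' n k x t r + ν * conj (sCoeff P' P r)
      = conj (xPlus c P' P a' (-n) (-k) x t r + ν * sCoeff P' P r) := by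
  simp only [xMinus, xPlus, map_add, map_sub, map_mul, map_natCast, Complex.conj_ofReal,
    Complex.conj_I, map_intCast]
  push_cast
  ring

lemma tmBasis_const (z z' : ℂ) (p : PowerSeries ℂ) (l : ℕ) :
    tmBasis (fun _ => z) (fun _ => z') p l
      = ((p - C z) * (p + C (conj z'))⁻¹) ^ l * (p + C (conj z'))⁻¹ := by
  rw [tmBasis, blaschke, Finset.prod_const, Finset.card_range]

lemma analyticAt_schurWeight (hP : AnalyticAt ℂ P 0) (hP0 : 0 < (P 0).re) {f : ℂ → ℂ}
    (hf : AnalyticAt ℂ f 0) (n k : ℤ) (x t : ℝ) : AnalyticAt ℂ (schurWeight c P f n k x t) 0 := by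
  have h : ∀ (k : ℝ) (n : ℤ),
      AnalyticAt ℂ (fun κ => ((P κ - Complex.I * k) / (P 0 - Complex.I * k)) ^ n) 0 := by
    intro k n
    have h1 := sub_I_mul_ne_zero hP0 k
    have : AnalyticAt ℂ (fun κ => (P κ - Complex.I * k) / (P 0 - Complex.I * k)) 0 := by
      fun_prop (disch := assumption)
    exact this.fun_zpow (by rw [div_self h1]; exact one_ne_zero)
  have h1 := h c.k₁ n
  have h2 := h c.k₂ k
  unfold schurWeight
  fun_prop

/-- Multiplication by `κ^ν` turns `dslope` into `P - P 0` and shifts the coefficient from `s - ν` to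
`s`; the result is a Takenaka-Malmquist function with all zeros at `P 0` and all poles at `-conj (P'
0)`. -/
lemma taylor_schurWeight_mul (hP : AnalyticAt ℂ P 0) (hP0 : 0 < (P 0).re) (hP0' : 0 < (P' 0).re)
    {f : ℂ → ℂ} (hf : AnalyticAt ℂ f 0) (n k : ℤ) (x t : ℝ) {s ν : ℕ} (hν : ν ≤ s) :
    taylor (fun κ => schurWeight c P f n k x t κ
        * ((P 0 + conj (P' 0)) / (P κ + conj (P' 0)))
        * ((P 0 + conj (P' 0)) / deriv P 0 * (dslope P 0 κ / (P κ + conj (P' 0)))) ^ ν) (s - ν)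
      = (P 0 + conj (P' 0)) * ((P 0 + conj (P' 0)) / deriv P 0) ^ ν
        * coeff s (taylorSeries (schurWeight c P f n k x t)
          * tmBasis (fun _ => P 0) (fun _ => P' 0) (taylorSeries P) ν) := by
  have hc := conj_add_ne_zero_of_re_pos hP0 hP0'
  have hD := analyticAt_dslope hP
  have hU := analyticAt_schurWeight (c := c) hP hP0 hf n k x t
  set G : ℂ → ℂ := fun κ => schurWeight c P f n k x t κ
        * ((P 0 + conj (P' 0)) / (P κ + conj (P' 0)))
        * ((P 0 + conj (P' 0)) / deriv P 0 * (dslope P 0 κ / (P κ + conj (P' 0)))) ^ ν with hG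
  have hGa : AnalyticAt ℂ G 0 := by
    have h1 : AnalyticAt ℂ (fun κ => dslope P 0 κ / (P κ + conj (P' 0))) 0 := by
      fun_prop (disch := assumption)
    have h2 : AnalyticAt ℂ (fun κ => (P 0 + conj (P' 0)) / (P κ + conj (P' 0))) 0 := by
      fun_prop (disch := assumption)
    exact (hU.fun_mul h2).fun_mul ((analyticAt_const.fun_mul h1).fun_pow ν)
  have h1 : coeff (s - ν) (taylorSeries G) = coeff s (taylorSeries fun κ => κ ^ ν * G κ) := by
    have hid : AnalyticAt ℂ (fun κ : ℂ => κ) 0 := analyticAt_id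
    rw [taylorSeries_mul (hid.fun_pow ν) hGa, taylorSeries_pow hid, taylorSeries_id,
      coeff_X_pow_mul', if_pos hν]
  have e : (fun κ => κ ^ ν * G κ)
      = fun κ => ((P 0 + conj (P' 0)) * ((P 0 + conj (P' 0)) / deriv P 0) ^ ν)
        * (schurWeight c P f n k x t κ
          * (((P κ - P 0) / (P κ + conj (P' 0))) ^ ν * (P κ + conj (P' 0))⁻¹)) := by
    funext κ
    rw [hG, ← mul_dslope_zero P κ]
    simp only [div_eq_mul_inv, mul_pow]
    ring
  have hdiv : AnalyticAt ℂ (fun κ => (P κ - P 0) / (P κ + conj (P' 0))) 0 := by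
    fun_prop (disch := assumption)
  have hinv : AnalyticAt ℂ (fun κ => (P κ + conj (P' 0))⁻¹) 0 := by fun_prop (disch := assumption)
  rw [← coeff_taylorSeries, h1, e, taylorSeries_const_mul, coeff_C_mul,
    taylorSeries_mul hU ((hdiv.fun_pow ν).fun_mul hinv), taylorSeries_mul (hdiv.fun_pow ν) hinv,
    taylorSeries_pow hdiv, taylorSeries_div (by fun_prop) (by fun_prop) hc,
    taylorSeries_inv (by fun_prop) hc, taylorSeries_sub hP analyticAt_const,
    taylorSeries_add hP analyticAt_const, taylorSeries_const, taylorSeries_const, tmBasis_const]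

/-- The entries of the Schur form as coefficients of a weighted Cauchy kernel. -/
lemma mSchur_eq_cauchyKernel (hP : AnalyticAt ℂ P 0) (hP0 : 0 < (P 0).re) (hd : deriv P 0 ≠ 0)
    (hP' : AnalyticAt ℂ P' 0) (hP0' : 0 < (P' 0).re) (hd' : deriv P' 0 ≠ 0)
    {f f' : ℂ → ℂ} (hf : AnalyticAt ℂ f 0) (hf0 : f 0 = 0) (hf' : AnalyticAt ℂ f' 0)
    (hf0' : f' 0 = 0) {a a' : ℕ → ℂ} {L : ℕ} (hfa : ∀ r, 1 ≤ r → r < L → taylor f r = a r)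
    (hfa' : ∀ r, 1 ≤ r → r < L → taylor f' r = a' r) (n k : ℤ) (x t : ℝ) {s j : ℕ}
    (hs : s < L) (hj : j < L) :
    mSchur c P P' a a' n k x t s j
      = cauchyKernel (fun _ => P 0) (fun _ => P' 0) L (taylorSeries P) (taylorSeries P')
        (taylorSeries (schurWeight c P f n k x t))
        (conjSeries (taylorSeries (schurWeight c P' f' (-n) (-k) x t))) s j := by
  have hc := conj_add_ne_zero_of_re_pos hP0 hP0'
  have hdvd : ∀ (z z' : ℂ) (p : PowerSeries ℂ) (ν : ℕ), constantCoeff p = z →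
      X ^ ν ∣ tmBasis (fun _ => z) (fun _ => z') p ν := by
    intro z z' p ν hp
    rw [tmBasis_const, mul_pow, mul_assoc]
    exact (pow_dvd_pow_of_dvd (X_dvd_iff.2 (by simp [hp])) ν).mul_right _
  rw [cauchyKernel, mSchur]
  -- The `ν`-th basis function has order at least `ν` at the base point, so extending the sum beyond
  -- `min s j` adds only zeros.
  have hsub : Finset.range (min s j + 1) ⊆ Finset.range L := by
    intro ν; simp only [Finset.mem_range]; omega
  rw [← Finset.sum_subset hsub]
  · refine Finset.sum_congr rfl fun ν hν => ?_
    rw [Finset.mem_range, Nat.lt_succ_iff, le_min_iff] at hν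
    rw [schur_xPlus hP hP0 hP0' hd hf hf0 (fun r hr hr' => hfa r hr (by omega)),
      taylor_schurWeight_mul hP hP0 hP0' hf n k x t hν.1]
    simp only [conj_xMinus]
    rw [← conj_schur, schur_xPlus hP' hP0' hP0 hd' hf' hf0' (fun r hr hr' => hfa' r hr (by omega)),
      taylor_schurWeight_mul hP' hP0' hP0 hf' (-n) (-k) x t hν.2, ← map_mul conjSeries,
      coeff_conjSeries, lamCoeff_one, lamCoeff_one]
    generalize coeff (R := ℂ) s _ = u
    generalize coeff (R := ℂ) j _ = v
    have h3 : conj (deriv P' 0) ≠ 0 := by simpa using hd'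
    simp only [map_mul, map_add, map_pow, map_div₀, Complex.conj_conj]
    rw [add_comm (conj (P' 0)) (P 0)]
    generalize P 0 + conj (P' 0) = w at hc
    have e : (deriv P 0 * conj (deriv P' 0) / w ^ 2) ^ ν * (w / deriv P 0) ^ ν
        * (w / conj (deriv P' 0)) ^ ν = 1 := by
      rw [← mul_pow, ← mul_pow]
      have : deriv P 0 * conj (deriv P' 0) / w ^ 2 * (w / deriv P 0)
          * (w / conj (deriv P' 0)) = 1 := by field_simp
      rw [this, one_pow]
    have e' : 1 / w * w = 1 := one_div_mul_cancel hc
    linear_combination (u * conj v * w * (1 / w * w)) * e + u * conj v * w * e'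
  · intro ν _ hν
    rw [Finset.mem_range, Nat.lt_succ_iff, le_min_iff, not_and_or, not_le, not_le] at hν
    rcases hν with hν | hν
    · rw [mul_comm (taylorSeries _),
        coeff_mul_eq_zero_of_X_pow_dvd hν (hdvd _ _ _ _ (constantCoeff_taylorSeries P)), mul_zero,
        zero_mul]
    · rw [← map_mul conjSeries, coeff_conjSeries,
        mul_comm (taylorSeries (schurWeight c P' f' _ _ _ _)),
        coeff_mul_eq_zero_of_X_pow_dvd hν (hdvd _ _ _ _ (constantCoeff_taylorSeries P')), map_zero,
        mul_zero]

end SchurForm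

end

/-! ### Rogue waves in Schur polynomial form -/

section

open PowerSeries Filter Topology

lemma det_scale {ι : Type*} [Fintype ι] [DecidableEq ι] (u v : ι → ℂ) (X : Matrix ι ι ℂ) :
    (Matrix.of fun i j => u i * v j * X i j).det = (∏ i, u i * v i) * X.det := by
  have e : (Matrix.of fun i j => u i * v j * X i j)
      = Matrix.diagonal u * X * Matrix.diagonal v := by
    ext i j
    rw [Matrix.mul_diagonal, Matrix.diagonal_mul, Matrix.of_apply]
    ring
  rw [e, Matrix.det_mul, Matrix.det_mul, Matrix.det_diagonal, Matrix.det_diagonal,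
    Finset.prod_mul_distrib]
  ring

/-- With `q = p^*`, this is `p - i k = (p + q) - (q + i k)`. Compared with `v₀ χ^*` subtracted from
`M` the sign is reversed, which is the source of the minus sign in the unimodular factors. -/
lemma LocalPair.kernel_sub_resolvent (S : LocalPair) (n : ℕ) (k : ℝ) (α β : Fin 2)
    (U V : PowerSeries ℂ) {s : ℕ} (hs : s < n) (j : ℕ) :
    S.kernel n α β ((S.p α - C (Complex.I * k)) * U) (conjSeries (S.resolvent k β) * V) s j
      = coeff s U * coeff j (conjSeries (S.resolvent k β) * V) - S.kernel n α β U V s j := by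
  have h := S.kernel_lyapunov n α β U (conjSeries (S.resolvent k β) * V) hs j
  rw [← mul_assoc (conjSeries (S.p β)), S.conj_p_mul_resolvent, add_mul, one_mul, mul_assoc,
    S.kernel_add_right, S.kernel_C_mul_right] at h
  rw [sub_eq_add_neg, ← map_neg, add_mul, S.kernel_add_left, S.kernel_C_mul_left]
  linear_combination h

section SchurWave

variable {c : Params} {N : Fin 2 → ℕ} (B : BranchPair)

namespace BranchPair

/-- The exponential at the base point. -/
def base (α : Fin 2) (x t : ℝ) : ℂ :=
  Complex.exp (B.P α 0 * x - Complex.I * B.P α 0 ^ 2 * t)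

lemma base_inv_mul_conj (α : Fin 2) (x t : ℝ) :
    (B.base α x t)⁻¹ * conj (B.base α x t)⁻¹
      = Real.exp (-2 * (B.P α 0).re * x + -2 * (B.P α 0 ^ 2).im * t) := by
  rw [map_inv₀, base, ← Complex.exp_conj, ← Complex.exp_neg, ← Complex.exp_neg, ← Complex.exp_add,
    ← neg_add, Complex.add_conj, Complex.ofReal_exp]
  congr 1
  rw [← Complex.ofReal_neg]
  congr 1
  simp only [Complex.sub_re, Complex.mul_re, Complex.ofReal_re, Complex.ofReal_im, Complex.I_re,
    Complex.I_im, Complex.mul_im]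
  ring

lemma schurWeight_eq (α : Fin 2) (n k : ℤ) (x t : ℝ) :
    schurWeight c (B.P α) (B.a α) n k x t = fun κ => (B.base α x t)⁻¹ * (B.expFun α x t κ
      * ((B.P α κ - Complex.I * c.k₁) / (B.P α 0 - Complex.I * c.k₁)) ^ n
      * ((B.P α κ - Complex.I * c.k₂) / (B.P α 0 - Complex.I * c.k₂)) ^ k) := by
  funext κ
  rw [schurWeight, base, ← Complex.exp_neg, ← mul_assoc, ← mul_assoc, expFun, ← Complex.exp_add]
  congr 3
  ring_nf

lemma taylorSeries_mul_ratio (α : Fin 2) (x t k : ℝ) :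
    taylorSeries (fun κ => B.expFun α x t κ
      * ((B.P α κ - Complex.I * k) / (B.P α 0 - Complex.I * k)))
      = C (B.P α 0 - Complex.I * k)⁻¹
        * ((B.localPair.p α - C (Complex.I * k)) * B.weights.E α x t) := by
  have e : (fun κ => B.expFun α x t κ * ((B.P α κ - Complex.I * k) / (B.P α 0 - Complex.I * k)))
      = fun κ => (B.P α 0 - Complex.I * k)⁻¹ * ((B.P α κ - Complex.I * k) * B.expFun α x t κ) := by
    funext κ; ring
  rw [e, taylorSeries_const_mul, taylorSeries_mul ((B.analytic_P α).fun_sub analyticAt_const)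
    (B.analyticAt_expFun α x t), taylorSeries_sub (B.analytic_P α) analyticAt_const,
    taylorSeries_const]
  rfl

lemma taylorSeries_mul_ratio_inv (α : Fin 2) (x t k : ℝ) :
    taylorSeries (fun κ => B.expFun α x t κ
      * ((B.P α κ - Complex.I * k) / (B.P α 0 - Complex.I * k))⁻¹)
      = C (B.P α 0 - Complex.I * k) * (B.localPair.resolvent k α * B.weights.E α x t) := by
  have h := sub_I_mul_ne_zero (B.re_pos α) k
  have e : (fun κ => B.expFun α x t κ * ((B.P α κ - Complex.I * k) / (B.P α 0 - Complex.I * k))⁻¹)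
      = fun κ => (B.P α 0 - Complex.I * k) * (1 / (B.P α κ - Complex.I * k) * B.expFun α x t κ) := by
    funext κ; rw [inv_div]; ring
  have hP := B.analytic_P α
  rw [e, taylorSeries_const_mul, taylorSeries_mul (by fun_prop (disch := assumption))
    (B.analyticAt_expFun α x t), B.resolvent_localPair]
  rfl

-- The Schur form expands each block with its own nodes, which does not exhibit a Gram matrix. By
-- uniqueness of finite expansions the nodes may be replaced by the list common to all blocks.
variable {B} in
lemma mSchur_eq_kernel (ha0 : ∀ α, B.a α 0 = 0) {a : Fin 2 → ℕ → ℂ}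
    (ha : ∀ α r, 1 ≤ r → r < LocalPair.order N → taylor (B.a α) r = a α r) (n k : ℤ) (x t : ℝ)
    (i j : LocalPair.Row N) :
    mSchur c (B.P i.1) (B.P j.1) (a i.1) (a j.1) n k x t i.idx j.idx
      = B.localPair.kernel (LocalPair.order N) i.1 j.1
        (taylorSeries (schurWeight c (B.P i.1) (B.a i.1) n k x t))
        (conjSeries (taylorSeries (schurWeight c (B.P j.1) (B.a j.1) (-n) (-k) x t)))
        i.idx j.idx := by
  have h0 : ∀ α, constantCoeff (B.localPair.p α) = B.P α 0 := B.p₀_localPair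
  have hc : ∀ α β, B.P α 0 + conj (B.P β 0) ≠ 0 := fun α β =>
    conj_add_ne_zero_of_re_pos (B.re_pos α) (B.re_pos β)
  rw [mSchur_eq_cauchyKernel (B.analytic_P _) (B.re_pos _) (B.deriv_ne_zero _) (B.analytic_P _)
    (B.re_pos _) (B.deriv_ne_zero _) (B.analytic_a _) (ha0 _) (B.analytic_a _) (ha0 _) (ha _) (ha _)
    n k x t i.idx_lt j.idx_lt]
  refine cauchyKernel_unique ?_ ?_ ?_ ?_
    (fun l _ => B.localPair.add_conj_node_ne_zero _ i.1 l)
    (fun l _ => B.localPair.add_conj_node_ne_zero _ j.1 l)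
    (B.localPair.X_pow_dvd_blaschke _ i.1) i.idx_lt _ _
  · rw [h0, h0]; exact hc i.1 j.1
  · rw [h0]; exact fun _ _ => hc i.1 j.1
  · rw [h0]; exact fun _ _ => hc j.1 i.1
  · rw [blaschke, Finset.prod_const, Finset.card_range, mul_pow]
    exact (pow_dvd_pow_of_dvd (X_dvd_iff.2 (by simp [h0])) _).mul_right _

end BranchPair

open BranchPair

lemma norm_prod_neg_conj_div {ι : Type*} [Fintype ι] {z : ι → ℂ} (hz : ∀ i, z i ≠ 0) :
    ‖∏ i, -(conj (z i) / z i)‖ = 1 := by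
  rw [norm_prod]
  refine Finset.prod_eq_one fun i _ => ?_
  rw [norm_neg, norm_div, RCLike.norm_conj, div_self (norm_ne_zero_iff.2 (hz i))]

/-- The gauge factor between the Schur form and the Gram determinant. -/
lemma prod_base (x t : ℝ) :
    ∏ i : LocalPair.Row N, (B.base i.1 x t)⁻¹ * conj (B.base i.1 x t)⁻¹
      = Real.exp ((∑ i : LocalPair.Row N, -2 * (B.P i.1 0).re) * x
        + (∑ i : LocalPair.Row N, -2 * (B.P i.1 0 ^ 2).im) * t + 0) := by
  simp only [base_inv_mul_conj]
  rw [← Complex.ofReal_prod, ← Real.exp_sum, Finset.sum_add_distrib, Finset.sum_mul,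
    Finset.sum_mul, add_zero]

/-- The shifted determinants in Schur form. -/
lemma det_shifted (k x t : ℝ) {m : LocalPair.Row N → LocalPair.Row N → ℂ}
    (hm : ∀ i j, m i j = B.localPair.kernel (LocalPair.order N) i.1 j.1
      (C (B.base i.1 x t)⁻¹ * (C (B.P i.1 0 - Complex.I * k)⁻¹
        * ((B.localPair.p i.1 - C (Complex.I * k)) * B.weights.E i.1 x t)))
      (conjSeries (C (B.base j.1 x t)⁻¹ * (C (B.P j.1 0 - Complex.I * k)
        * (B.localPair.resolvent k j.1 * B.weights.E j.1 x t)))) i.idx j.idx) :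
    (Matrix.of m).det
      = (∏ i : LocalPair.Row N, -(conj (B.P i.1 0 - Complex.I * k) / (B.P i.1 0 - Complex.I * k)))
        * Real.exp ((∑ i : LocalPair.Row N, -2 * (B.P i.1 0).re) * x
          + (∑ i : LocalPair.Row N, -2 * (B.P i.1 0 ^ 2).im) * t + 0)
        * ((B.weights.gramFlow N).M x t - outer ((B.weights.gramFlow N).v 0 x t)
          (B.weights.vec (B.localPair.resolvent k) x t)).det := by
  rw [← prod_base, ← Finset.prod_mul_distrib]
  -- Regroups each gauge factor as one factor for the row and one for the column, as needed by
  -- `det_scale`.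
  have e : ∀ i : LocalPair.Row N,
      -(conj (B.P i.1 0 - Complex.I * k) / (B.P i.1 0 - Complex.I * k))
        * ((B.base i.1 x t)⁻¹ * conj (B.base i.1 x t)⁻¹)
      = -((B.base i.1 x t)⁻¹ * (B.P i.1 0 - Complex.I * k)⁻¹)
        * conj ((B.base i.1 x t)⁻¹ * (B.P i.1 0 - Complex.I * k)) := by
    intro i; rw [map_mul]; ring
  simp only [e]
  rw [← det_scale]
  congr 1
  ext i j
  rw [Matrix.of_apply, Matrix.of_apply, hm]
  simp only [map_mul conjSeries, map_mul (starRingEnd ℂ), PowerSeries.map_C]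
  rw [LocalPair.kernel_C_mul_left, LocalPair.kernel_C_mul_left, LocalPair.kernel_C_mul_right,
    LocalPair.kernel_C_mul_right, LocalPair.kernel_sub_resolvent _ _ _ _ _ _ _ i.idx_lt,
    ← map_mul conjSeries, coeff_conjSeries, mul_comm (B.localPair.resolvent k j.1)]
  simp only [LocalPair.Weights.gramFlow, outer, LocalPair.Weights.vec, Matrix.sub_apply,
    Matrix.of_apply, pow_zero, mul_one]
  ring

end SchurWave

section SchurTheorem

open BranchPair

variable {c : Params} {p₀ : Fin 2 → ℂ} {N : Fin 2 → ℕ}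

/-- The polynomial with coefficients `a r`, `1 ≤ r < L`. -/
def polyPhase (a : ℕ → ℂ) (L : ℕ) (κ : ℂ) : ℂ :=
  ∑ r ∈ Finset.range L, (if r = 0 then 0 else a r) * κ ^ r

lemma analyticAt_polyPhase (a : ℕ → ℂ) (L : ℕ) : AnalyticAt ℂ (polyPhase a L) 0 :=
  Finset.analyticAt_fun_sum _ fun r _ => by fun_prop

lemma polyPhase_zero (a : ℕ → ℂ) (L : ℕ) : polyPhase a L 0 = 0 := by
  refine Finset.sum_eq_zero fun r _ => ?_
  rcases r with _ | r <;> simp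

lemma taylor_polyPhase (a : ℕ → ℂ) {L r : ℕ} (hr : 1 ≤ r) (hrL : r < L) :
    taylor (polyPhase a L) r = a r := by
  have hid : AnalyticAt ℂ (fun κ : ℂ => κ) 0 := analyticAt_id
  rw [← coeff_taylorSeries]
  change coeff r (taylorSeries fun κ => ∑ r ∈ Finset.range L, (if r = 0 then 0 else a r) * κ ^ r) = _
  rw [taylorSeries_sum _ fun r _ => by fun_prop, map_sum, Finset.sum_eq_single r]
  · rw [taylorSeries_const_mul, taylorSeries_pow hid, taylorSeries_id, coeff_C_mul, coeff_X_pow_self,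
      if_neg (by omega), mul_one]
  · intro m _ hm
    rw [taylorSeries_const_mul, taylorSeries_pow hid, taylorSeries_id, coeff_C_mul, coeff_X_pow,
      if_neg (Ne.symm hm), mul_zero]
  · simp [hrL]

/-- The rogue waves in Schur polynomial form. -/
theorem isBoundedRogueWave_tauSchur (hre : ∀ α, 0 < (p₀ α).re) (hne : p₀ 0 ≠ p₀ 1)
    (hroot : ∀ α, IsSimpleRoot c (p₀ α)) {P : Fin 2 → ℂ → ℂ} (a : Fin 2 → ℕ → ℂ)
    (hP : ∀ α, IsBranchP c (p₀ α) (P α)) : IsBoundedRogueWave c (tauSchur c N P a) := by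
  -- The series with coefficients `a r` need not converge, but only indices below `order N` enter,
  -- so a polynomial phase suffices.
  set B := branchPair hre hne hroot hP
    (fun α => analyticAt_polyPhase (a α) (LocalPair.order N)) with hB
  have hodd : ∀ α r, Odd r → coeff r (B.localPair.qSeries c α) = 0 := fun α r hr =>
    (hP α).coeff_odd (hre α) hr
  have hm := fun (n k : ℤ) (x t : ℝ) (i j : LocalPair.Row N) =>
    mSchur_eq_kernel (c := c) (B := B) (fun α => polyPhase_zero (a α) _)
      (fun α r hr hr' => taylor_polyPhase (a α) hr hr') n k x t i j
  have hz : ∀ (k : ℝ) (i : LocalPair.Row N), B.P i.1 0 - Complex.I * k ≠ 0 := fun k i =>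
    sub_I_mul_ne_zero (B.re_pos i.1) k
  refine (B.weights_reduces N).isBoundedRogueWave hodd
    ⟨∑ i : LocalPair.Row N, -2 * (B.P i.1 0).re, ∑ i : LocalPair.Row N, -2 * (B.P i.1 0 ^ 2).im, 0,
      _, _, norm_prod_neg_conj_div (hz c.k₁), norm_prod_neg_conj_div (hz c.k₂),
      fun x t => ⟨?_, ?_, ?_⟩⟩
  all_goals
    rw [tauSchur, blockDet_eq_det]
  · rw [← prod_base, ← det_scale]
    congr 1
    ext i j
    rw [Matrix.of_apply, Matrix.of_apply]
    refine (hm 0 0 x t i j).trans ?_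
    simp only [neg_zero, schurWeight_eq, zpow_zero, mul_one, taylorSeries_const_mul, map_mul,
      PowerSeries.map_C]
    rw [LocalPair.kernel_C_mul_left, LocalPair.kernel_C_mul_right, ← mul_assoc]
    rfl
  · refine det_shifted B c.k₁ x t fun i j => (hm 1 0 x t i j).trans ?_
    simp only [neg_zero, schurWeight_eq, zpow_zero, mul_one, taylorSeries_const_mul, zpow_neg_one,
      zpow_one, taylorSeries_mul_ratio, taylorSeries_mul_ratio_inv]
  · refine det_shifted B c.k₂ x t fun i j => (hm 0 1 x t i j).trans ?_
    simp only [neg_zero, schurWeight_eq, zpow_zero, mul_one, taylorSeries_const_mul, zpow_neg_one,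
      zpow_one, taylorSeries_mul_ratio, taylorSeries_mul_ratio_inv]

end SchurTheorem

end

end TwoLSRI

end

theorem theorem3 (c : TwoLSRI.Params) (p₀ : Fin 2 → ℂ)
    (hroot : ∀ α, TwoLSRI.IsSimpleRoot c (p₀ α))
    (hre : ∀ α, 0 < (p₀ α).re)
    (hne : p₀ 0 ≠ p₀ 1)
    (N : Fin 2 → ℕ) (hN : ∀ α, 0 < N α) :
    -- the local branches used below exist
    (∀ α, TwoLSRI.Q c (p₀ α) ≠ 0 ∧ (∃ T, TwoLSRI.IsBranchT c (p₀ α) T) ∧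
      (∃ W, TwoLSRI.IsBranchW c (p₀ α) W) ∧ (∃ P, TwoLSRI.IsBranchP c (p₀ α) P)) ∧
    -- (a) differential operator form
    (∀ (T W : Fin 2 → ℂ → ℂ) (a : Fin 2 → ℕ → ℂ),
      (∀ α, TwoLSRI.IsBranchT c (p₀ α) (T α)) →
      (∀ α, TwoLSRI.IsBranchW c (p₀ α) (W α)) →
      (∀ α, ∃ z : ℂ, z ≠ 0 ∧ Summable (fun r : ℕ => a α r * z ^ r)) →
      TwoLSRI.IsBoundedRogueWave c (TwoLSRI.tauOp c p₀ N T W a)) ∧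
    -- (b) Schur polynomial form
    (∀ (P : Fin 2 → ℂ → ℂ) (a : Fin 2 → ℕ → ℂ),
      (∀ α, TwoLSRI.IsBranchP c (p₀ α) (P α)) →
      TwoLSRI.IsBoundedRogueWave c (TwoLSRI.tauSchur c N P a)) := by
  exact ⟨fun α => ⟨TwoLSRI.Q_ne_zero_of_deriv_eq_zero (hre α) (hroot α).1,
      (hroot α).exists_branchT (hre α), (hroot α).exists_branchW (hre α),
      (hroot α).exists_branchP (hre α)⟩,
    fun _ _ _ hT hW ha => TwoLSRI.isBoundedRogueWave_tauOp hre hne hroot hT hW ha,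
    fun _ a hP => TwoLSRI.isBoundedRogueWave_tauSchur hre hne hroot a hP⟩
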